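/- **Setting.** Consider three particles in $\mathbb R^4$ with masses $m_1,m_2,m_3>0$. For a pair $\alpha=ij\in\{12,23,31\}$ with third particle $l$ put $$m_\alpha=\frac{m_im_j}{m_i+m_j},\qquad n_\alpha=\frac{m_l(m_i+m_j)}{m_1+m_2+m_3},$$ and on the momentum space $\{(k_1,k_2,k_3)\in(\mathbb R^4)^3:\ k_1+k_2+k_3=0\}\cong\mathbb R^4_{k_1}\times\mathbb R^4_{k_2}$ (Lebesgue measure $dk_1\,dk_2$) use the Jacobi momenta $$k_\alpha=\frac{m_jk_i-m_ik_j}{m_i+m_j},\qquad p_\alpha=\frac{m_l(k_i+k_j)-(m_i+m_j)k_l}{m_1+m_2+m_3}.$$ Let $H_0$ be multiplication by $H^0=\sum_i\frac{k_i^2}{2m_i}=\frac{k_\alpha^2}{2m_\alpha}+\frac{p_\alpha^2}{2n_\alpha}$ and $R_0(z)=(H_0-z)^{-1}$. Let $v_\alpha:\mathbb R^4\to\mathbb R$ be measurable potentials with $$v_\alpha(x)\le 0,\qquad |v_\alpha(x)|\le C_\alpha(1+|x|)^{-b_\alpha},\quad b_\alpha>4 .$$ Let $\Phi_\alpha$ be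 the partial Fourier transform $(\Phi_\alpha f)(k_\alpha,p_\alpha)=(2\pi)^{-2}\int_{\mathbb R^4}e^{-i\langle k_\alpha,x_\alpha\rangle}f(x_\alpha,p_\alpha)\,dx_\alpha$ (a unitary operator on $L^2$), and put $$|V_\alpha|^{1/2}=\Phi_\alpha|v_\alpha|^{1/2}\Phi_\alpha^*,\qquad K_{\alpha\beta}(z)=|V_\alpha|^{1/2}R_0(z)|V_\beta|^{1/2}.$$ For each $\alpha$ let $\tau_\alpha\in\mathbb R$, let $\mu_\alpha\in(-1,0)$ be such that $\ln|t|-\tau_\alpha<0$ for all $t\in[\mu_\alpha,0)$, and let $\zeta_\alpha\in C^\infty((-\infty,0))$ be a strictly positive function with $$\zeta_\alpha(t)=\sqrt{t(\ln|t|-\tau_\alpha)}\ \text{ for } t\in(\mu_\alpha,0),\qquad \zeta_\alpha(t)=1\ \text{ for } t\le -1 .$$ Let $\Gamma_\alpha(z)$ be multiplication by $\zeta_\alpha\!\left(z-\frac{p_\alpha^2}{2n_\alpha}\right)$. **Lemma.** Let $\alpha\neq\beta$. Then for every $z\le 0$ the operator $$M_{\alpha\beta}(z)=\Gamma_\alpha(z)^{-1}K_{\alpha\beta}(z)\Gamma_\beta(z)^{-1}$$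 is compact. Here products of unbounded operators are taken on their natural domains. For $z<0$ the operator $M_{\alpha\beta}(z)$ is defined on all of $L^2$ and compact. For $z=0$ it is densely defined and is the restriction of a (unique) compact operator on $L^2$. -/

import Mathlib

open MeasureTheory

noncomputable section

namespace ThreeBody

/-- One-particle space `ℝ⁴` with the Euclidean norm and Lebesgue measure. -/
abbrev E := EuclideanSpace ℝ (Fin 4)

/-- `L²(ℝ⁴)`. -/
abbrev L2One := Lp ℂ 2 (volume : Measure E)

/-- `L²(ℝ⁴ × ℝ⁴)`. -/
abbrev L2Two := Lp ℂ 2 (volume : Measure (E × E))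

/-! ### Partially defined operators -/

section Operators

variable {H₁ H₂ H₃ : Type*} [AddCommGroup H₁] [Module ℂ H₁] [AddCommGroup H₂] [Module ℂ H₂]
  [AddCommGroup H₃] [Module ℂ H₃]

/-- The product `B A` of partially defined operators on its natural domain
`{f ∈ D(A) | A f ∈ D(B)}`. -/
def prodOp (B : H₂ →ₗ.[ℂ] H₃) (A : H₁ →ₗ.[ℂ] H₂) : H₁ →ₗ.[ℂ] H₃ where
  domain := (B.domain.comap A.toFun).map A.domain.subtype
  toFun :=
    { toFun := fun f => B ⟨A ⟨f, by
          obtain ⟨g, -, hg⟩ := f.2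
          exact hg ▸ g.2⟩, by
          obtain ⟨f, g, hgB, rfl⟩ := f
          exact hgB⟩
      map_add' := fun f g => by
        rw [← LinearPMap.map_add]
        congr 1
        exact Subtype.ext (A.map_add ⟨f, _⟩ ⟨g, _⟩)
      map_smul' := fun c f => by
        rw [RingHom.id_apply, ← LinearPMap.map_smul]
        congr 1
        exact Subtype.ext (A.map_smul c ⟨f, _⟩) }

theorem mem_prodOp_domain (B : H₂ →ₗ.[ℂ] H₃) (A : H₁ →ₗ.[ℂ] H₂) (f : H₁) :
    f ∈ (prodOp B A).domain ↔ ∃ hf : f ∈ A.domain, A ⟨f, hf⟩ ∈ B.domain := by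
  constructor
  · rintro ⟨g, hg, rfl⟩
    exact ⟨g.2, hg⟩
  · rintro ⟨hf, h⟩
    exact ⟨⟨f, hf⟩, h, rfl⟩

end Operators

/-- Multiplication by the function `a` in `L²(μ)` on its maximal domain
`{f ∈ L² | a f ∈ L²}`. -/
def mulOp {X : Type*} [MeasurableSpace X] {μ : Measure X} (a : X → ℂ) :
    Lp ℂ 2 μ →ₗ.[ℂ] Lp ℂ 2 μ where
  domain :=
    { carrier := {f | MemLp (fun x => a x * f x) 2 μ}
      add_mem' := fun {f g} hf hg => by
        refine (MemLp.add hf hg).ae_eq ?_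
        filter_upwards [Lp.coeFn_add f g] with x hx
        rw [hx]
        exact (mul_add _ _ _).symm
      zero_mem' := by
        refine (MemLp.zero' (ε := ℂ)).ae_eq ?_
        filter_upwards [Lp.coeFn_zero ℂ 2 μ] with x hx
        rw [hx]
        exact (mul_zero _).symm
      smul_mem' := fun c f hf => by
        refine (MemLp.const_smul hf c).ae_eq ?_
        filter_upwards [Lp.coeFn_smul c f] with x hx
        rw [hx]
        exact mul_left_comm _ _ _ }
  toFun :=
    { toFun := fun f => MemLp.toLp (fun x => a x * (f : Lp ℂ 2 μ) x) f.2
      map_add' := fun f g => by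
        rw [← MemLp.toLp_add]
        apply MemLp.toLp_congr
        filter_upwards [Lp.coeFn_add (f : Lp ℂ 2 μ) (g : Lp ℂ 2 μ)] with x hx
        simp only [Submodule.coe_add, Pi.add_apply] at hx ⊢
        rw [hx, mul_add]
      map_smul' := fun c f => by
        rw [RingHom.id_apply, ← MemLp.toLp_const_smul]
        apply MemLp.toLp_congr
        filter_upwards [Lp.coeFn_smul c (f : Lp ℂ 2 μ)] with x hx
        simp only [Submodule.coe_smul, Pi.smul_apply, smul_eq_mul] at hx ⊢
        rw [hx, mul_left_comm] }

/-- The operator `U A U⁻¹`, for a unitary `U`. -/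
def conjOp {H₁ H₂ : Type*} [NormedAddCommGroup H₁] [NormedSpace ℂ H₁] [NormedAddCommGroup H₂]
    [NormedSpace ℂ H₂] (U : H₁ ≃ₗᵢ[ℂ] H₂) (A : H₁ →ₗ.[ℂ] H₁) : H₂ →ₗ.[ℂ] H₂ :=
  prodOp ((U.toLinearEquiv : H₁ →ₗ[ℂ] H₂).toPMap ⊤)
    (prodOp A ((U.symm.toLinearEquiv : H₂ →ₗ[ℂ] H₁).toPMap ⊤))

/-! ### The unitary Fourier transform of `L²(ℝ⁴)` and its partial version -/

theorem eLpNorm_two_sq {X V : Type*} [MeasurableSpace X] [NormedAddCommGroup V] (μ : Measure X)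
    (f : X → V) : eLpNorm f 2 μ ^ 2 = ∫⁻ x, ‖f x‖ₑ ^ 2 ∂μ := by
  have := eLpNorm_nnreal_pow_eq_lintegral (f := f) (μ := μ) (p := 2) two_ne_zero
  simpa using this

theorem memLp_two_iff {X V : Type*} [MeasurableSpace X] [NormedAddCommGroup V] (μ : Measure X)
    {f : X → V} (hf : AEStronglyMeasurable f μ) :
    MemLp f 2 μ ↔ ∫⁻ x, ‖f x‖ₑ ^ 2 ∂μ < ⊤ := by
  rw [← eLpNorm_two_sq, MemLp, and_iff_right hf]
  simp

theorem lintegral_dilate (F : E → ENNReal) :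
    ∫⁻ k, F ((2 * Real.pi)⁻¹ • k) = ENNReal.ofReal ((2 * Real.pi) ^ 4) * ∫⁻ x, F x := by
  have h0 : (2 * Real.pi)⁻¹ ≠ 0 := by positivity
  have h1 := (Homeomorph.smulOfNeZero (α := E) (2 * Real.pi)⁻¹ h0).measurableEmbedding.lintegral_map
    (μ := volume) F
  have h2 := Measure.map_addHaar_smul (volume : Measure E) h0
  simp only [Homeomorph.smulOfNeZero_apply] at h1
  change ∫⁻ a, F a ∂(Measure.map (fun x : E => (2 * Real.pi)⁻¹ • x) volume) = _ at h1
  rw [← h1, h2, lintegral_smul_measure]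
  simp only [finrank_euclideanSpace, Fintype.card_fin, smul_eq_mul]
  congr 2
  rw [abs_of_pos (by positivity), ← inv_pow, inv_inv]

theorem quasi_dilate (c : ℝ) (hc : c ≠ 0) :
    Measure.QuasiMeasurePreserving (fun k : E => c • k) volume volume := by
  refine ⟨measurable_const_smul c, ?_⟩
  rw [Measure.map_addHaar_smul (volume : Measure E) hc]
  exact Measure.smul_absolutelyContinuous

theorem eLpNorm_dilate (g : L2One) :
    eLpNorm (fun k : E => (((2 * Real.pi) ^ 2)⁻¹ : ℂ) * g ((2 * Real.pi)⁻¹ • k)) 2 volume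
      = eLpNorm g 2 volume := by
  have h : eLpNorm (fun k : E => (((2 * Real.pi) ^ 2)⁻¹ : ℂ) * g ((2 * Real.pi)⁻¹ • k)) 2 volume ^ 2
      = eLpNorm g 2 volume ^ 2 := by
    rw [eLpNorm_two_sq, eLpNorm_two_sq]
    have hmul : ∀ k : E, ‖(((2 * Real.pi) ^ 2)⁻¹ : ℂ) * g ((2 * Real.pi)⁻¹ • k)‖ₑ ^ 2
        = ‖(((2 * Real.pi) ^ 2)⁻¹ : ℂ)‖ₑ ^ 2 * ‖g ((2 * Real.pi)⁻¹ • k)‖ₑ ^ 2 := fun k => by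
      rw [enorm_mul, mul_pow]
    simp_rw [hmul]
    rw [lintegral_const_mul' _ _ (ENNReal.pow_ne_top enorm_ne_top)]
    rw [lintegral_dilate (fun x => ‖g x‖ₑ ^ 2), ← mul_assoc]
    have : ‖(((2 * Real.pi) ^ 2)⁻¹ : ℂ)‖ₑ ^ 2 * ENNReal.ofReal ((2 * Real.pi) ^ 4) = 1 := by
      rw [← ofReal_norm, ← ENNReal.ofReal_pow (norm_nonneg _),
        ← ENNReal.ofReal_mul (by positivity)]
      rw [show ‖(((2 * Real.pi) ^ 2)⁻¹ : ℂ)‖ ^ 2 * (2 * Real.pi) ^ 4 = 1 from ?_]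
      · simp
      · have hp := Real.pi_pos
        simp only [norm_inv, norm_pow, norm_mul, Complex.norm_ofNat, Complex.norm_real,
          Real.norm_eq_abs, abs_of_pos hp]
        field_simp
    rw [this, one_mul]
  exact (ENNReal.pow_right_strictMono two_ne_zero).injective h

theorem memLp_dilate (g : L2One) :
    MemLp (fun k : E => (((2 * Real.pi) ^ 2)⁻¹ : ℂ) * g ((2 * Real.pi)⁻¹ • k)) 2 volume := by
  refine ⟨?_, ?_⟩
  · exact ((Lp.aestronglyMeasurable g).comp_quasiMeasurePreserving
      (quasi_dilate _ (by positivity))).const_mul _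
  · rw [eLpNorm_dilate]
    exact Lp.eLpNorm_lt_top g

/-- The dilation `(D g)(k) = (2π)⁻² g(k / 2π)`, as an isometry of `L²(ℝ⁴)`. -/
def dilateIsometry : L2One →ₗᵢ[ℂ] L2One where
  toFun g := (memLp_dilate g).toLp
  map_add' f g := by
    rw [← MemLp.toLp_add]
    apply MemLp.toLp_congr
    filter_upwards [(quasi_dilate (2 * Real.pi)⁻¹ (by positivity)).ae (Lp.coeFn_add f g)] with x hx
    simp only [Pi.add_apply] at hx ⊢
    rw [hx, mul_add]
  map_smul' c f := by
    rw [RingHom.id_apply, ← MemLp.toLp_const_smul]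
    apply MemLp.toLp_congr
    filter_upwards [(quasi_dilate (2 * Real.pi)⁻¹ (by positivity)).ae (Lp.coeFn_smul c f)]
      with x hx
    simp only [Pi.smul_apply, smul_eq_mul] at hx ⊢
    rw [hx, mul_left_comm]
  norm_map' g := by
    change ‖(memLp_dilate g).toLp‖ = ‖g‖
    rw [Lp.norm_toLp, eLpNorm_dilate, Lp.norm_def]

theorem dilateIsometry_surjective : Function.Surjective dilateIsometry := by
  intro g
  have h2 : (2 * Real.pi) ≠ 0 := by positivity
  have hq := quasi_dilate (2 * Real.pi) h2
  have hq' := quasi_dilate (2 * Real.pi)⁻¹ (inv_ne_zero h2)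
  have hc : ((2 * Real.pi : ℂ) ^ 2) ≠ 0 := by
    exact_mod_cast pow_ne_zero 2 h2
  have hmeas : AEStronglyMeasurable
      (fun x : E => ((2 * Real.pi : ℂ) ^ 2) * g ((2 * Real.pi) • x)) volume :=
    ((Lp.aestronglyMeasurable g).comp_quasiMeasurePreserving hq).const_mul _
  have hmem : MemLp (fun x : E => ((2 * Real.pi : ℂ) ^ 2) * g ((2 * Real.pi) • x)) 2 volume := by
    rw [memLp_two_iff _ hmeas]
    have hmul : ∀ y : E, ‖((2 * Real.pi : ℂ) ^ 2) * g y‖ₑ ^ 2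
        = ‖((2 * Real.pi : ℂ) ^ 2)‖ₑ ^ 2 * ‖g y‖ₑ ^ 2 := fun y => by rw [enorm_mul, mul_pow]
    have h3 := lintegral_dilate
      (fun x : E => ‖((2 * Real.pi : ℂ) ^ 2) * g ((2 * Real.pi) • x)‖ₑ ^ 2)
    simp only [smul_inv_smul₀ h2] at h3
    simp_rw [hmul] at h3 ⊢
    rw [lintegral_const_mul' _ _ (ENNReal.pow_ne_top enorm_ne_top), ← eLpNorm_two_sq] at h3
    have h4 : ENNReal.ofReal ((2 * Real.pi) ^ 4) ≠ 0 := by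
      simp only [ne_eq, ENNReal.ofReal_eq_zero, not_le]
      positivity
    by_contra hcon
    rw [not_lt, top_le_iff] at hcon
    rw [hcon, ENNReal.mul_top h4] at h3
    exact ENNReal.mul_ne_top (ENNReal.pow_ne_top enorm_ne_top) (ENNReal.pow_ne_top (Lp.eLpNorm_ne_top g)) h3
  refine ⟨hmem.toLp, ?_⟩
  apply Lp.ext
  refine (MemLp.coeFn_toLp (memLp_dilate hmem.toLp)).trans ?_
  filter_upwards [hq'.ae (MemLp.coeFn_toLp hmem)] with x hx
  rw [hx, smul_inv_smul₀ h2, inv_mul_cancel_left₀ hc]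

/-- The unitary Fourier transform
`(𝓕 f)(k) = (2π)⁻² ∫ e^{-i⟨k,x⟩} f(x) dx` of `L²(ℝ⁴)`. (Mathlib's transform has the kernel
`e^{-2πi⟨k,x⟩}`, so it is followed by a dilation.) -/
def fourierL2 : L2One ≃ₗᵢ[ℂ] L2One :=
  (Lp.fourierTransformₗᵢ E ℂ).trans
    (LinearIsometryEquiv.ofSurjective dilateIsometry dilateIsometry_surjective)

/-- The slice `x ↦ f (p, x)`, as an element of `L²(ℝ⁴)` (for almost every `p`). -/
def slice (f : L2Two) (p : E) : L2One :=
  open scoped Classical in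
  if h : MemLp (fun x => f (p, x)) 2 volume then h.toLp else 0

theorem sm_two (f : L2Two) : StronglyMeasurable (f : E × E → ℂ) := Lp.stronglyMeasurable f

theorem sm_slice (f : L2Two) (p : E) : StronglyMeasurable (fun x => f (p, x)) :=
  (sm_two f).comp_measurable measurable_prodMk_left

theorem lintegral_slice (f : L2Two) :
    ∫⁻ p, ∫⁻ x, ‖f (p, x)‖ₑ ^ 2 = eLpNorm f 2 volume ^ 2 := by
  rw [eLpNorm_two_sq]
  exact (lintegral_prod _ ((sm_two f).enorm.pow_const 2).aemeasurable).symm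

theorem measurable_slice_sq (f : L2Two) : Measurable fun p => ∫⁻ x, ‖f (p, x)‖ₑ ^ 2 :=
  Measurable.lintegral_prod_right' (f := fun q : E × E => ‖f q‖ₑ ^ 2)
    ((sm_two f).enorm.pow_const 2)

theorem ae_memLp_slice (f : L2Two) : ∀ᵐ p : E, MemLp (fun x => f (p, x)) 2 volume := by
  have h : ∀ᵐ p : E, ∫⁻ x, ‖f (p, x)‖ₑ ^ 2 < ⊤ := by
    refine ae_lt_top (measurable_slice_sq f) ?_
    rw [lintegral_slice]
    exact ENNReal.pow_ne_top (Lp.eLpNorm_ne_top f)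
  filter_upwards [h] with p hp
  exact (memLp_two_iff _ (sm_slice f p).aestronglyMeasurable).2 hp

theorem slice_ae (f : L2Two) : ∀ᵐ p : E, slice f p =ᵐ[volume] fun x => f (p, x) := by
  filter_upwards [ae_memLp_slice f] with p hp
  rw [slice, dif_pos hp]
  exact hp.coeFn_toLp

instance factTwo : Fact ((2 : ENNReal) ≠ ⊤) := ⟨ENNReal.ofNat_ne_top⟩

theorem measurable_of_edist {X Y : Type*} [MeasurableSpace X] [PseudoEMetricSpace Y]
    [SecondCountableTopology Y] [MeasurableSpace Y] [BorelSpace Y] (F : X → Y)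
    (h : ∀ y, Measurable fun x => edist (F x) y) : Measurable F := by
  refine measurable_of_isOpen fun U hU => ?_
  have hcov : ∀ y : U, ∃ ε > 0, Metric.eball (y : Y) ε ⊆ U :=
    fun y => EMetric.isOpen_iff.1 hU y y.2
  choose ε hε hsub using hcov
  obtain ⟨T, hT, hTU⟩ := TopologicalSpace.isOpen_iUnion_countable
    (fun y : U => Metric.eball (y : Y) (ε y)) (fun y => Metric.isOpen_eball)
  have hU' : U = ⋃ y ∈ T, Metric.eball (y : Y) (ε y) := by
    rw [hTU]
    apply Set.Subset.antisymm
    · exact fun y hy => Set.mem_iUnion.2 ⟨⟨y, hy⟩, Metric.mem_eball_self (hε _)⟩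
    · exact Set.iUnion_subset hsub
  rw [hU', Set.preimage_iUnion₂]
  refine MeasurableSet.biUnion hT fun y _ => ?_
  exact measurableSet_lt (h y) measurable_const

theorem sm_sliceMap (f : L2Two) : StronglyMeasurable (slice f) := by
  borelize ↥L2One
  refine (measurable_of_edist _ fun g => ?_).stronglyMeasurable
  have hS : MeasurableSet {p : E | ∫⁻ x, ‖f (p, x)‖ₑ ^ 2 < ⊤} :=
    measurableSet_lt (measurable_slice_sq f) measurable_const
  have hD : Measurable fun p : E => ∫⁻ x, ‖f (p, x) - g x‖ₑ ^ 2 := by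
    refine Measurable.lintegral_prod_right' (f := fun q : E × E => ‖f q - g q.2‖ₑ ^ 2) ?_
    exact (((sm_two f).sub ((Lp.stronglyMeasurable g).comp_measurable
      measurable_snd)).enorm.pow_const 2)
  classical
  have hform : (fun p => edist (slice f p) g) = fun p =>
      if p ∈ {p : E | ∫⁻ x, ‖f (p, x)‖ₑ ^ 2 < ⊤} then
        (∫⁻ x, ‖f (p, x) - g x‖ₑ ^ 2) ^ (1 / 2 : ℝ) else edist 0 g := by
    funext p
    by_cases hp : ∫⁻ x, ‖f (p, x)‖ₑ ^ 2 < ⊤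
    · have hm : MemLp (fun x => f (p, x)) 2 volume :=
        (memLp_two_iff _ (sm_slice f p).aestronglyMeasurable).2 hp
      rw [if_pos (show p ∈ {p : E | ∫⁻ x, ‖f (p, x)‖ₑ ^ 2 < ⊤} from hp), slice, dif_pos hm, Lp.edist_def]
      have h1 : eLpNorm (⇑hm.toLp - ⇑g) 2 volume
          = eLpNorm (fun x => f (p, x) - g x) 2 volume := by
        apply eLpNorm_congr_ae
        filter_upwards [hm.coeFn_toLp] with x hx
        simp [hx]
      rw [h1, ← eLpNorm_two_sq, ← ENNReal.rpow_natCast, ← ENNReal.rpow_mul]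
      norm_num
    · have hm : ¬ MemLp (fun x => f (p, x)) 2 volume := fun hm =>
        hp ((memLp_two_iff _ (sm_slice f p).aestronglyMeasurable).1 hm)
      rw [if_neg (show p ∉ {p : E | ∫⁻ x, ‖f (p, x)‖ₑ ^ 2 < ⊤} from hp), slice, dif_neg hm]
  rw [hform]
  exact Measurable.ite hS (hD.pow_const _) measurable_const

theorem lintegral_sliceMap (f : L2Two) :
    ∫⁻ p, ‖slice f p‖ₑ ^ 2 = eLpNorm f 2 volume ^ 2 := by
  rw [← lintegral_slice]
  apply lintegral_congr_ae
  filter_upwards [slice_ae f] with p hp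
  rw [← eLpNorm_two_sq, ← eLpNorm_congr_ae hp, Lp.enorm_def]

theorem memLp_sliceMap (f : L2Two) : MemLp (slice f) 2 volume := by
  rw [memLp_two_iff _ (sm_sliceMap f).aestronglyMeasurable, lintegral_sliceMap]
  exact ENNReal.pow_lt_top (Lp.eLpNorm_lt_top f)

theorem slice_eq_of_ae (f : L2Two) (F : E × E → ℂ) (hF : f =ᵐ[volume] F) (G : E → L2One)
    (hG : ∀ᵐ p : E, G p =ᵐ[volume] fun x => F (p, x)) : slice f =ᵐ[volume] G := by
  have h := Measure.ae_ae_of_ae_prod hF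
  filter_upwards [h, slice_ae f, hG] with p h1 h2 h3
  refine Lp.ext ?_
  filter_upwards [h1, h2, h3] with x e1 e2 e3
  rw [e2, e1, e3]

/-- The identification of `L²(ℝ⁴ × ℝ⁴)` with `L²(ℝ⁴; L²(ℝ⁴))` by slices, as an isometry. -/
def sliceIsometry : L2Two →ₗᵢ[ℂ] Lp L2One 2 (volume : Measure E) where
  toFun f := (memLp_sliceMap f).toLp
  map_add' f g := by
    rw [← MemLp.toLp_add]
    apply MemLp.toLp_congr
    refine slice_eq_of_ae _ _ (Lp.coeFn_add f g) _ ?_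
    filter_upwards [slice_ae f, slice_ae g] with p h1 h2
    filter_upwards [h1, h2, Lp.coeFn_add (slice f p) (slice g p)] with x e1 e2 e3
    simp only [Pi.add_apply] at e3 ⊢
    rw [e3, e1, e2]
  map_smul' c f := by
    rw [RingHom.id_apply, ← MemLp.toLp_const_smul]
    apply MemLp.toLp_congr
    refine slice_eq_of_ae _ _ (Lp.coeFn_smul c f) _ ?_
    filter_upwards [slice_ae f] with p h1
    filter_upwards [h1, Lp.coeFn_smul c (slice f p)] with x e1 e3
    simp only [Pi.smul_apply] at e3 ⊢
    rw [e3, e1]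
  norm_map' f := by
    change ‖(memLp_sliceMap f).toLp‖ = ‖f‖
    rw [Lp.norm_toLp, Lp.norm_def]
    congr 1
    apply (ENNReal.pow_right_strictMono two_ne_zero).injective
    change eLpNorm (slice f) 2 volume ^ 2 = eLpNorm f 2 volume ^ 2
    rw [eLpNorm_two_sq, lintegral_sliceMap]

theorem sliceIsometry_surjective : Function.Surjective sliceIsometry := by
  have hclosed : IsClosed (Set.range sliceIsometry) :=
    sliceIsometry.isometry.isClosedEmbedding.isClosed_range
  intro F
  refine Lp.induction (p := 2) ENNReal.ofNat_ne_top
    (motive := fun F => ∃ f, sliceIsometry f = F) ?_ ?_ hclosed F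
  · intro c s hs hμs
    have hm : MemLp (fun q : E × E => s.indicator (fun _ => (1 : ℂ)) q.1 * c q.2) 2 volume := by
      have hmeas : StronglyMeasurable
          (fun q : E × E => s.indicator (fun _ => (1 : ℂ)) q.1 * c q.2) :=
        ((stronglyMeasurable_const.indicator hs).comp_measurable measurable_fst).mul
          ((Lp.stronglyMeasurable c).comp_measurable measurable_snd)
      rw [memLp_two_iff _ hmeas.aestronglyMeasurable]
      change ∫⁻ q, _ ∂((volume : Measure E).prod (volume : Measure E)) < ⊤
      rw [lintegral_prod _ (hmeas.enorm.pow_const 2).aemeasurable]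
      simp_rw [enorm_mul, mul_pow]
      have h1 : ∀ p : E, ∫⁻ y, ‖s.indicator (fun _ => (1 : ℂ)) p‖ₑ ^ 2 * ‖c y‖ₑ ^ 2
          = s.indicator (fun _ => (1 : ENNReal)) p * eLpNorm c 2 volume ^ 2 := by
        intro p
        rw [lintegral_const_mul' _ _ (by simp), eLpNorm_two_sq]
        congr 1
        by_cases hp : p ∈ s <;> simp [hp]
      simp_rw [h1]
      rw [lintegral_mul_const' _ _ (ENNReal.pow_ne_top (Lp.eLpNorm_ne_top c)),
        lintegral_indicator hs]
      refine ENNReal.mul_lt_top ?_ (ENNReal.pow_lt_top (Lp.eLpNorm_lt_top c))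
      simpa using hμs
    refine ⟨hm.toLp, ?_⟩
    apply Lp.ext
    refine (MemLp.coeFn_toLp (memLp_sliceMap hm.toLp)).trans ?_
    rw [Lp.simpleFunc.coe_indicatorConst]
    refine Filter.EventuallyEq.trans ?_ indicatorConstLp_coeFn.symm
    refine slice_eq_of_ae _ _ hm.coeFn_toLp _ (Filter.Eventually.of_forall fun p => ?_)
    by_cases hp : p ∈ s
    · simp [hp]
    · simp only [Set.indicator_of_notMem hp, zero_mul]
      exact Lp.coeFn_zero ℂ 2 volume
  · rintro f g hf hg - ⟨f', h1⟩ ⟨g', h2⟩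
    exact ⟨f' + g', by rw [map_add, h1, h2]⟩

/-- The unitary identification of `L²(ℝ⁴ × ℝ⁴)` with `L²(ℝ⁴; L²(ℝ⁴))`. -/
def sliceEquiv : L2Two ≃ₗᵢ[ℂ] Lp L2One 2 (volume : Measure E) :=
  LinearIsometryEquiv.ofSurjective sliceIsometry sliceIsometry_surjective

theorem compLp_cancel (A B : L2One →L[ℂ] L2One) (h : ∀ u, A (B u) = u)
    (F : Lp L2One 2 (volume : Measure E)) : A.compLpL 2 volume (B.compLpL 2 volume F) = F := by
  apply Lp.ext
  filter_upwards [A.coeFn_compLpL (p := 2) (B.compLpL 2 volume F), B.coeFn_compLpL (p := 2) F]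
    with p h1 h2
  rw [h1, h2, h]

/-- A unitary of `L²(ℝ⁴)` acting pointwise on `L²(ℝ⁴; L²(ℝ⁴))`. -/
def fiberwise (A : L2One ≃ₗᵢ[ℂ] L2One) :
    Lp L2One 2 (volume : Measure E) ≃ₗᵢ[ℂ] Lp L2One 2 (volume : Measure E) where
  toFun F := (A : L2One →L[ℂ] L2One).compLpL 2 volume F
  invFun F := (A.symm : L2One →L[ℂ] L2One).compLpL 2 volume F
  left_inv F := compLp_cancel _ _ A.symm_apply_apply F
  right_inv F := compLp_cancel _ _ A.apply_symm_apply F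
  map_add' F G := map_add _ F G
  map_smul' c F := map_smul _ c F
  norm_map' F := by
    change ‖(A : L2One →L[ℂ] L2One).compLpL 2 volume F‖ = ‖F‖
    rw [Lp.norm_def, Lp.norm_def]
    congr 1
    apply eLpNorm_congr_norm_ae
    filter_upwards [(A : L2One →L[ℂ] L2One).coeFn_compLpL (p := 2) F] with p hp
    rw [hp]
    exact A.norm_map _

/-- The partial Fourier transform `Φ`, from functions of `(p, x)` to functions of `(p, k)`: for
almost every `p`, the slice `(Φ f)(p, ·)` is the Fourier transform of `f(p, ·)`. -/
def partialFourier : L2Two ≃ₗᵢ[ℂ] L2Two :=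
  (sliceEquiv.trans (fiberwise fourierL2)).trans sliceEquiv.symm

theorem slice_partialFourier (f : L2Two) :
    ∀ᵐ p : E, slice (partialFourier f) p = fourierL2 (slice f p) := by
  have h : sliceEquiv (partialFourier f) = fiberwise fourierL2 (sliceEquiv f) := by
    simp [partialFourier]
  have h1 : sliceEquiv (partialFourier f) =ᵐ[volume] slice (partialFourier f) :=
    MemLp.coeFn_toLp (memLp_sliceMap _)
  have h2 : sliceEquiv f =ᵐ[volume] slice f := MemLp.coeFn_toLp (memLp_sliceMap _)
  have h3 : fiberwise fourierL2 (sliceEquiv f) =ᵐ[volume] fun p => fourierL2 (sliceEquiv f p) :=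
    (fourierL2 : L2One →L[ℂ] L2One).coeFn_compLpL (p := 2) (sliceEquiv f)
  rw [h] at h1
  filter_upwards [h1, h2, h3] with p e1 e2 e3
  rw [← e1, e3, e2]

/-! ### Kinematics of three particles in the centre-of-mass frame

Particles are indexed by `Fin 3`. The pair `α : Fin 3` consists of the particles `α` and `α + 1`
(cyclically), the third particle is `α + 2`; thus `0, 1, 2` stand for the pairs `12, 23, 31`.
The momentum space of the relative motion is `{(k₁, k₂, k₃) | k₁ + k₂ + k₃ = 0}`, parametrised by
`(k₁, k₂) ∈ ℝ⁴ × ℝ⁴`. -/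

/-- The three momenta `(k₁, k₂, k₃)`, with `k₃ = - k₁ - k₂`. -/
def momenta (q : E × E) : Fin 3 → E := ![q.1, q.2, -q.1 - q.2]

/-- The reduced mass `m_α` of the pair `α`. -/
def redMass (m : Fin 3 → ℝ) (α : Fin 3) : ℝ := m α * m (α + 1) / (m α + m (α + 1))

/-- The reduced mass `n_α` of the pair `α` and the third particle. -/
def redMassThird (m : Fin 3 → ℝ) (α : Fin 3) : ℝ :=
  m (α + 2) * (m α + m (α + 1)) / (m 0 + m 1 + m 2)

/-- The Jacobi momentum `k_α = (m_j k_i - m_i k_j) / (m_i + m_j)` of the pair `α = ij`. -/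
def pairMomentum (m : Fin 3 → ℝ) (α : Fin 3) (q : E × E) : E :=
  (m α + m (α + 1))⁻¹ • (m (α + 1) • momenta q α - m α • momenta q (α + 1))

/-- The Jacobi momentum `p_α = (m_l (k_i + k_j) - (m_i + m_j) k_l) / (m_1 + m_2 + m_3)` for the pair
`α = ij` and the third particle `l`. -/
def thirdMomentum (m : Fin 3 → ℝ) (α : Fin 3) (q : E × E) : E :=
  (m 0 + m 1 + m 2)⁻¹ •
    (m (α + 2) • (momenta q α + momenta q (α + 1)) - (m α + m (α + 1)) • momenta q (α + 2))

/-- The kinetic energy `H⁰ = k₁²/2m₁ + k₂²/2m₂ + k₃²/2m₃`. -/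
def kinetic (m : Fin 3 → ℝ) (q : E × E) : ℝ := ∑ i, ‖momenta q i‖ ^ 2 / (2 * m i)

theorem kinetic_eq (m : Fin 3 → ℝ) (hm : ∀ i, 0 < m i) (α : Fin 3) (q : E × E) :
    kinetic m q = ‖pairMomentum m α q‖ ^ 2 / (2 * redMass m α)
      + ‖thirdMomentum m α q‖ ^ 2 / (2 * redMassThird m α) := by
  obtain ⟨x, y⟩ := q
  have h0 := (hm 0).ne'
  have h1 := (hm 1).ne'
  have h2 := (hm 2).ne'
  have h01 := (add_pos (hm 0) (hm 1)).ne'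
  have h12 := (add_pos (hm 1) (hm 2)).ne'
  have h20 := (add_pos (hm 2) (hm 0)).ne'
  have hM := (add_pos (add_pos (hm 0) (hm 1)) (hm 2)).ne'
  have key : ∀ a b : ℝ, ‖a • x + b • y‖ ^ 2
      = a ^ 2 * ‖x‖ ^ 2 + 2 * a * b * inner ℝ x y + b ^ 2 * ‖y‖ ^ 2 := fun a b => by
    rw [norm_add_sq_real, norm_smul, norm_smul, inner_smul_left, inner_smul_right, mul_pow,
      mul_pow, Real.norm_eq_abs, Real.norm_eq_abs, sq_abs, sq_abs]
    simp only [conj_trivial]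
    ring
  have lin : ∀ (u : E) (a b : ℝ), u = a • x + b • y → ‖u‖ ^ 2
      = a ^ 2 * ‖x‖ ^ 2 + 2 * a * b * inner ℝ x y + b ^ 2 * ‖y‖ ^ 2 := fun u a b h => h ▸ key a b
  have third : ‖-x - y‖ ^ 2 = ‖x‖ ^ 2 + 2 * inner ℝ x y + ‖y‖ ^ 2 := by
    rw [lin (-x - y) (-1) (-1) (by module)]
    ring
  have hK : kinetic m (x, y) = ‖x‖ ^ 2 / (2 * m 0) + ‖y‖ ^ 2 / (2 * m 1)
      + (‖x‖ ^ 2 + 2 * inner ℝ x y + ‖y‖ ^ 2) / (2 * m 2) := by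
    simp [kinetic, Fin.sum_univ_three, momenta, third]
  rw [hK]
  fin_cases α
  · rw [lin (pairMomentum m _ (x, y)) (m 1 / (m 0 + m 1)) (-(m 0 / (m 0 + m 1)))
        (by simp [pairMomentum, momenta]; module),
      lin (thirdMomentum m _ (x, y)) 1 1 (by
        simp [thirdMomentum, momenta]
        rw [inv_smul_eq_iff₀ hM]
        module)]
    simp [redMass, redMassThird]
    field_simp
    ring
  · rw [lin (pairMomentum m _ (x, y)) (m 1 / (m 1 + m 2)) 1 (by
          simp [pairMomentum, momenta]
          rw [inv_smul_eq_iff₀ h12, smul_add, smul_smul, mul_div_cancel₀ _ h12]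
          module),
      lin (thirdMomentum m _ (x, y)) (-1) 0 (by
        simp [thirdMomentum, momenta]
        rw [inv_smul_eq_iff₀ hM]
        module)]
    simp [redMass, redMassThird]
    field_simp
    ring
  · rw [lin (pairMomentum m _ (x, y)) (-1) (-(m 0 / (m 2 + m 0))) (by
          simp [pairMomentum, momenta]
          rw [inv_smul_eq_iff₀ h20, smul_add, smul_neg, smul_neg, smul_smul, mul_div_cancel₀ _ h20]
          module),
      lin (thirdMomentum m _ (x, y)) 0 (-1) (by
        simp [thirdMomentum, momenta]
        rw [inv_smul_eq_iff₀ hM]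
        module)]
    simp [redMass, redMassThird]
    field_simp
    ring

/-- The coordinates `(p_α, k_α)` of a point of momentum space. -/
def jacobi (m : Fin 3 → ℝ) (α : Fin 3) (q : E × E) : E × E :=
  (thirdMomentum m α q, pairMomentum m α q)

/-- The inverse of `jacobi`. -/
def jacobiInv (m : Fin 3 → ℝ) (α : Fin 3) (w : E × E) : E × E :=
  let k : Fin 3 → E := fun s =>
    if s = α then w.2 + (m α / (m α + m (α + 1))) • w.1
    else if s = α + 1 then -w.2 + (m (α + 1) / (m α + m (α + 1))) • w.1
    else -w.1
  (k 0, k 1)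

/-- `jacobi`, with the total momentum zero used to simplify `p_α`. -/
theorem jacobi_eq (m : Fin 3 → ℝ) (hm : ∀ i, 0 < m i) (α : Fin 3) (x y : E) :
    jacobi m α (x, y) =
      ![(x + y, x + (-(m 0 / (m 0 + m 1))) • (x + y)), (-x, y + (m 1 / (m 1 + m 2)) • x),
        (-y, -x + (-(m 0 / (m 2 + m 0))) • y)] α := by
  have h01 := (add_pos (hm 0) (hm 1)).ne'
  have h12 := (add_pos (hm 1) (hm 2)).ne'
  have h20 := (add_pos (hm 2) (hm 0)).ne'
  have hM := (add_pos (add_pos (hm 0) (hm 1)) (hm 2)).ne'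
  fin_cases α
  · refine Prod.ext ?_ ?_
    · simp [jacobi, thirdMomentum, momenta]
      rw [inv_smul_eq_iff₀ hM]
      module
    · simp [jacobi, pairMomentum, momenta]
      rw [inv_smul_eq_iff₀ h01, smul_add, smul_add, smul_neg, smul_neg, smul_smul, smul_smul,
        mul_div_cancel₀ _ h01]
      module
  · refine Prod.ext ?_ ?_
    · simp [jacobi, thirdMomentum, momenta]
      rw [inv_smul_eq_iff₀ hM]
      module
    · simp [jacobi, pairMomentum, momenta]
      rw [inv_smul_eq_iff₀ h12, smul_add, smul_smul, mul_div_cancel₀ _ h12]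
      module
  · refine Prod.ext ?_ ?_
    · simp [jacobi, thirdMomentum, momenta]
      rw [inv_smul_eq_iff₀ hM]
      module
    · simp [jacobi, pairMomentum, momenta]
      rw [inv_smul_eq_iff₀ h20, smul_add, smul_neg, smul_neg, smul_smul, mul_div_cancel₀ _ h20]
      module

theorem measurePreserving_jacobi (m : Fin 3 → ℝ) (hm : ∀ i, 0 < m i) (α : Fin 3) :
    MeasurePreserving (jacobi m α) volume volume := by
  have hid : MeasurePreserving (fun x : E => x) volume volume := MeasurePreserving.id _
  have hneg : MeasurePreserving (fun x : E => -x) volume volume := Measure.measurePreserving_neg _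
  have shear : ∀ (f g : E → E), MeasurePreserving f volume volume → Measurable g →
      MeasurePreserving (fun w : E × E => (f w.1, w.2 + g w.1)) volume volume := by
    intro f g hf hg
    refine hf.skew_product (μc := (volume : Measure E)) (μd := (volume : Measure E))
      (g := fun x y => y + g x) (by fun_prop) (Filter.Eventually.of_forall fun x => ?_)
    exact map_add_right_eq_self _ _
  have shear' : ∀ (f g : E → E), MeasurePreserving f volume volume → Measurable g →
      MeasurePreserving (fun w : E × E => (f w.1, -w.2 + g w.1)) volume volume := by
    intro f g hf hg
    refine hf.skew_product (μc := (volume : Measure E)) (μd := (volume : Measure E))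
      (g := fun x y => -y + g x) (by fun_prop) (Filter.Eventually.of_forall fun x => ?_)
    exact ((measurePreserving_add_right volume (g x)).comp hneg).map_eq
  have hswap : MeasurePreserving (Prod.swap : E × E → E × E) volume volume :=
    Measure.measurePreserving_swap
  have hJ : jacobi m α = fun q : E × E => ![(q.1 + q.2, q.1 + (-(m 0 / (m 0 + m 1))) • (q.1 + q.2)),
      (-q.1, q.2 + (m 1 / (m 1 + m 2)) • q.1),
      (-q.2, -q.1 + (-(m 0 / (m 2 + m 0))) • q.2)] α :=
    funext fun q => jacobi_eq m hm α q.1 q.2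
  rw [hJ]
  fin_cases α
  · exact (shear (fun x => x) (fun x => (-(m 0 / (m 0 + m 1))) • x) hid (by fun_prop)).comp
      (hswap.comp (((measurePreserving_prod_add (volume : Measure E) (volume : Measure E)))))
  · exact shear (fun x => -x) (fun x => (m 1 / (m 1 + m 2)) • x) hneg (by fun_prop)
  · exact (shear' (fun x => -x) (fun x => (-(m 0 / (m 2 + m 0))) • x) hneg (by fun_prop)).comp hswap

theorem jacobiInv_jacobi (m : Fin 3 → ℝ) (hm : ∀ i, 0 < m i) (α : Fin 3) (q : E × E) :
    jacobiInv m α (jacobi m α q) = q := by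
  have h01 := (add_pos (hm 0) (hm 1)).ne'
  have h12 := (add_pos (hm 1) (hm 2)).ne'
  have h20 := (add_pos (hm 2) (hm 0)).ne'
  obtain ⟨x, y⟩ := q
  rw [jacobi_eq m hm]
  fin_cases α
  · refine Prod.ext ?_ ?_ <;> ext i <;> simp [jacobiInv] <;> field_simp <;> ring
  · refine Prod.ext ?_ ?_ <;> ext i <;> simp [jacobiInv]
  · refine Prod.ext ?_ ?_ <;> ext i <;> simp [jacobiInv]

theorem jacobi_jacobiInv (m : Fin 3 → ℝ) (hm : ∀ i, 0 < m i) (α : Fin 3) (w : E × E) :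
    jacobi m α (jacobiInv m α w) = w := by
  have h01 := (add_pos (hm 0) (hm 1)).ne'
  have h12 := (add_pos (hm 1) (hm 2)).ne'
  have h20 := (add_pos (hm 2) (hm 0)).ne'
  obtain ⟨p, k⟩ := w
  rw [← Prod.mk.eta (p := jacobiInv m α (p, k)), jacobi_eq m hm]
  fin_cases α
  · refine Prod.ext ?_ ?_ <;> ext i <;> simp [jacobiInv] <;> field_simp <;> ring
  · refine Prod.ext ?_ ?_ <;> ext i <;> simp [jacobiInv]
  · refine Prod.ext ?_ ?_ <;> ext i <;> simp [jacobiInv]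

/-- `jacobi` as a measurable equivalence. -/
def jacobiEquiv (m : Fin 3 → ℝ) (hm : ∀ i, 0 < m i) (α : Fin 3) : E × E ≃ᵐ E × E where
  toFun := jacobi m α
  invFun := jacobiInv m α
  left_inv := jacobiInv_jacobi m hm α
  right_inv := jacobi_jacobiInv m hm α
  measurable_toFun := (measurePreserving_jacobi m hm α).measurable
  measurable_invFun := by
    change Measurable fun w : E × E => jacobiInv m α w
    simp only [jacobiInv]
    refine Measurable.prodMk ?_ ?_ <;> split_ifs <;> fun_prop

theorem compJacobi_surjective (m : Fin 3 → ℝ) (hm : ∀ i, 0 < m i) (α : Fin 3) :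
    Function.Surjective (Lp.compMeasurePreservingₗᵢ (E := ℂ) (p := 2) ℂ (jacobi m α)
      (measurePreserving_jacobi m hm α)) := by
  intro f
  have hinv : MeasurePreserving (jacobiInv m α) volume volume :=
    (show MeasurePreserving (jacobiEquiv m hm α) volume volume from
      measurePreserving_jacobi m hm α).symm
  refine ⟨Lp.compMeasurePreserving (jacobiInv m α) hinv f, ?_⟩
  apply Lp.ext
  refine (Lp.coeFn_compMeasurePreserving (Lp.compMeasurePreserving (jacobiInv m α) hinv f)
    (measurePreserving_jacobi m hm α)).trans ?_
  filter_upwards [(measurePreserving_jacobi m hm α).quasiMeasurePreserving.ae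
    (Lp.coeFn_compMeasurePreserving f hinv)] with q hq
  simp only [Function.comp_apply] at hq ⊢
  rw [hq, jacobiInv_jacobi m hm]

/-- The unitary `g ↦ g ∘ (p_α, k_α)`, from functions of `(p_α, k_α)` to functions on momentum
space. -/
def jacobiUnitary (m : Fin 3 → ℝ) (hm : ∀ i, 0 < m i) (α : Fin 3) : L2Two ≃ₗᵢ[ℂ] L2Two :=
  LinearIsometryEquiv.ofSurjective
    (Lp.compMeasurePreservingₗᵢ (E := ℂ) (p := 2) ℂ (jacobi m α)
      (measurePreserving_jacobi m hm α)) (compJacobi_surjective m hm α)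

/-- The partial Fourier transform `Φ_α`, from functions of `(p_α, x_α)` to functions on momentum
space. -/
def Phi (m : Fin 3 → ℝ) (hm : ∀ i, 0 < m i) (α : Fin 3) : L2Two ≃ₗᵢ[ℂ] L2Two :=
  partialFourier.trans (jacobiUnitary m hm α)

/-! ### The operators -/

/-- The operator `|V_α|^{1/2} = Φ_α |v_α|^{1/2} Φ_α*`, where `|v_α|^{1/2}` is multiplication by
`|v_α(x_α)|^{1/2}` on functions of `(p_α, x_α)`. -/
def sqrtAbsV (m : Fin 3 → ℝ) (hm : ∀ i, 0 < m i) (v : Fin 3 → E → ℝ) (α : Fin 3) :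
    L2Two →ₗ.[ℂ] L2Two :=
  conjOp (Phi m hm α) (mulOp fun w : E × E => (Real.sqrt |v α w.2| : ℂ))

/-- The free resolvent `R₀(z) = (H₀ - z)⁻¹`, for `H₀` the multiplication by `H⁰`. -/
def freeResolvent (m : Fin 3 → ℝ) (z : ℝ) : L2Two →ₗ.[ℂ] L2Two :=
  (mulOp fun q : E × E => ((kinetic m q - z : ℝ) : ℂ)).inverse

/-- `K_{αβ}(z) = |V_α|^{1/2} R₀(z) |V_β|^{1/2}`. -/
def opK (m : Fin 3 → ℝ) (hm : ∀ i, 0 < m i) (v : Fin 3 → E → ℝ) (α β : Fin 3) (z : ℝ) :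
    L2Two →ₗ.[ℂ] L2Two :=
  prodOp (sqrtAbsV m hm v α) (prodOp (freeResolvent m z) (sqrtAbsV m hm v β))

/-- `Γ_α(z)`, the multiplication by `ζ_α(z - p_α² / 2 n_α)`. -/
def opGamma (m : Fin 3 → ℝ) (ζ : Fin 3 → ℝ → ℝ) (α : Fin 3) (z : ℝ) : L2Two →ₗ.[ℂ] L2Two :=
  mulOp fun q : E × E => (ζ α (z - ‖thirdMomentum m α q‖ ^ 2 / (2 * redMassThird m α)) : ℂ)

/-- `M_{αβ}(z) = Γ_α(z)⁻¹ K_{αβ}(z) Γ_β(z)⁻¹`. -/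
def opM (m : Fin 3 → ℝ) (hm : ∀ i, 0 < m i) (v : Fin 3 → E → ℝ) (ζ : Fin 3 → ℝ → ℝ)
    (α β : Fin 3) (z : ℝ) : L2Two →ₗ.[ℂ] L2Two :=
  prodOp (opGamma m ζ α z).inverse (prodOp (opK m hm v α β z) (opGamma m ζ β z).inverse)

/-- A partially defined operator is compact if it is densely defined and is the restriction of a
compact operator defined on the whole space (which is then its closure). -/
def IsCompactPMap {H : Type*} [NormedAddCommGroup H] [NormedSpace ℂ H] (A : H →ₗ.[ℂ] H) : Prop :=
  Dense (A.domain : Set H) ∧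
    ∃ T : H →L[ℂ] H, IsCompactOperator T ∧ ∀ f : A.domain, A f = T f

/-- The conditions on the auxiliary function `ζ : (-∞, 0) → ℝ` with parameters `τ ∈ ℝ` and
`μ ∈ (-1, 0)`. -/
structure IsAuxFunction (τ μ : ℝ) (ζ : ℝ → ℝ) : Prop where
  mu_mem : μ ∈ Set.Ioo (-1) 0
  log_sub_neg : ∀ t ∈ Set.Ico μ 0, Real.log |t| - τ < 0
  smooth : ContDiffOn ℝ (⊤ : ℕ∞) ζ (Set.Iio 0)
  pos : ∀ t < 0, 0 < ζ t
  eq_near_zero : ∀ t ∈ Set.Ioo μ 0, ζ t = Real.sqrt (t * (Real.log |t| - τ))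
  eq_one : ∀ t ≤ -1, ζ t = 1

end ThreeBody

end

noncomputable section

namespace ThreeBody

open scoped ComplexConjugate

section

/-! ### Multiplication by bounded measurable functions -/

/-! Write `A(p_α)` and `A'(p_β)` for the multipliers `Γ_α(z)⁻¹` and `Γ_β(z)⁻¹`, and `r` for the
resolvent `(H⁰ - z)⁻¹`. The operator `|V_α|^{1/2}` acts in `x_α` only, so it commutes with functions
of `p_α`. Formally, therefore, `M_{αβ}(z) = |V_α|^{1/2} W |V_β|^{1/2}` with one multiplier `W =
A(p_α) r A'(p_β)`. For `α ≠ β` the pair `(p_α, p_β)` is a coordinate system on momentum space with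
unit Jacobian, and `b > 4` puts `|v|^{1/2}` in `L²(ℝ⁴)`. Two estimates follow.

(1) If `W` is square integrable in `(p_α, p_β)`, the operator is, up to the unitaries `Φ_α` and
`Φ_β`, an integral operator with a square integrable kernel. It is compact, with norm at most a
constant times `‖W‖₂` (`isCompactOperator_sandwich`).

(2) By Cauchy–Schwarz in `x_β`, the function `|V_β|^{1/2} f` is bounded in `k_β` by a function of
`p_β` alone. Hence `a(p_α) |V_β|^{1/2}` is bounded for every square integrable `a`, even an
unbounded one (`norm_mulL2_boundedV_le`).

At low energy (1) applies. Near the threshold `A²` is of order `1 / (|p|² ln(1/|p|))` at worst and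
`r` is at most of order `1 / max(|p_α|, |p_β|)²`, so integrating `W²` over four-dimensional balls
leads to `∫ dy / (y ln² y)` near `0`. This converges, and only because each of the two factors `Γ⁻¹`
contributes a logarithm (`lintegral_logMajorant_lt_top`, `isSandwich_auxMultiplier`). At energy
above `R` one has `r ≤ 1/R` and, for `R` large, `p_α` and `p_β` are not both small. At most one of
`A`, `A'` is then singular, and (2) absorbs it; this part has norm `O(1/R)`
(`exists_norm_sandwich_le`).

Consequently the truncations of `W` give compact operators that are Cauchy in norm
(`cauchySeq_approx`), and their limit `T` is compact. The unbounded product is described by its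
graph as a chain of square integrable functions (`mem_graph_opM`), and along such a chain the
truncations converge to the right value, so `T` extends `M_{αβ}(z)` (`limit_eq`). The domain
contains every function supported where the argument of `ζ_β` stays away from `0`. This gives
density, and the whole space when `z < 0` (`mulL2_mem_domain_opM`). -/

/-- A bounded measurable real function. -/
def BddMeas {X : Type*} [MeasurableSpace X] (a : X → ℝ) : Prop :=
  Measurable a ∧ ∃ C, ∀ x, |a x| ≤ C

namespace BddMeas

variable {X Y : Type*} [MeasurableSpace X] [MeasurableSpace Y] {a b : X → ℝ}

theorem mul (ha : BddMeas a) (hb : BddMeas b) : BddMeas fun x => a x * b x := by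
  obtain ⟨ha, C, hC⟩ := ha
  obtain ⟨hb, D, hD⟩ := hb
  refine ⟨ha.mul hb, C * D, fun x => ?_⟩
  rw [abs_mul]
  exact mul_le_mul (hC x) (hD x) (abs_nonneg _) ((abs_nonneg _).trans (hC x))

theorem comp (ha : BddMeas a) {f : Y → X} (hf : Measurable f) : BddMeas fun y => a (f y) :=
  ⟨ha.1.comp hf, ha.2.choose, fun y => ha.2.choose_spec (f y)⟩

theorem sub (ha : BddMeas a) (hb : BddMeas b) : BddMeas fun x => a x - b x := by
  obtain ⟨ha, C, hC⟩ := ha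
  obtain ⟨hb, D, hD⟩ := hb
  exact ⟨ha.sub hb, C + D, fun x => (abs_sub _ _).trans (add_le_add (hC x) (hD x))⟩

theorem indicator (ha : BddMeas a) {s : Set X} (hs : MeasurableSet s) :
    BddMeas (s.indicator a) := by
  obtain ⟨ha, C, hC⟩ := ha
  refine ⟨ha.indicator hs, C, fun x => ?_⟩
  by_cases hx : x ∈ s
  · simpa [hx] using hC x
  · simpa [hx] using (abs_nonneg _).trans (hC x)

theorem indicator_one {s : Set X} (hs : MeasurableSet s) :
    BddMeas (s.indicator fun _ => (1 : ℝ)) :=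
  indicator ⟨measurable_const, 1, by simp⟩ hs

end BddMeas

section MulL2

variable {X : Type*} [MeasurableSpace X] {μ : Measure X} {a b : X → ℝ}

theorem BddMeas.memLp (ha : BddMeas a) (f : Lp ℂ 2 μ) :
    MemLp (fun x => (a x : ℂ) * f x) 2 μ := by
  obtain ⟨ha, C, hC⟩ := ha
  refine MemLp.of_le_mul (c := C) (Lp.memLp f)
    ((Complex.measurable_ofReal.comp ha).aestronglyMeasurable.mul (Lp.aestronglyMeasurable f))
    (Filter.Eventually.of_forall fun x => ?_)
  rw [norm_mul, Complex.norm_real]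
  exact mul_le_mul_of_nonneg_right (hC x) (norm_nonneg _)

theorem norm_toLp_mul_le {C : ℝ} (f : Lp ℂ 2 μ) (hf : MemLp (fun x => (a x : ℂ) * f x) 2 μ)
    (hC : ∀ x, |a x| ≤ C) : ‖hf.toLp‖ ≤ C * ‖f‖ := by
  refine Lp.norm_le_mul_norm_of_ae_le_mul ?_
  filter_upwards [hf.coeFn_toLp] with x hx
  rw [hx, norm_mul, Complex.norm_real]
  exact mul_le_mul_of_nonneg_right (hC x) (norm_nonneg _)

open scoped Classical in
/-- Multiplication by a bounded measurable real function in `L²` (and zero for other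
functions). -/
def mulL2 (a : X → ℝ) : Lp ℂ 2 μ →L[ℂ] Lp ℂ 2 μ :=
  if h : BddMeas a then
    LinearMap.mkContinuous
      { toFun := fun f => (h.memLp f).toLp
        map_add' := fun f g => by
          rw [← MemLp.toLp_add]
          apply MemLp.toLp_congr
          filter_upwards [Lp.coeFn_add f g] with x hx
          simp only [Pi.add_apply] at hx ⊢
          rw [hx, mul_add]
        map_smul' := fun c f => by
          rw [RingHom.id_apply, ← MemLp.toLp_const_smul]
          apply MemLp.toLp_congr
          filter_upwards [Lp.coeFn_smul c f] with x hx
          simp only [Pi.smul_apply, smul_eq_mul] at hx ⊢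
          rw [hx, mul_left_comm] }
      h.2.choose fun f => norm_toLp_mul_le f (h.memLp f) h.2.choose_spec
  else 0

theorem mulL2_apply (ha : BddMeas a) (f : Lp ℂ 2 μ) : mulL2 a f = (ha.memLp f).toLp := by
  rw [mulL2, dif_pos ha]
  rfl

theorem coeFn_mulL2 (ha : BddMeas a) (f : Lp ℂ 2 μ) :
    mulL2 a f =ᵐ[μ] fun x => (a x : ℂ) * f x := by
  rw [mulL2_apply ha]
  exact MemLp.coeFn_toLp _

theorem norm_mulL2_le (ha : BddMeas a) {C : ℝ} (hC : ∀ x, |a x| ≤ C) (h0 : 0 ≤ C) :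
    ‖(mulL2 a : Lp ℂ 2 μ →L[ℂ] Lp ℂ 2 μ)‖ ≤ C := by
  refine ContinuousLinearMap.opNorm_le_bound _ h0 fun f => ?_
  rw [mulL2_apply ha]
  exact norm_toLp_mul_le f _ hC

theorem mulL2_mul (ha : BddMeas a) (hb : BddMeas b) (f : Lp ℂ 2 μ) :
    mulL2 (fun x => a x * b x) f = mulL2 a (mulL2 b f) := by
  apply Lp.ext
  filter_upwards [coeFn_mulL2 (ha.mul hb) f, coeFn_mulL2 ha (mulL2 b f), coeFn_mulL2 hb f]
    with x h1 h2 h3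
  rw [h1, h2, h3, Complex.ofReal_mul, mul_assoc]

theorem mulL2_comm (ha : BddMeas a) (hb : BddMeas b) (f : Lp ℂ 2 μ) :
    mulL2 a (mulL2 b f) = mulL2 b (mulL2 a f) := by
  rw [← mulL2_mul ha hb, ← mulL2_mul hb ha]
  congr 2
  exact funext fun x => mul_comm _ _

theorem mulL2_sub (ha : BddMeas a) (hb : BddMeas b) :
    (mulL2 (fun x => a x - b x) : Lp ℂ 2 μ →L[ℂ] Lp ℂ 2 μ) = mulL2 a - mulL2 b := by
  ext1 f
  apply Lp.ext
  rw [sub_apply]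
  filter_upwards [coeFn_mulL2 (ha.sub hb) f, coeFn_mulL2 ha f, coeFn_mulL2 hb f,
    Lp.coeFn_sub (mulL2 a f) (mulL2 b f)] with x h1 h2 h3 h4
  rw [h1, h4, Pi.sub_apply, h2, h3, Complex.ofReal_sub, sub_mul]

theorem inner_mulL2_left (ha : BddMeas a) (f g : Lp ℂ 2 μ) :
    inner ℂ (mulL2 a f) g = inner ℂ f (mulL2 a g) := by
  rw [L2.inner_def, L2.inner_def]
  apply integral_congr_ae
  filter_upwards [coeFn_mulL2 ha f, coeFn_mulL2 ha g] with x h1 h2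
  simp only [h1, h2, RCLike.inner_apply, map_mul, Complex.conj_ofReal]
  ring

theorem adjoint_mulL2 (ha : BddMeas a) :
    ContinuousLinearMap.adjoint (mulL2 a : Lp ℂ 2 μ →L[ℂ] Lp ℂ 2 μ) = mulL2 a := by
  symm
  rw [ContinuousLinearMap.eq_adjoint_iff]
  exact inner_mulL2_left ha

end MulL2

/-! ### Hilbert–Schmidt operators -/

section HilbertSchmidt

variable {X Y : Type*} [MeasurableSpace X] [MeasurableSpace Y] {μ : Measure X} {ν : Measure Y}

/-- The operator `f ↦ (x ↦ κ(x) f)` from a normed space to `L²`, for a square integrable function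
`κ` with values in the dual. -/
def carleman {H : Type*} [NormedAddCommGroup H] [NormedSpace ℂ H]
    (κ : Lp (H →L[ℂ] ℂ) 2 μ) : H →L[ℂ] Lp ℂ 2 μ :=
  LinearMap.mkContinuous
    { toFun := fun f => (ContinuousLinearMap.apply ℂ ℂ f).compLp κ
      map_add' := fun f g => by
        rw [map_add, ContinuousLinearMap.add_compLp]
      map_smul' := fun c f => by
        rw [map_smul, ContinuousLinearMap.smul_compLp, RingHom.id_apply] }
    ‖κ‖ fun f => by
      refine (ContinuousLinearMap.norm_compLp_le _ _).trans ?_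
      rw [mul_comm]
      refine mul_le_mul_of_nonneg_left ?_ (norm_nonneg _)
      refine ContinuousLinearMap.opNorm_le_bound _ (norm_nonneg _) fun l => ?_
      rw [ContinuousLinearMap.apply_apply, mul_comm]
      exact l.le_opNorm f

variable {H : Type*} [NormedAddCommGroup H] [NormedSpace ℂ H]

theorem coeFn_carleman (κ : Lp (H →L[ℂ] ℂ) 2 μ) (f : H) :
    carleman κ f =ᵐ[μ] fun x => κ x f :=
  (ContinuousLinearMap.apply ℂ ℂ f).coeFn_compLp κ

theorem norm_carleman_le (κ : Lp (H →L[ℂ] ℂ) 2 μ) : ‖carleman κ‖ ≤ ‖κ‖ :=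
  LinearMap.mkContinuous_norm_le _ (norm_nonneg _) _

theorem carleman_add (κ κ' : Lp (H →L[ℂ] ℂ) 2 μ) :
    carleman (κ + κ') = carleman κ + carleman κ' := by
  ext1 f
  exact map_add ((ContinuousLinearMap.apply ℂ ℂ f).compLpL 2 μ) κ κ'

theorem carleman_sub (κ κ' : Lp (H →L[ℂ] ℂ) 2 μ) :
    carleman (κ - κ') = carleman κ - carleman κ' := by
  ext1 f
  exact map_sub ((ContinuousLinearMap.apply ℂ ℂ f).compLpL 2 μ) κ κ'

theorem continuous_carleman :
    Continuous (carleman : Lp (H →L[ℂ] ℂ) 2 μ → H →L[ℂ] Lp ℂ 2 μ) := by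
  refine (LipschitzWith.of_dist_le_mul (K := 1) fun κ κ' => ?_).continuous
  rw [dist_eq_norm, dist_eq_norm, ← carleman_sub, NNReal.coe_one, one_mul]
  exact norm_carleman_le _

/-- Indicator functions `κ` give operators of rank at most one, sums preserve compactness, and
compact operators form a norm-closed set whose preimage under the continuous map `carleman` is
closed. Induction over `Lp` combines the three facts. -/
theorem isCompactOperator_carleman (κ : Lp (H →L[ℂ] ℂ) 2 μ) :
    IsCompactOperator (carleman κ) := by
  refine Lp.induction (p := 2) ENNReal.ofNat_ne_top
    (motive := fun κ => IsCompactOperator (carleman κ)) ?_ ?_ ?_ κ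
  · intro l s hs hμs
    have h : carleman (↑(Lp.simpleFunc.indicatorConst 2 hs hμs.ne l) : Lp (H →L[ℂ] ℂ) 2 μ)
        = (ContinuousLinearMap.toSpanSingleton ℂ
            (indicatorConstLp 2 hs hμs.ne (1 : ℂ) : Lp ℂ 2 μ)).comp l := by
      ext1 f
      apply Lp.ext
      rw [Lp.simpleFunc.coe_indicatorConst]
      refine (coeFn_carleman _ f).trans ?_
      simp only [ContinuousLinearMap.comp_apply, ContinuousLinearMap.toSpanSingleton_apply]
      filter_upwards [indicatorConstLp_coeFn (p := 2) (hs := hs) (hμs := hμs.ne) (c := l),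
        Lp.coeFn_smul (l f) (indicatorConstLp 2 hs hμs.ne (1 : ℂ) : Lp ℂ 2 μ),
        indicatorConstLp_coeFn (p := 2) (hs := hs) (hμs := hμs.ne) (c := (1 : ℂ))] with x h1 h2 h3
      rw [h1, h2, Pi.smul_apply, h3]
      by_cases hx : x ∈ s <;> simp [hx]
    rw [h]
    have hl : IsCompactOperator l := isCompactOperator_of_locallyCompactSpace_dom l
    exact hl.clm_comp (ContinuousLinearMap.toSpanSingleton ℂ _)
  · intro f g hf hg _ h1 h2
    rw [carleman_add]
    exact h1.add h2
  · exact isClosed_setOfPred_isCompactOperator.preimage continuous_carleman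

end HilbertSchmidt

end

section

/-! ### Integral operators with square integrable kernels. -/

section HilbertSchmidtKernel

variable {X Y : Type*} [MeasurableSpace X] [MeasurableSpace Y] {μ : Measure X} {ν : Measure Y}

open scoped Classical in
/-- The slice `y ↦ K (x, y)` of a kernel, as an element of `L²`. -/
def kernelSlice (ν : Measure Y) (K : X × Y → ℂ) (x : X) : Lp ℂ 2 ν :=
  if h : MemLp (fun y => K (x, y)) 2 ν then h.toLp else 0

/-- In a separable space it suffices that the distance to each fixed `g` is measurable, and this
distance is a Tonelli integral. Where the slice is not in `L²` its value is `0`, hence the case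
distinction. -/
theorem stronglyMeasurable_kernelSlice [SFinite ν] [SecondCountableTopology (Lp ℂ 2 ν)]
    {K : X × Y → ℂ} (hK : StronglyMeasurable K) : StronglyMeasurable (kernelSlice ν K) := by
  borelize ↥(Lp ℂ 2 ν)
  refine (measurable_of_edist _ fun g => ?_).stronglyMeasurable
  have hsl : ∀ x, StronglyMeasurable fun y => K (x, y) :=
    fun x => hK.comp_measurable measurable_prodMk_left
  have hN : Measurable fun x => ∫⁻ y, ‖K (x, y)‖ₑ ^ 2 ∂ν :=
    Measurable.lintegral_prod_right' (f := fun q : X × Y => ‖K q‖ₑ ^ 2) (hK.enorm.pow_const 2)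
  have hS : MeasurableSet {x : X | ∫⁻ y, ‖K (x, y)‖ₑ ^ 2 ∂ν < ⊤} :=
    measurableSet_lt hN measurable_const
  have hD : Measurable fun x : X => ∫⁻ y, ‖K (x, y) - g y‖ₑ ^ 2 ∂ν := by
    refine Measurable.lintegral_prod_right' (f := fun q : X × Y => ‖K q - g q.2‖ₑ ^ 2) ?_
    exact (hK.sub ((Lp.stronglyMeasurable g).comp_measurable measurable_snd)).enorm.pow_const 2
  classical
  have hform : (fun x => edist (kernelSlice ν K x) g) = fun x =>
      if x ∈ {x : X | ∫⁻ y, ‖K (x, y)‖ₑ ^ 2 ∂ν < ⊤} then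
        (∫⁻ y, ‖K (x, y) - g y‖ₑ ^ 2 ∂ν) ^ (1 / 2 : ℝ) else edist 0 g := by
    funext x
    by_cases hx : ∫⁻ y, ‖K (x, y)‖ₑ ^ 2 ∂ν < ⊤
    · have hm : MemLp (fun y => K (x, y)) 2 ν :=
        (memLp_two_iff _ (hsl x).aestronglyMeasurable).2 hx
      rw [if_pos (by exact hx), kernelSlice, dif_pos hm, Lp.edist_def]
      have h1 : eLpNorm (⇑hm.toLp - ⇑g) 2 ν = eLpNorm (fun y => K (x, y) - g y) 2 ν := by
        apply eLpNorm_congr_ae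
        filter_upwards [hm.coeFn_toLp] with y hy
        simp [hy]
      rw [h1, ← eLpNorm_two_sq, ← ENNReal.rpow_natCast, ← ENNReal.rpow_mul]
      norm_num
    · have hm : ¬ MemLp (fun y => K (x, y)) 2 ν := fun hm =>
        hx ((memLp_two_iff _ (hsl x).aestronglyMeasurable).1 hm)
      rw [if_neg (by exact hx), kernelSlice, dif_neg hm]
  rw [hform]
  exact Measurable.ite hS (hD.pow_const _) measurable_const

theorem ae_memLp_kernelSlice [SFinite ν] {K : X × Y → ℂ} (hK : StronglyMeasurable K)
    (hK2 : MemLp K 2 (μ.prod ν)) : ∀ᵐ x ∂μ, MemLp (fun y => K (x, y)) 2 ν := by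
  have hN : Measurable fun x => ∫⁻ y, ‖K (x, y)‖ₑ ^ 2 ∂ν :=
    Measurable.lintegral_prod_right' (f := fun q : X × Y => ‖K q‖ₑ ^ 2) (hK.enorm.pow_const 2)
  have h : ∀ᵐ x ∂μ, ∫⁻ y, ‖K (x, y)‖ₑ ^ 2 ∂ν < ⊤ := by
    refine ae_lt_top hN ?_
    rw [← lintegral_prod _ (hK.enorm.pow_const 2).aemeasurable]
    exact ((memLp_two_iff _ hK2.1).1 hK2).ne
  filter_upwards [h] with x hx
  exact (memLp_two_iff _ (hK.comp_measurable measurable_prodMk_left).aestronglyMeasurable).2 hx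

theorem eLpNorm_kernelSlice [SFinite ν] {K : X × Y → ℂ} (hK : StronglyMeasurable K)
    (hK2 : MemLp K 2 (μ.prod ν)) : eLpNorm (kernelSlice ν K) 2 μ = eLpNorm K 2 (μ.prod ν) := by
  apply (ENNReal.pow_right_strictMono two_ne_zero).injective
  change eLpNorm (kernelSlice ν K) 2 μ ^ 2 = eLpNorm K 2 (μ.prod ν) ^ 2
  rw [eLpNorm_two_sq, eLpNorm_two_sq, lintegral_prod _ (hK.enorm.pow_const 2).aemeasurable]
  apply lintegral_congr_ae
  filter_upwards [ae_memLp_kernelSlice hK hK2] with x hx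
  rw [← eLpNorm_two_sq, kernelSlice, dif_pos hx, Lp.enorm_toLp]

theorem integrable_kernel_mul [SFinite μ] [SFinite ν] {K : X × Y → ℂ}
    (hK : MemLp K 2 (μ.prod ν)) (f : Lp ℂ 2 ν) (g : Lp ℂ 2 μ) :
    Integrable (fun z : X × Y => conj (g z.1) * K z * f z.2) (μ.prod ν) := by
  have hfg : MemLp (fun z : X × Y => conj (g z.1) * f z.2) 2 (μ.prod ν) := by
    have hm : AEStronglyMeasurable (fun z : X × Y => conj (g z.1) * f z.2) (μ.prod ν) :=
      ((Complex.continuous_conj.comp_stronglyMeasurable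
        (Lp.stronglyMeasurable g)).comp_measurable measurable_fst).mul
        ((Lp.stronglyMeasurable f).comp_measurable measurable_snd) |>.aestronglyMeasurable
    rw [memLp_two_iff_integrable_sq_norm hm]
    have h1 := (memLp_two_iff_integrable_sq_norm (Lp.aestronglyMeasurable g)).1 (Lp.memLp g)
    have h2 := (memLp_two_iff_integrable_sq_norm (Lp.aestronglyMeasurable f)).1 (Lp.memLp f)
    refine (h1.mul_prod h2).congr (Filter.Eventually.of_forall fun z => ?_)
    simp [mul_pow]
  refine (hK.integrable_mul hfg).congr (Filter.Eventually.of_forall fun z => ?_)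
  simp only [Pi.mul_apply]
  ring

/-- A square integrable kernel defines a compact operator between `L²` spaces. -/
theorem exists_isCompactOperator_of_memLp_kernel [SFinite μ] [SFinite ν]
    [SecondCountableTopology (Lp ℂ 2 ν)] {K : X × Y → ℂ} (hK2 : MemLp K 2 (μ.prod ν)) :
    ∃ T : Lp ℂ 2 ν →L[ℂ] Lp ℂ 2 μ, IsCompactOperator T ∧
      ‖T‖ ≤ (eLpNorm K 2 (μ.prod ν)).toReal ∧
      ∀ f g, inner ℂ g (T f) = ∫ z, conj (g z.1) * K z * f z.2 ∂(μ.prod ν) := by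
  -- With a strongly measurable representative every slice is measurable, not merely almost every
  -- one.
  wlog hK : StronglyMeasurable K generalizing K
  · obtain ⟨T, h1, h2, h3⟩ := this (hK2.ae_eq hK2.1.ae_eq_mk) hK2.1.stronglyMeasurable_mk
    refine ⟨T, h1, ?_, fun f g => ?_⟩
    · rwa [eLpNorm_congr_ae hK2.1.ae_eq_mk]
    · rw [h3]
      apply integral_congr_ae
      filter_upwards [hK2.1.ae_eq_mk] with z hz
      rw [hz]
  have hc : StronglyMeasurable fun q => conj (K q) :=
    Complex.continuous_conj.comp_stronglyMeasurable hK
  have hc2 : MemLp (fun q => conj (K q)) 2 (μ.prod ν) :=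
    hK2.of_le hc.aestronglyMeasurable (Filter.Eventually.of_forall fun q => by simp)
  -- The inner product is conjugate linear in its first argument, so the functional `f ↦ ∫ K(x, y)
  -- f(y) dy` is represented by the conjugate slice.
  set κ : X → Lp ℂ 2 ν := kernelSlice ν fun q => conj (K q) with hκ
  have hκn : eLpNorm κ 2 μ = eLpNorm K 2 (μ.prod ν) := by
    rw [eLpNorm_kernelSlice hc hc2]
    exact eLpNorm_congr_norm_ae (Filter.Eventually.of_forall fun q => by simp)
  have hsm : StronglyMeasurable fun x => InnerProductSpace.toDual ℂ (Lp ℂ 2 ν) (κ x) :=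
    (InnerProductSpace.toDual ℂ (Lp ℂ 2 ν)).continuous.comp_stronglyMeasurable
      (stronglyMeasurable_kernelSlice hc)
  have hln : eLpNorm (fun x => InnerProductSpace.toDual ℂ (Lp ℂ 2 ν) (κ x)) 2 μ
      = eLpNorm K 2 (μ.prod ν) := by
    rw [← hκn]
    exact eLpNorm_congr_norm_ae (Filter.Eventually.of_forall fun q =>
      (InnerProductSpace.toDual ℂ (Lp ℂ 2 ν)).norm_map _)
  have hl : MemLp (fun x => InnerProductSpace.toDual ℂ (Lp ℂ 2 ν) (κ x)) 2 μ :=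
    ⟨hsm.aestronglyMeasurable, hln ▸ hK2.2⟩
  refine ⟨carleman hl.toLp, isCompactOperator_carleman _, ?_, fun f g => ?_⟩
  · refine (norm_carleman_le _).trans_eq ?_
    rw [Lp.norm_toLp, hln]
  · have hint := integrable_kernel_mul hK2 f g
    rw [integral_prod _ hint, L2.inner_def]
    apply integral_congr_ae
    filter_upwards [coeFn_carleman hl.toLp f, hl.coeFn_toLp, ae_memLp_kernelSlice hc hc2]
      with x h1 h2 h3
    rw [h1, h2, InnerProductSpace.toDual_apply_apply, RCLike.inner_apply]
    simp_rw [mul_assoc]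
    rw [integral_const_mul, mul_comm, L2.inner_def]
    congr 1
    apply integral_congr_ae
    have h4 : κ x =ᵐ[ν] fun y => conj (K (x, y)) := by
      rw [hκ, kernelSlice, dif_pos h3]
      exact h3.coeFn_toLp
    filter_upwards [h4] with y hy
    rw [RCLike.inner_apply, hy, Complex.conj_conj, mul_comm]

end HilbertSchmidtKernel

end

section

/-! ### The Fourier transform of integrable functions -/

/-- Both functions are locally integrable and agree when tested against smooth compactly supported
functions: the `L²` transform is compatible with the distributional one, and for integrable `g`
Fubini moves the transform from `g` to the test function. -/
theorem coeFn_fourierTransform_of_integrable (g : L2One) (hg : Integrable g) :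
    (Lp.fourierTransformₗᵢ E ℂ g : L2One) =ᵐ[volume] FourierTransform.fourier (g : E → ℂ) := by
  have hcont : Continuous (FourierTransform.fourier (g : E → ℂ)) :=
    VectorFourier.fourierIntegral_continuous Real.continuous_fourierChar
      (by exact continuous_inner) hg
  refine ae_eq_of_integral_contDiff_smul_eq
    ((Lp.memLp _).locallyIntegrable (by norm_num)) hcont.locallyIntegrable fun φ hφ hφs => ?_
  have hφ1 : HasCompactSupport fun x => (φ x : ℂ) := hφs.comp_left Complex.ofReal_zero
  have hφ2 : ContDiff ℝ (⊤ : ℕ∞) fun x => (φ x : ℂ) := Complex.ofRealCLM.contDiff.comp hφ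
  set s : SchwartzMap E ℂ := hφ1.toSchwartzMap hφ2 with hs
  have hsφ : ∀ x, s x = φ x := fun x => rfl
  have h1 := congrArg (fun T => T s) (Lp.fourier_toTemperedDistribution_eq g)
  simp only [TemperedDistribution.fourier_apply, Lp.toTemperedDistribution_apply, smul_eq_mul]
    at h1
  have h2 : ∫ x, FourierTransform.fourier (s : E → ℂ) x * g x
      = ∫ x, s x * FourierTransform.fourier (g : E → ℂ) x := by
    have := VectorFourier.integral_fourierIntegral_smul_eq_flip (μ := (volume : Measure E))
      (ν := (volume : Measure E)) (L := innerₗ E) (f := (s : E → ℂ)) (g := (g : E → ℂ))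
      Real.continuous_fourierChar (by exact continuous_inner) s.integrable hg
    rw [flip_innerₗ] at this
    exact this
  simp only [Complex.real_smul, ← hsφ]
  rw [← h2, ← SchwartzMap.fourier_coe]
  exact h1.symm

/-- The character `x ↦ e^{-i⟨k,x⟩}`. -/
def char (k x : E) : ℂ := Complex.exp (-(inner ℝ k x : ℝ) * Complex.I)

theorem norm_char (k x : E) : ‖char k x‖ = 1 := by
  rw [char, ← Complex.ofReal_neg, Complex.norm_exp_ofReal_mul_I]

theorem continuous_char : Continuous fun w : E × E => char w.1 w.2 := by
  unfold char
  fun_prop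

/-- The constant `(2π)⁻²`. -/
def c₀ : ℝ := ((2 * Real.pi) ^ 2)⁻¹

theorem coeFn_fourierL2 (g : L2One) (hg : Integrable g) :
    fourierL2 g =ᵐ[volume] fun k => (c₀ : ℂ) * ∫ x, char k x * g x := by
  have h2 : (2 * Real.pi)⁻¹ ≠ 0 := by positivity
  have h3 : fourierL2 g = dilateIsometry (Lp.fourierTransformₗᵢ E ℂ g) := rfl
  have h4 : (dilateIsometry (Lp.fourierTransformₗᵢ E ℂ g) : L2One) =ᵐ[volume] fun k =>
      (((2 * Real.pi) ^ 2)⁻¹ : ℂ) * (Lp.fourierTransformₗᵢ E ℂ g) ((2 * Real.pi)⁻¹ • k) :=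
    MemLp.coeFn_toLp (memLp_dilate _)
  rw [h3]
  filter_upwards [h4, (quasi_dilate _ h2).ae (coeFn_fourierTransform_of_integrable g hg)]
    with k h5 h6
  rw [h5, h6, Real.fourier_eq']
  congr 1
  · rw [c₀]
    push_cast
    rfl
  · apply integral_congr_ae
    refine Filter.Eventually.of_forall fun x => ?_
    simp only [smul_eq_mul, char]
    congr 3
    rw [inner_smul_right, real_inner_comm, ← Complex.ofReal_neg]
    congr 1
    field_simp

theorem coeFn_partialFourier (F : L2Two) (hF : ∀ᵐ p : E, Integrable fun x => F (p, x)) :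
    partialFourier F =ᵐ[volume] fun w => (c₀ : ℂ) * ∫ x, char w.2 x * F (w.1, x) := by
  -- Joint measurability makes the set of equality measurable, so that equality for almost every
  -- `k`, for almost every `p`, becomes equality almost everywhere in `(p, k)`.
  have hm : StronglyMeasurable fun w : E × E => (c₀ : ℂ) * ∫ x, char w.2 x * F (w.1, x) := by
    refine StronglyMeasurable.const_mul ?_ _
    refine StronglyMeasurable.integral_prod_right'
      (f := fun z : (E × E) × E => char z.1.2 z.2 * F (z.1.1, z.2)) ?_
    exact (continuous_char.stronglyMeasurable.comp_measurable
      (g := fun z : (E × E) × E => (z.1.2, z.2)) (by fun_prop)).mul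
      ((sm_two F).comp_measurable (g := fun z : (E × E) × E => (z.1.1, z.2)) (by fun_prop))
  refine (Measure.ae_prod_iff_ae_ae (μ := (volume : Measure E)) (ν := (volume : Measure E))
    (measurableSet_eq_fun (sm_two _).measurable hm.measurable)).2 ?_
  filter_upwards [hF, slice_partialFourier F, slice_ae F, slice_ae (partialFourier F)]
    with p h1 h2 h3 h4
  have h5 := coeFn_fourierL2 (slice F p) (h1.congr h3.symm)
  rw [← h2] at h5
  filter_upwards [h4, h5] with k h6 h7
  rw [← h6, h7]
  congr 1
  apply integral_congr_ae
  filter_upwards [h3] with x hx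
  rw [hx]

/-- The function `(p, k) ↦ (2π)⁻² ∫ e^{-i⟨k,x⟩} u(x) f(p, x) dx`. -/
def weightedFourier (u : E → ℝ) (f : E × E → ℂ) (w : E × E) : ℂ :=
  (c₀ : ℂ) * ∫ x, char w.2 x * ((u x : ℂ) * f (w.1, x))

theorem stronglyMeasurable_weightedFourier {u : E → ℝ} (hu : Measurable u) (f : L2Two) :
    StronglyMeasurable (weightedFourier u f) := by
  refine StronglyMeasurable.const_mul ?_ _
  refine StronglyMeasurable.integral_prod_right'
    (f := fun z : (E × E) × E => char z.1.2 z.2 * ((u z.2 : ℂ) * f (z.1.1, z.2))) ?_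
  refine (continuous_char.stronglyMeasurable.comp_measurable
    (g := fun z : (E × E) × E => (z.1.2, z.2)) (by fun_prop)).mul (StronglyMeasurable.mul ?_
    ((sm_two f).comp_measurable (g := fun z : (E × E) × E => (z.1.1, z.2)) (by fun_prop)))
  exact (Complex.measurable_ofReal.comp (hu.comp measurable_snd)).stronglyMeasurable

/-- The product of the square integrable weight with an `L²` slice is integrable, so the Fourier
transform is a genuine integral. -/
theorem coeFn_partialFourier_mulL2 {u : E → ℝ} (hu : BddMeas u) (hu2 : MemLp u 2 volume)
    (f : L2Two) :
    partialFourier (mulL2 (fun w : E × E => u w.2) f) =ᵐ[volume] weightedFourier u f := by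
  have hub : BddMeas fun w : E × E => u w.2 := hu.comp measurable_snd
  have h1 := Measure.ae_ae_of_ae_prod (coeFn_mulL2 hub f)
  have huC : MemLp (fun x => (u x : ℂ)) 2 volume := hu2.ofReal
  refine (coeFn_partialFourier _ ?_).trans ?_
  · filter_upwards [h1, ae_memLp_slice f] with p h2 h3
    exact (huC.integrable_mul h3).congr (Filter.EventuallyEq.symm h2)
  · have h4 : ∀ᵐ w : E × E, ∀ᵐ x, mulL2 (fun w : E × E => u w.2) f (w.1, x)
        = (u x : ℂ) * f (w.1, x) := Measure.quasiMeasurePreserving_fst.ae h1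
    filter_upwards [h4] with w hw
    rw [weightedFourier]
    congr 1
    apply integral_congr_ae
    filter_upwards [hw] with x hx
    rw [hx]

/-- Cauchy–Schwarz in `x`. The point is that the bound does not depend on `k = w.2`, which leaves
that direction free for an unbounded square integrable multiplier. -/
theorem enorm_weightedFourier_le {u : E → ℝ} (hu : Measurable u) (f : L2Two) (w : E × E) :
    ‖weightedFourier u f w‖ₑ ^ 2
      ≤ (ENNReal.ofReal c₀ * eLpNorm u 2 volume) ^ 2 * ∫⁻ x, ‖f (w.1, x)‖ₑ ^ 2 := by
  rw [weightedFourier, ← eLpNorm_two_sq, ← mul_pow, enorm_mul, mul_assoc]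
  gcongr
  · rw [← ofReal_norm, Complex.norm_real, Real.norm_of_nonneg (by unfold c₀; positivity)]
  · refine (enorm_integral_le_lintegral_enorm _).trans ?_
    have := eLpNorm_le_eLpNorm_mul_eLpNorm_of_nnnorm (p := 2) (q := 2) (r := 1)
      (μ := (volume : Measure E)) (f := u) (g := fun x => f (w.1, x))
      hu.aestronglyMeasurable (sm_slice f w.1).aestronglyMeasurable
      (fun a b => char w.2 0 * ((a : ℂ) * b)) 1 (Filter.Eventually.of_forall fun x => by
        simp only [nnnorm_mul, one_mul]
        rw [← NNReal.coe_le_coe]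
        simp [norm_char])
    rw [eLpNorm_one_eq_lintegral_enorm] at this
    simpa [enorm_mul, ← ofReal_norm, norm_char] using this

theorem coeFn_Phi_mulL2 (m : Fin 3 → ℝ) (hm : ∀ i, 0 < m i) (α : Fin 3)
    {u : E → ℝ} (hu : BddMeas u) (hu2 : MemLp u 2 volume) (f : L2Two) :
    Phi m hm α (mulL2 (fun w : E × E => u w.2) f)
      =ᵐ[volume] fun q => weightedFourier u f (jacobi m α q) := by
  have h : Phi m hm α (mulL2 (fun w : E × E => u w.2) f)
      = Lp.compMeasurePreserving (jacobi m α) (measurePreserving_jacobi m hm α)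
        (partialFourier (mulL2 (fun w : E × E => u w.2) f)) := rfl
  rw [h]
  refine (Lp.coeFn_compMeasurePreserving _ _).trans ?_
  exact (measurePreserving_jacobi m hm α).quasiMeasurePreserving.ae
    (coeFn_partialFourier_mulL2 hu hu2 f)

end

section

/-! ### The third momenta of two different pairs as coordinates -/

variable (m : Fin 3 → ℝ)

/-- At total momentum zero, `p_α` is minus the momentum of the third particle; the masses drop out.
-/
theorem thirdMomentum_eq_vec (hm : ∀ i, 0 < m i) (α : Fin 3) (q : E × E) :
    thirdMomentum m α q = ![q.1 + q.2, -q.1, -q.2] α := by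
  have h := congrArg Prod.fst (jacobi_eq m hm α q.1 q.2)
  fin_cases α <;> exact h

theorem measurable_thirdMomentum (hm : ∀ i, 0 < m i) (α : Fin 3) :
    Measurable (thirdMomentum m α) :=
  measurable_fst.comp (measurePreserving_jacobi m hm α).measurable

/-- Two different third momenta are, up to sign, two of the three particle momenta, and these
determine everything. Later arguments use only that such coefficients exist. -/
theorem exists_pairMomentum_eq (hm : ∀ i, 0 < m i) {α β : Fin 3} (h : α ≠ β) :
    ∃ a b : ℝ, ∀ q, pairMomentum m α q = a • thirdMomentum m α q + b • thirdMomentum m β q := by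
  have key : ∀ q : E × E, pairMomentum m α q =
      ![q.1 + (-(m 0 / (m 0 + m 1))) • (q.1 + q.2), q.2 + (m 1 / (m 1 + m 2)) • q.1,
        -q.1 + (-(m 0 / (m 2 + m 0))) • q.2] α := fun q => by
    have h := congrArg Prod.snd (jacobi_eq m hm α q.1 q.2)
    fin_cases α <;> exact h
  simp only [key, thirdMomentum_eq_vec m hm]
  fin_cases α <;> fin_cases β <;> first | exact absurd rfl h | skip
  · exact ⟨-(m 0 / (m 0 + m 1)), -1, fun q => by simp; module⟩
  · exact ⟨1 - m 0 / (m 0 + m 1), 1, fun q => by simp; module⟩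
  · exact ⟨1 - m 1 / (m 1 + m 2), 1, fun q => by simp; module⟩
  · exact ⟨-(m 1 / (m 1 + m 2)), -1, fun q => by simp; module⟩
  · exact ⟨m 0 / (m 2 + m 0) - 1, -1, fun q => by simp; module⟩
  · exact ⟨m 0 / (m 2 + m 0), 1, fun q => by simp; module⟩

/-- In each of the six cases the map is a composition of exchanges, reflections and shears. For `α =
β` it would be degenerate; this is where distinct pairs matter. -/
theorem measurePreserving_thirdMomentum (hm : ∀ i, 0 < m i) {α β : Fin 3} (h : α ≠ β) :
    MeasurePreserving (fun q => (thirdMomentum m α q, thirdMomentum m β q)) volume volume := by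
  have hneg : MeasurePreserving (fun x : E => -x) volume volume := Measure.measurePreserving_neg _
  have hnn : MeasurePreserving (fun w : E × E => (-w.1, -w.2)) volume volume := hneg.prod hneg
  have hswap : MeasurePreserving (Prod.swap : E × E → E × E) volume volume :=
    Measure.measurePreserving_swap
  have hn1 : MeasurePreserving (fun w : E × E => (w.1, -w.2)) volume volume :=
    (MeasurePreserving.id _).prod hneg
  have hadd : MeasurePreserving (fun w : E × E => (w.1, w.1 + w.2)) volume volume :=
    measurePreserving_prod_add (volume : Measure E) (volume : Measure E)
  have h10 : MeasurePreserving (fun w : E × E => (-w.1, w.1 + w.2)) volume volume :=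
    (hneg.prod (MeasurePreserving.id _)).comp hadd
  have h20 : MeasurePreserving (fun w : E × E => (-w.2, w.1 + w.2)) volume volume := by
    have e : (fun w : E × E => (-w.2, w.1 + w.2))
        = (fun w : E × E => (-w.1, w.1 + w.2)) ∘ Prod.swap := by
      funext w
      simp [add_comm]
    rw [e]
    exact h10.comp hswap
  simp only [thirdMomentum_eq_vec m hm]
  fin_cases α <;> fin_cases β <;> first | exact absurd rfl h | skip
  · exact hswap.comp h10
  · exact hswap.comp h20
  · exact h10
  · exact hnn
  · exact h20
  · exact hnn.comp hswap

theorem redMass_pos (hm : ∀ i, 0 < m i) (α : Fin 3) : 0 < redMass m α :=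
  div_pos (mul_pos (hm _) (hm _)) (add_pos (hm _) (hm _))

theorem redMassThird_pos (hm : ∀ i, 0 < m i) (α : Fin 3) : 0 < redMassThird m α :=
  div_pos (mul_pos (hm _) (add_pos (hm _) (hm _))) (add_pos (add_pos (hm _) (hm _)) (hm _))

theorem thirdMomentum_sq_le_kinetic (hm : ∀ i, 0 < m i) (α : Fin 3) (q : E × E) :
    ‖thirdMomentum m α q‖ ^ 2 / (2 * redMassThird m α) ≤ kinetic m q := by
  rw [kinetic_eq m hm α]
  have := redMass_pos m hm α
  have : 0 ≤ ‖pairMomentum m α q‖ ^ 2 / (2 * redMass m α) := by positivity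
  linarith

end

section

/-! ### The bounded operators `|V_α|^{1/2}` and their products with multiplications -/

/-- A bounded measurable square integrable function on `ℝ⁴`. -/
structure IsWeight (u : E → ℝ) : Prop where
  bddMeas : BddMeas u
  memLp : MemLp u 2 volume

variable {m : Fin 3 → ℝ} (hm : ∀ i, 0 < m i) {α β : Fin 3} {u : E → ℝ}

/-- `Φ_α u Φ_α*`, as a bounded operator. -/
def boundedV (u : E → ℝ) (α : Fin 3) : L2Two →L[ℂ] L2Two :=
  (Phi m hm α : L2Two →L[ℂ] L2Two).comp
    ((mulL2 fun w : E × E => u w.2).comp ((Phi m hm α).symm : L2Two →L[ℂ] L2Two))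

theorem boundedV_apply (u : E → ℝ) (α : Fin 3) (f : L2Two) : boundedV hm u α f
    = Phi m hm α (mulL2 (fun w : E × E => u w.2) ((Phi m hm α).symm f)) := rfl

theorem adjoint_boundedV (hu : IsWeight u) (α : Fin 3) :
    ContinuousLinearMap.adjoint (boundedV hm u α) = boundedV hm u α := by
  symm
  rw [ContinuousLinearMap.eq_adjoint_iff]
  intro f g
  have h1 := (Phi m hm α).inner_map_map
    (mulL2 (fun w : E × E => u w.2) ((Phi m hm α).symm f)) ((Phi m hm α).symm g)
  have h2 := (Phi m hm α).inner_map_map ((Phi m hm α).symm f)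
    (mulL2 (fun w : E × E => u w.2) ((Phi m hm α).symm g))
  rw [LinearIsometryEquiv.apply_symm_apply] at h1 h2
  rw [boundedV_apply, boundedV_apply, h1, h2]
  exact inner_mulL2_left (hu.bddMeas.comp measurable_snd) _ _

/-- The constant `(2π)⁻² ‖u‖`. -/
def weightConst (u : E → ℝ) : ℝ := c₀ * (eLpNorm u 2 volume).toReal

theorem c₀_nonneg : 0 ≤ c₀ := by
  unfold c₀
  positivity

theorem weightConst_nonneg (u : E → ℝ) : 0 ≤ weightConst u :=
  mul_nonneg c₀_nonneg ENNReal.toReal_nonneg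

theorem ofReal_weightConst (hu : IsWeight u) :
    ENNReal.ofReal (weightConst u) = ENNReal.ofReal c₀ * eLpNorm u 2 volume := by
  rw [weightConst, ENNReal.ofReal_mul c₀_nonneg, ENNReal.ofReal_toReal hu.memLp.2.ne]

/-- `enorm_weightedFourier_le` majorises `|V_β|^{1/2} f` by a function of `p_β` alone. In the
coordinates `(p_α, p_β)` the integral then factors. -/
theorem lintegral_sq_mul_boundedV_le (hu : IsWeight u) (hαβ : α ≠ β) {a : E → ENNReal}
    (ha : Measurable a) (f : L2Two) :
    ∫⁻ q, a (thirdMomentum m α q) ^ 2 * ‖boundedV hm u β f q‖ₑ ^ 2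
      ≤ ENNReal.ofReal (weightConst u) ^ 2 * (∫⁻ p, a p ^ 2) * ‖f‖ₑ ^ 2 := by
  set f' := (Phi m hm β).symm f with hf'
  have hD := measurePreserving_thirdMomentum m hm hαβ
  have hN : Measurable fun p => ∫⁻ x, ‖f' (p, x)‖ₑ ^ 2 := measurable_slice_sq f'
  have hn : ∫⁻ p, ∫⁻ x, ‖f' (p, x)‖ₑ ^ 2 = ‖f‖ₑ ^ 2 := by
    rw [lintegral_slice, ← Lp.enorm_def, ← ofReal_norm, ← ofReal_norm, hf',
      LinearIsometryEquiv.norm_map]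
  calc ∫⁻ q, a (thirdMomentum m α q) ^ 2 * ‖boundedV hm u β f q‖ₑ ^ 2
      ≤ ∫⁻ q, ENNReal.ofReal (weightConst u) ^ 2 * (a (thirdMomentum m α q) ^ 2
          * ∫⁻ x, ‖f' (thirdMomentum m β q, x)‖ₑ ^ 2) := by
        apply lintegral_mono_ae
        filter_upwards [coeFn_Phi_mulL2 m hm β hu.bddMeas hu.memLp f'] with q hq
        rw [boundedV_apply, hq, mul_left_comm, ofReal_weightConst hu]
        exact mul_le_mul_right (enorm_weightedFourier_le hu.bddMeas.1 f' _) _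
    _ = ENNReal.ofReal (weightConst u) ^ 2 * ∫⁻ w : E × E, a w.1 ^ 2
          * ∫⁻ x, ‖f' (w.2, x)‖ₑ ^ 2 := by
        rw [lintegral_const_mul' _ _ (ENNReal.pow_ne_top ENNReal.ofReal_ne_top)]
        congr 1
        exact hD.lintegral_comp (f := fun w : E × E => a w.1 ^ 2 * ∫⁻ x, ‖f' (w.2, x)‖ₑ ^ 2)
          (((ha.comp measurable_fst).pow_const 2).mul (hN.comp measurable_snd))
    _ = _ := by
        rw [mul_assoc, ← hn]
        congr 1
        exact lintegral_prod_mul (ha.pow_const 2).aemeasurable hN.aemeasurable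

theorem norm_mulL2_boundedV_le (hu : IsWeight u) (hαβ : α ≠ β) {w : E × E → ℝ} (hw : BddMeas w)
    {a : E → ℝ} (ham : Measurable a) (ha : MemLp a 2 volume)
    (hwa : ∀ q, |w q| ≤ a (thirdMomentum m α q)) :
    ‖(mulL2 w).comp (boundedV hm u β)‖ ≤ weightConst u * (eLpNorm a 2 volume).toReal := by
  have h0 := weightConst_nonneg u
  refine ContinuousLinearMap.opNorm_le_bound _ (by positivity) fun f => ?_
  have h1 : ‖mulL2 w (boundedV hm u β f)‖ₑ ^ 2
      ≤ (ENNReal.ofReal (weightConst u) * eLpNorm a 2 volume * ‖f‖ₑ) ^ 2 := by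
    rw [Lp.enorm_def, eLpNorm_two_sq, mul_pow, mul_pow, eLpNorm_two_sq]
    refine le_trans (lintegral_mono_ae ?_)
      (lintegral_sq_mul_boundedV_le hm hu hαβ ham.enorm f)
    filter_upwards [coeFn_mulL2 hw (boundedV hm u β f)] with q hq
    rw [hq, enorm_mul, mul_pow]
    gcongr
    rw [← ofReal_norm, ← ofReal_norm, Complex.norm_real]
    exact ENNReal.ofReal_le_ofReal ((hwa q).trans (le_abs_self _))
  have h2 := (ENNReal.pow_right_strictMono two_ne_zero).le_iff_le.1 h1
  have h3 := ENNReal.toReal_mono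
    (by finiteness [ha.2.ne]) h2
  simpa [ENNReal.toReal_mul, ENNReal.toReal_ofReal h0] using h3

/-- The adjoint of the preceding estimate, since both factors are self-adjoint. -/
theorem norm_boundedV_mulL2_le (hu : IsWeight u) (hαβ : α ≠ β) {w : E × E → ℝ} (hw : BddMeas w)
    {a : E → ℝ} (ham : Measurable a) (ha : MemLp a 2 volume)
    (hwa : ∀ q, |w q| ≤ a (thirdMomentum m β q)) :
    ‖(boundedV hm u α).comp (mulL2 w)‖ ≤ weightConst u * (eLpNorm a 2 volume).toReal := by
  have h := norm_mulL2_boundedV_le hm hu hαβ.symm hw ham ha hwa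
  rw [← LinearIsometryEquiv.norm_map ContinuousLinearMap.adjoint,
    ContinuousLinearMap.adjoint_comp, adjoint_boundedV hm hu, adjoint_mulL2 hw] at h
  exact h

/-- The operator `|V_α|^{1/2} w |V_β|^{1/2}`, for a multiplication operator `w`. -/
def sandwich (u u' : E → ℝ) (α β : Fin 3) (w : E × E → ℝ) : L2Two →L[ℂ] L2Two :=
  (boundedV hm u α).comp ((mulL2 w).comp (boundedV hm u' β))

/-- Provides the separability of `L²(ℝ⁴ × ℝ⁴)` that `exists_isCompactOperator_of_memLp_kernel`
assumes. -/
instance isSeparable_volume_prod : IsSeparable (volume : Measure (E × E)) := by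
  have : MeasurableSpace.CountablyGenerated (E × E) := inferInstance
  have : SigmaFinite (volume : Measure (E × E)) := inferInstance
  exact isSeparable_of_sigmaFinite _

/-! ### Square integrable multipliers give Hilbert–Schmidt operators -/

/-- The exchange `((p, q), (x, y)) ↦ ((p, x), (q, y))`. -/
def exchange (z : (E × E) × (E × E)) : (E × E) × (E × E) := ((z.1.1, z.2.1), (z.1.2, z.2.2))

theorem measurePreserving_exchange : MeasurePreserving exchange volume volume := by
  have hid : MeasurePreserving (id : E → E) volume volume := MeasurePreserving.id _
  have hswap : MeasurePreserving (Prod.swap : E × E → E × E) volume volume :=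
    Measure.measurePreserving_swap
  have h1 := measurePreserving_prodAssoc (volume : Measure E) (volume : Measure E)
    (volume : Measure (E × E))
  have h2 := measurePreserving_prodAssoc (volume : Measure E) (volume : Measure E)
    (volume : Measure E)
  exact ((h1.symm.comp (hid.prod (h2.comp ((hswap.prod hid).comp h2.symm)))).comp h1 :)

variable {u' : E → ℝ}

/-- The integral kernel of `|V_α|^{1/2} W |V_β|^{1/2}` as a function of `((p_α, x_α), (p_β, x_β))`,
where `k_α = a p_α + b p_β` and `k_β = a' p_β + b' p_α`. -/
def sandwichKernel (u u' : E → ℝ) (a b a' b' : ℝ) (W : E × E → ℝ) (z : (E × E) × (E × E)) : ℂ :=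
  conj ((c₀ : ℂ) * (char (a • z.1.1 + b • z.2.1) z.1.2 * (u z.1.2 : ℂ))) * (W (z.1.1, z.2.1) : ℂ)
    * ((c₀ : ℂ) * (char (a' • z.2.1 + b' • z.1.1) z.2.2 * (u' z.2.2 : ℂ)))

theorem stronglyMeasurable_sandwichKernel (hu : IsWeight u) (hu' : IsWeight u')
    (a b a' b' : ℝ) {W : E × E → ℝ} (hW : Measurable W) :
    StronglyMeasurable (sandwichKernel u u' a b a' b' W) := by
  have h1 := hu.bddMeas.1
  have h2 := hu'.bddMeas.1
  have hc : Measurable fun w : E × E => char w.1 w.2 := continuous_char.measurable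
  have h3 : Measurable fun z : (E × E) × (E × E) => char (a • z.1.1 + b • z.2.1) z.1.2 :=
    hc.comp (g := fun w : E × E => char w.1 w.2)
      (f := fun z : (E × E) × (E × E) => (a • z.1.1 + b • z.2.1, z.1.2)) (by fun_prop)
  have h4 : Measurable fun z : (E × E) × (E × E) => char (a' • z.2.1 + b' • z.1.1) z.2.2 :=
    hc.comp (g := fun w : E × E => char w.1 w.2)
      (f := fun z : (E × E) × (E × E) => (a' • z.2.1 + b' • z.1.1, z.2.2)) (by fun_prop)
  have h5 : Measurable (conj : ℂ → ℂ) := Complex.continuous_conj.measurable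
  apply Measurable.stronglyMeasurable
  unfold sandwichKernel
  refine Measurable.mul (Measurable.mul (h5.comp ?_) ?_) ?_ <;> fun_prop

/-- The characters have modulus one, so the squared modulus of the kernel is a product of a function
of the momenta and one function of each position; `exchange` groups the variables accordingly. -/
theorem eLpNorm_sandwichKernel (hu : IsWeight u) (hu' : IsWeight u')
    (a b a' b' : ℝ) {W : E × E → ℝ} (hW : Measurable W) :
    eLpNorm (sandwichKernel u u' a b a' b' W) 2 volume
      = ENNReal.ofReal (weightConst u) * ENNReal.ofReal (weightConst u')
        * eLpNorm W 2 volume := by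
  have hK := stronglyMeasurable_sandwichKernel hu hu' a b a' b' hW
  rw [← eLpNorm_comp_measurePreserving hK.aestronglyMeasurable measurePreserving_exchange]
  apply (ENNReal.pow_right_strictMono two_ne_zero).injective
  change eLpNorm _ 2 volume ^ 2 = _ ^ 2
  have hn : ∀ z : (E × E) × (E × E),
      ‖(sandwichKernel u u' a b a' b' W ∘ exchange) z‖ₑ ^ 2
      = (ENNReal.ofReal c₀ ^ 2) ^ 2 * (‖W z.1‖ₑ ^ 2 * (‖u z.2.1‖ₑ ^ 2 * ‖u' z.2.2‖ₑ ^ 2)) := by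
    intro z
    have h0 : ∀ r : ℝ, ‖(r : ℂ)‖ₑ = ‖r‖ₑ := fun r => by
      rw [← ofReal_norm, ← ofReal_norm, Complex.norm_real]
    have hc : ∀ k x, ‖char k x‖ₑ = 1 := fun k x => by
      rw [← ofReal_norm, norm_char, ENNReal.ofReal_one]
    have hcc : ∀ w : ℂ, ‖conj w‖ₑ = ‖w‖ₑ := fun w => by
      rw [← ofReal_norm, ← ofReal_norm, RCLike.norm_conj]
    have hcz : ‖c₀‖ₑ = ENNReal.ofReal c₀ := by
      rw [← ofReal_norm, Real.norm_of_nonneg c₀_nonneg]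
    simp only [Function.comp_apply, sandwichKernel, exchange, enorm_mul, hcc, h0, hc, hcz]
    ring
  have h1 := hu.bddMeas.1
  have h2 := hu'.bddMeas.1
  rw [eLpNorm_two_sq]
  simp_rw [hn]
  rw [lintegral_const_mul' _ _ (by finiteness)]
  have e1 : ∫⁻ z : (E × E) × (E × E), ‖W z.1‖ₑ ^ 2 * (‖u z.2.1‖ₑ ^ 2 * ‖u' z.2.2‖ₑ ^ 2)
      = (∫⁻ w, ‖W w‖ₑ ^ 2) * ∫⁻ w : E × E, ‖u w.1‖ₑ ^ 2 * ‖u' w.2‖ₑ ^ 2 :=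
    lintegral_prod_mul (f := fun w => ‖W w‖ₑ ^ 2)
      (g := fun w : E × E => ‖u w.1‖ₑ ^ 2 * ‖u' w.2‖ₑ ^ 2) (by fun_prop) (by fun_prop)
  have e2 : ∫⁻ w : E × E, ‖u w.1‖ₑ ^ 2 * ‖u' w.2‖ₑ ^ 2
      = (∫⁻ x, ‖u x‖ₑ ^ 2) * ∫⁻ x, ‖u' x‖ₑ ^ 2 :=
    lintegral_prod_mul (f := fun x => ‖u x‖ₑ ^ 2) (g := fun x => ‖u' x‖ₑ ^ 2)
      (by fun_prop) (by fun_prop)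
  rw [e1, e2, ofReal_weightConst hu, ofReal_weightConst hu', mul_pow, mul_pow, mul_pow, mul_pow,
    eLpNorm_two_sq, eLpNorm_two_sq, eLpNorm_two_sq]
  ring

/-- Fubini with `p_α` and `p_β` fixed: the two position integrals separate, and each is a weighted
Fourier transform. -/
theorem integral_kernel_eq (hu : IsWeight u) (hu' : IsWeight u')
    (a b a' b' : ℝ) {W : E × E → ℝ} (hW : Measurable W) (hW2 : MemLp W 2 volume) (f g : L2Two) :
    ∫ z, conj (g z.1) * sandwichKernel u u' a b a' b' W z * f z.2
      = ∫ w : E × E, conj (weightedFourier u g (w.1, a • w.1 + b • w.2))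
        * ((W w : ℂ) * weightedFourier u' f (w.2, a' • w.2 + b' • w.1)) := by
  have hK := stronglyMeasurable_sandwichKernel hu hu' a b a' b' hW
  have hK2 : MemLp (sandwichKernel u u' a b a' b' W) 2 volume := by
    refine ⟨hK.aestronglyMeasurable, ?_⟩
    rw [eLpNorm_sandwichKernel hu hu' a b a' b' hW]
    finiteness [hW2.2.ne]
  have hint := integrable_kernel_mul hK2 f g
  have hρ := measurePreserving_exchange
  have hint' := hρ.integrable_comp_of_integrable hint
  have h1 : ∫ z, conj (g z.1) * sandwichKernel u u' a b a' b' W z * f z.2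
      = ∫ z, ((fun z => conj (g z.1) * sandwichKernel u u' a b a' b' W z * f z.2) ∘ exchange) z := by
    have := integral_map hρ.measurable.aemeasurable (f := fun z : (E × E) × (E × E) =>
      conj (g z.1) * sandwichKernel u u' a b a' b' W z * f z.2) (by
        rw [hρ.map_eq]
        exact hint.1)
    rwa [hρ.map_eq] at this
  rw [h1]
  refine (integral_prod _ hint').trans (integral_congr_ae (Filter.Eventually.of_forall fun w => ?_))
  have h2 : ∀ y : E × E,
      ((fun z => conj (g z.1) * sandwichKernel u u' a b a' b' W z * f z.2) ∘ exchange) (w, y)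
      = (W w : ℂ) * (conj ((c₀ : ℂ) * (char (a • w.1 + b • w.2) y.1
          * ((u y.1 : ℂ) * g (w.1, y.1))))
        * ((c₀ : ℂ) * (char (a' • w.2 + b' • w.1) y.2 * ((u' y.2 : ℂ) * f (w.2, y.2))))) := by
    intro y
    simp only [Function.comp_apply, exchange, sandwichKernel, map_mul]
    ring
  simp_rw [h2]
  rw [integral_const_mul]
  have h3 := integral_prod_mul (μ := (volume : Measure E)) (ν := (volume : Measure E))
    (fun x => conj ((c₀ : ℂ) * (char (a • w.1 + b • w.2) x * ((u x : ℂ) * g (w.1, x)))))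
    (fun y => (c₀ : ℂ) * (char (a' • w.2 + b' • w.1) y * ((u' y : ℂ) * f (w.2, y))))
  refine (congrArg _ h3).trans ?_
  rw [integral_conj, integral_const_mul, integral_const_mul, mul_left_comm]
  rfl

theorem inner_mulL2_Phi_symm (hu : IsWeight u) (α : Fin 3) (g y : L2Two) :
    inner ℂ g (mulL2 (fun w : E × E => u w.2) ((Phi m hm α).symm y))
      = inner ℂ (Phi m hm α (mulL2 (fun w : E × E => u w.2) g)) y := by
  have hbu : BddMeas fun w : E × E => u w.2 := hu.bddMeas.comp measurable_snd
  have h1 := (Phi m hm α).inner_map_map (mulL2 (fun w : E × E => u w.2) g) ((Phi m hm α).symm y)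
  have h2 := inner_mulL2_left hbu g ((Phi m hm α).symm y)
  rw [LinearIsometryEquiv.apply_symm_apply] at h1
  exact h2.symm.trans h1.symm

/-- The counterpart of `integral_kernel_eq` on the operator side: the change of variables `q ↦ (p_α,
p_β)` brings the quadratic form to the same integral. -/
theorem inner_sandwich (hu : IsWeight u) (hu' : IsWeight u') (hαβ : α ≠ β) {a b a' b' : ℝ}
    (hab : ∀ q, pairMomentum m α q = a • thirdMomentum m α q + b • thirdMomentum m β q)
    (hab' : ∀ q, pairMomentum m β q = a' • thirdMomentum m β q + b' • thirdMomentum m α q)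
    {W : E × E → ℝ} (hW : BddMeas W) (f g : L2Two) :
    inner ℂ (Phi m hm α (mulL2 (fun w : E × E => u w.2) g))
        (mulL2 (fun q => W (thirdMomentum m α q, thirdMomentum m β q))
          (Phi m hm β (mulL2 (fun w : E × E => u' w.2) f)))
      = ∫ w : E × E, conj (weightedFourier u g (w.1, a • w.1 + b • w.2))
        * ((W w : ℂ) * weightedFourier u' f (w.2, a' • w.2 + b' • w.1)) := by
  have hD := measurePreserving_thirdMomentum m hm hαβ
  have hwb : BddMeas fun q => W (thirdMomentum m α q, thirdMomentum m β q) :=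
    hW.comp hD.measurable
  rw [L2.inner_def]
  set Ψ : E × E → ℂ := fun w => conj (weightedFourier u g (w.1, a • w.1 + b • w.2))
      * ((W w : ℂ) * weightedFourier u' f (w.2, a' • w.2 + b' • w.1)) with hΨ
  have hΨm : StronglyMeasurable Ψ := by
    refine StronglyMeasurable.mul (Complex.continuous_conj.comp_stronglyMeasurable
      ((stronglyMeasurable_weightedFourier hu.bddMeas.1 g).comp_measurable (by fun_prop)))
      (StronglyMeasurable.mul (Complex.measurable_ofReal.comp hW.1).stronglyMeasurable
      ((stronglyMeasurable_weightedFourier hu'.bddMeas.1 f).comp_measurable (by fun_prop)))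
  have hmap := integral_map (μ := volume) hD.measurable.aemeasurable
    (f := Ψ) hΨm.aestronglyMeasurable
  rw [hD.map_eq] at hmap
  rw [hmap]
  apply integral_congr_ae
  filter_upwards [coeFn_Phi_mulL2 m hm α hu.bddMeas hu.memLp g,
    coeFn_Phi_mulL2 m hm β hu'.bddMeas hu'.memLp f,
    coeFn_mulL2 hwb (Phi m hm β (mulL2 (fun w : E × E => u' w.2) f))] with q h1 h2 h3
  rw [h3, h1, h2, RCLike.inner_apply, mul_comm]
  simp only [hΨ, jacobi, hab, hab']

theorem isCompactOperator_sandwich (hu : IsWeight u) (hu' : IsWeight u') (hαβ : α ≠ β)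
    {W : E × E → ℝ} (hW : BddMeas W) (hW2 : MemLp W 2 volume) :
    IsCompactOperator
        (sandwich hm u u' α β fun q => W (thirdMomentum m α q, thirdMomentum m β q)) ∧
      ‖sandwich hm u u' α β fun q => W (thirdMomentum m α q, thirdMomentum m β q)‖
        ≤ weightConst u * weightConst u' * (eLpNorm W 2 volume).toReal := by
  obtain ⟨a, b, hab⟩ := exists_pairMomentum_eq m hm hαβ
  obtain ⟨a', b', hab'⟩ := exists_pairMomentum_eq m hm hαβ.symm
  have hKn := eLpNorm_sandwichKernel hu hu' a b a' b' hW.1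
  have hK2 : MemLp (sandwichKernel u u' a b a' b' W) 2 volume := by
    refine ⟨(stronglyMeasurable_sandwichKernel hu hu' a b a' b' hW.1).aestronglyMeasurable, ?_⟩
    rw [hKn]
    finiteness [hW2.2.ne]
  obtain ⟨T, hT, hTn, hTi⟩ : ∃ T : L2Two →L[ℂ] L2Two, IsCompactOperator T ∧
      ‖T‖ ≤ (eLpNorm (sandwichKernel u u' a b a' b' W) 2 volume).toReal ∧
      ∀ f g : L2Two, inner ℂ g (T f)
        = ∫ z, conj (g z.1) * sandwichKernel u u' a b a' b' W z * f z.2 :=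
    exists_isCompactOperator_of_memLp_kernel hK2
  -- The integral operator `T` lives in the `(p, x)` pictures of the two pairs; conjugating by the
  -- two unitaries returns to momentum space. The identity is checked on inner products.
  have hS : ∀ f, sandwich hm u u' α β (fun q => W (thirdMomentum m α q, thirdMomentum m β q)) f
      = Phi m hm α (T ((Phi m hm β).symm f)) := by
    intro f
    have h : T ((Phi m hm β).symm f) = mulL2 (fun w : E × E => u w.2) ((Phi m hm α).symm
        (mulL2 (fun q => W (thirdMomentum m α q, thirdMomentum m β q))
          (Phi m hm β (mulL2 (fun w : E × E => u' w.2) ((Phi m hm β).symm f))))) := by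
      refine ext_inner_left ℂ fun g => ?_
      rw [hTi, integral_kernel_eq hu hu' a b a' b' hW.1 hW2, inner_mulL2_Phi_symm hm hu,
        inner_sandwich hm hu hu' hαβ hab hab' hW]
    rw [h]
    rfl
  refine ⟨?_, ?_⟩
  · rw [funext hS]
    exact (hT.comp_clm ((Phi m hm β).symm : L2Two →L[ℂ] L2Two)).clm_comp
      (Phi m hm α : L2Two →L[ℂ] L2Two)
  · have hT' : ‖T‖ ≤ weightConst u * weightConst u' * (eLpNorm W 2 volume).toReal := by
      refine hTn.trans_eq ?_
      rw [hKn, ENNReal.toReal_mul, ENNReal.toReal_mul,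
        ENNReal.toReal_ofReal (weightConst_nonneg u),
        ENNReal.toReal_ofReal (weightConst_nonneg u')]
    refine le_trans (ContinuousLinearMap.opNorm_le_bound _ (norm_nonneg T) fun f => ?_) hT'
    rw [hS, LinearIsometryEquiv.norm_map]
    refine (T.le_opNorm _).trans ?_
    rw [LinearIsometryEquiv.norm_map]

end

section

/-! ### Functions of `p_α` commute with `|V_α|^{1/2}` -/

/-- On the fibre over `p` the multiplier is a scalar, and the fibre transform is linear. -/
theorem partialFourier_mulL2_fst {φ : E → ℝ} (hφ : BddMeas φ) (f : L2Two) :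
    partialFourier (mulL2 (fun w : E × E => φ w.1) f)
      = mulL2 (fun w : E × E => φ w.1) (partialFourier f) := by
  have hb : BddMeas fun w : E × E => φ w.1 := hφ.comp measurable_fst
  have key : ∀ f : L2Two, ∀ᵐ p : E, slice (mulL2 (fun w : E × E => φ w.1) f) p
      = (φ p : ℂ) • slice f p := by
    intro f
    refine slice_eq_of_ae _ _ (coeFn_mulL2 hb f) _ ?_
    filter_upwards [slice_ae f] with p hp
    filter_upwards [hp, Lp.coeFn_smul (φ p : ℂ) (slice f p)] with x h1 h2
    rw [h2, Pi.smul_apply, h1, smul_eq_mul]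
  apply sliceEquiv.injective
  change (memLp_sliceMap _).toLp = (memLp_sliceMap _).toLp
  apply MemLp.toLp_congr
  filter_upwards [slice_partialFourier (mulL2 (fun w : E × E => φ w.1) f), key f,
    key (partialFourier f), slice_partialFourier f] with p h1 h2 h3 h4
  rw [h1, h2, h3, h4, map_smul]

variable {m : Fin 3 → ℝ} (hm : ∀ i, 0 < m i) {α β : Fin 3} {u u' : E → ℝ}

theorem Phi_mulL2_fst (α : Fin 3) {φ : E → ℝ} (hφ : BddMeas φ) (f : L2Two) :
    Phi m hm α (mulL2 (fun w : E × E => φ w.1) f)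
      = mulL2 (fun q => φ (thirdMomentum m α q)) (Phi m hm α f) := by
  have hJ := measurePreserving_jacobi m hm α
  have hb : BddMeas fun w : E × E => φ w.1 := hφ.comp measurable_fst
  have hb' : BddMeas fun q => φ (thirdMomentum m α q) :=
    hφ.comp (measurable_thirdMomentum m hm α)
  change Lp.compMeasurePreserving (jacobi m α) hJ
      (partialFourier (mulL2 (fun w : E × E => φ w.1) f))
    = mulL2 (fun q => φ (thirdMomentum m α q))
      (Lp.compMeasurePreserving (jacobi m α) hJ (partialFourier f))
  rw [partialFourier_mulL2_fst hφ]
  apply Lp.ext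
  refine (Lp.coeFn_compMeasurePreserving _ hJ).trans ?_
  filter_upwards [hJ.quasiMeasurePreserving.ae (coeFn_mulL2 hb (partialFourier f)),
    coeFn_mulL2 hb' (Lp.compMeasurePreserving (jacobi m α) hJ (partialFourier f)),
    Lp.coeFn_compMeasurePreserving (partialFourier f) hJ] with q h1 h2 h3
  rw [h2, h3, Function.comp_apply, h1]
  rfl

/-- After `Φ_α⁻¹` the two operators are multiplications, by a function of `x_α` and by a function of
`p_α`. -/
theorem boundedV_mulL2 (hu : IsWeight u) (α : Fin 3) {φ : E → ℝ} (hφ : BddMeas φ) (f : L2Two) :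
    boundedV hm u α (mulL2 (fun q => φ (thirdMomentum m α q)) f)
      = mulL2 (fun q => φ (thirdMomentum m α q)) (boundedV hm u α f) := by
  have h : (Phi m hm α).symm (mulL2 (fun q => φ (thirdMomentum m α q)) f)
      = mulL2 (fun w : E × E => φ w.1) ((Phi m hm α).symm f) := by
    rw [LinearIsometryEquiv.symm_apply_eq, Phi_mulL2_fst hm α hφ,
      LinearIsometryEquiv.apply_symm_apply]
  rw [boundedV_apply, boundedV_apply, h,
    mulL2_comm (hu.bddMeas.comp measurable_snd) (hφ.comp measurable_fst), Phi_mulL2_fst hm α hφ]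

/-! ### Dominated convergence in `L²` -/

theorem tendsto_eLpNorm_sub_of_dominated {X V : Type*} [MeasurableSpace X] [NormedAddCommGroup V]
    {μ : Measure X} {F : X → V} {Fn : ℕ → X → V} (hF : MemLp F 2 μ)
    (hm : ∀ n, AEStronglyMeasurable (Fn n) μ) (hle : ∀ n, ∀ᵐ x ∂μ, ‖Fn n x‖ ≤ ‖F x‖)
    (hlim : ∀ᵐ x ∂μ, Filter.Tendsto (fun n => Fn n x) Filter.atTop (nhds (F x))) :
    Filter.Tendsto (fun n => eLpNorm (Fn n - F) 2 μ) Filter.atTop (nhds 0) := by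
  have h2 : Filter.Tendsto (fun n => eLpNorm (Fn n - F) 2 μ ^ 2) Filter.atTop (nhds 0) := by
    simp_rw [eLpNorm_two_sq]
    rw [show (0 : ENNReal) = ∫⁻ _, 0 ∂μ by simp]
    refine tendsto_lintegral_of_dominated_convergence' (fun x => (2 * ‖F x‖ₑ) ^ 2)
      (fun n => ((hm n).sub hF.1).enorm.pow_const 2) (fun n => ?_) ?_ ?_
    · filter_upwards [hle n] with x hx
      rw [Pi.sub_apply, two_mul]
      gcongr
      refine (enorm_sub_le).trans ?_
      gcongr
      exact enorm_le_iff_norm_le.2 hx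
    · simp_rw [mul_pow]
      rw [lintegral_const_mul' _ _ (by norm_num)]
      exact ENNReal.mul_ne_top (by norm_num) ((memLp_two_iff _ hF.1).1 hF).ne
    · filter_upwards [hlim] with x hx
      have h3 : Filter.Tendsto (fun n => ‖(Fn n - F) x‖ₑ ^ 2) Filter.atTop
          (nhds (‖F x - F x‖ₑ ^ 2)) :=
        ENNReal.Tendsto.pow (hx.sub_const (F x)).enorm
      simpa using h3
  have h3 : Filter.Tendsto (fun n => (eLpNorm (Fn n - F) 2 μ ^ 2) ^ (1 / 2 : ℝ)) Filter.atTop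
      (nhds (0 ^ (1 / 2 : ℝ))) := (ENNReal.continuous_rpow_const.tendsto 0).comp h2
  rw [ENNReal.zero_rpow_of_pos (by norm_num)] at h3
  refine h3.congr fun n => ?_
  rw [← ENNReal.rpow_natCast, ← ENNReal.rpow_mul]
  norm_num

theorem tendsto_mulL2 {X : Type*} [MeasurableSpace X] {μ : Measure X} {c : ℕ → X → ℝ}
    (hc : ∀ n, BddMeas (c n)) (h1 : ∀ n x, |c n x| ≤ 1)
    (hlim : ∀ᵐ x ∂μ, Filter.Tendsto (fun n => c n x) Filter.atTop (nhds 1)) (f : Lp ℂ 2 μ) :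
    Filter.Tendsto (fun n => mulL2 (c n) f) Filter.atTop (nhds f) := by
  rw [Lp.tendsto_Lp_iff_tendsto_eLpNorm']
  refine tendsto_eLpNorm_sub_of_dominated (Lp.memLp f) (fun n => Lp.aestronglyMeasurable _)
    (fun n => ?_) ?_
  · filter_upwards [coeFn_mulL2 (hc n) f] with x hx
    rw [hx, norm_mul, Complex.norm_real]
    exact mul_le_of_le_one_left (norm_nonneg _) (h1 n x)
  · filter_upwards [hlim, ae_all_iff.2 fun n => coeFn_mulL2 (hc n) f] with x hx hn
    simp_rw [hn]
    simpa using ((Complex.continuous_ofReal.tendsto 1).comp hx).mul_const (f x)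

theorem mulL2_add {X : Type*} [MeasurableSpace X] {μ : Measure X} {a b : X → ℝ}
    (ha : BddMeas a) (hb : BddMeas b) (hab : BddMeas fun x => a x + b x) :
    (mulL2 (fun x => a x + b x) : Lp ℂ 2 μ →L[ℂ] Lp ℂ 2 μ) = mulL2 a + mulL2 b := by
  ext1 f
  apply Lp.ext
  rw [add_apply]
  filter_upwards [coeFn_mulL2 hab f, coeFn_mulL2 ha f, coeFn_mulL2 hb f,
    Lp.coeFn_add (mulL2 a f) (mulL2 b f)] with x h1 h2 h3 h4
  rw [h1, h4, Pi.add_apply, h2, h3, Complex.ofReal_add, add_mul]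

/-! ### Truncation of unbounded functions. -/

/-- Cutting off a function where it is larger than `n`. -/
def truncate {X : Type*} (n : ℕ) (A : X → ℝ) : X → ℝ := {x | A x ≤ n}.indicator A

theorem BddMeas.truncate {X : Type*} [MeasurableSpace X] {A : X → ℝ} (hA : Measurable A)
    (h0 : ∀ x, 0 ≤ A x) (n : ℕ) : BddMeas (truncate n A) := by
  refine ⟨hA.indicator (measurableSet_le hA measurable_const), n, fun x => ?_⟩
  by_cases hx : A x ≤ n
  · rw [ThreeBody.truncate, Set.indicator_of_mem (by exact hx), abs_of_nonneg (h0 x)]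
    exact hx
  · rw [ThreeBody.truncate, Set.indicator_of_notMem (by exact hx), abs_zero]
    exact n.cast_nonneg

theorem eventually_indicator_eq {X : Type*} {f g : X → ℝ} (x : X) :
    ∀ᶠ n : ℕ in Filter.atTop, {x | f x ≤ n}.indicator g x = g x := by
  obtain ⟨N, hN⟩ := exists_nat_ge (f x)
  filter_upwards [Filter.eventually_ge_atTop N] with n hn
  exact Set.indicator_of_mem (s := {x | f x ≤ n}) (hN.trans (Nat.cast_le.2 hn)) g

end

section

/-! ### The sandwiched operators with unbounded multipliers -/

/-- A nonnegative measurable function which is bounded outside of the unit ball and square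
integrable inside. -/
structure IsMultiplier (A : E → ℝ) : Prop where
  measurable : Measurable A
  nonneg : ∀ p, 0 ≤ A p
  exists_le : ∃ C, ∀ p, 1 ≤ ‖p‖ → A p ≤ C
  memLp : MemLp ({p | ‖p‖ < 1}.indicator A) 2 volume

/-- Conditions on a product `A(p_α) r(p_α, p_β) A'(p_β)` under which it defines a compact operator
between `|V_α|^{1/2}` and `|V_β|^{1/2}`; here `kin` plays the role of the kinetic energy and `r` of
its resolvent. -/
structure IsSandwich (A A' : E → ℝ) (kin r : E × E → ℝ) : Prop where
  left : IsMultiplier A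
  right : IsMultiplier A'
  measurable_kin : Measurable kin
  measurable_res : Measurable r
  res_nonneg : ∀ w, 0 ≤ r w
  res_le : ∀ R > 0, ∀ w, R < kin w → r w ≤ R⁻¹
  kin_le : ∃ R, ∀ w : E × E, ‖w.1‖ < 1 → ‖w.2‖ < 1 → kin w ≤ R
  memLp : ∀ R, MemLp ({w | kin w ≤ R}.indicator fun w => A w.1 * A' w.2 * r w) 2 volume

variable {m : Fin 3 → ℝ} (hm : ∀ i, 0 < m i) {α β : Fin 3} {u u' : E → ℝ}
  {A A' : E → ℝ} {kin r : E × E → ℝ}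

/-- The pair `(p_α, p_β)`. -/
def thirds (m : Fin 3 → ℝ) (α β : Fin 3) (q : E × E) : E × E :=
  (thirdMomentum m α q, thirdMomentum m β q)

theorem measurable_thirds (hm : ∀ i, 0 < m i) (α β : Fin 3) : Measurable (thirds m α β) :=
  (measurable_thirdMomentum m hm α).prodMk (measurable_thirdMomentum m hm β)

theorem norm_sandwich_le (u u' : E → ℝ) (α β : Fin 3) (w : E × E → ℝ) : ‖sandwich hm u u' α β w‖
    ≤ ‖boundedV hm u α‖ * ‖(mulL2 w).comp (boundedV hm u' β)‖ :=
  ContinuousLinearMap.opNorm_comp_le _ _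

theorem norm_sandwich_le' (u u' : E → ℝ) (α β : Fin 3) (w : E × E → ℝ) : ‖sandwich hm u u' α β w‖
    ≤ ‖(boundedV hm u α).comp (mulL2 w)‖ * ‖boundedV hm u' β‖ :=
  ContinuousLinearMap.opNorm_comp_le ((boundedV hm u α).comp (mulL2 w)) _

theorem sandwich_add (u u' : E → ℝ) (α β : Fin 3) {w w' : E × E → ℝ} (hw : BddMeas w)
    (hw' : BddMeas w') (hww' : BddMeas fun q => w q + w' q) :
    sandwich hm u u' α β (fun q => w q + w' q)
      = sandwich hm u u' α β w + sandwich hm u u' α β w' := by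
  rw [sandwich, mulL2_add hw hw' hww', ContinuousLinearMap.add_comp, ContinuousLinearMap.comp_add]
  rfl

theorem sandwich_sub (u u' : E → ℝ) (α β : Fin 3) {w w' : E × E → ℝ} (hw : BddMeas w)
    (hw' : BddMeas w') : sandwich hm u u' α β (fun q => w q - w' q)
      = sandwich hm u u' α β w - sandwich hm u u' α β w' := by
  rw [sandwich, mulL2_sub hw hw', ContinuousLinearMap.sub_comp, ContinuousLinearMap.comp_sub]
  rfl

theorem norm_sandwich_split_le (u u' : E → ℝ) (α β : Fin 3) {V : E × E → ℝ} (hV : BddMeas V)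
    {s : Set (E × E)} (hs : MeasurableSet s) :
    ‖sandwich hm u u' α β fun q => V (thirds m α β q)‖
      ≤ ‖sandwich hm u u' α β fun q => s.indicator V (thirds m α β q)‖
        + ‖sandwich hm u u' α β fun q => sᶜ.indicator V (thirds m α β q)‖ := by
  have hD := measurable_thirds hm α β
  have h := sandwich_add hm u u' α β ((hV.indicator hs).comp hD) ((hV.indicator hs.compl).comp hD)
    (by
      simp_rw [← Pi.add_apply (s.indicator V), Set.indicator_self_add_compl]
      exact hV.comp hD)
  simp_rw [← Pi.add_apply (s.indicator V), Set.indicator_self_add_compl] at h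
  rw [h]
  exact norm_add_le _ _

/-- The high-energy estimate. Since `V` vanishes when both momenta lie in the unit ball, at most one
of `A`, `A'` is singular at any point of its support, and the neighbouring `|V|^{1/2}` of the other
pair absorbs it. The constant depends on neither `V` nor `ε`. -/
theorem exists_norm_sandwich_le (hu : IsWeight u) (hu' : IsWeight u') (hαβ : α ≠ β)
    (hA : IsMultiplier A) (hA' : IsMultiplier A') :
    ∃ C, 0 ≤ C ∧ ∀ V : E × E → ℝ, BddMeas V → ∀ ε, 0 ≤ ε →
      (∀ w, |V w| ≤ ε * (A w.1 * A' w.2)) → (∀ w : E × E, ‖w.1‖ < 1 → ‖w.2‖ < 1 → V w = 0) →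
      ‖sandwich hm u u' α β fun q => V (thirds m α β q)‖ ≤ ε * C := by
  obtain ⟨C₁, hC₁⟩ := hA.exists_le
  obtain ⟨C₂, hC₂⟩ := hA'.exists_le
  wlog h₁ : 0 ≤ C₁ generalizing C₁
  · exact this (max C₁ 0) (fun p hp => (hC₁ p hp).trans (le_max_left _ _)) (le_max_right _ _)
  wlog h₂ : 0 ≤ C₂ generalizing C₂
  · exact this (max C₂ 0) (fun p hp => (hC₂ p hp).trans (le_max_left _ _)) (le_max_right _ _)
  have hB : MeasurableSet {p : E | ‖p‖ < 1} := measurableSet_lt measurable_norm measurable_const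
  set a := {p : E | ‖p‖ < 1}.indicator A with ha
  set a' := {p : E | ‖p‖ < 1}.indicator A' with ha'
  have hD := measurable_thirds hm α β
  have hw := weightConst_nonneg u
  have hw' := weightConst_nonneg u'
  refine ⟨‖boundedV hm u α‖ * (weightConst u' * (C₂ * (eLpNorm a 2 volume).toReal))
    + (weightConst u * (C₁ * (eLpNorm a' 2 volume).toReal) * ‖boundedV hm u' β‖
    + ‖boundedV hm u α‖ * (C₁ * C₂ * ‖boundedV hm u' β‖)), by positivity,
    fun V hV ε hε hle h0 => ?_⟩
  set s₁ : Set (E × E) := {w | ‖w.1‖ < 1} with hs₁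
  set s₂ : Set (E × E) := {w | ‖w.2‖ < 1} with hs₂
  have hs₁m : MeasurableSet s₁ := measurableSet_lt (measurable_norm.comp measurable_fst)
    measurable_const
  have hs₂m : MeasurableSet s₂ := measurableSet_lt (measurable_norm.comp measurable_snd)
    measurable_const
  have hscale : ∀ (c : ℝ) (b : E → ℝ), 0 ≤ c →
      (eLpNorm (fun p => c * b p) 2 volume).toReal = c * (eLpNorm b 2 volume).toReal := by
    intro c b hc
    change (eLpNorm (c • b) 2 volume).toReal = _
    rw [eLpNorm_const_smul, ENNReal.toReal_mul]
    simp [abs_of_nonneg hc]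
  refine (norm_sandwich_split_le hm u u' α β hV hs₁m).trans ?_
  rw [mul_add]
  refine add_le_add ?_ ((norm_sandwich_split_le hm u u' α β (hV.indicator hs₁m.compl)
    hs₂m).trans ?_)
  -- Region `|p_α| < 1`: on the support `|p_β| ≥ 1`, so `A' ≤ C₂`, while the singular `a(p_α)` is
  -- absorbed by `|V_β|^{1/2}` on the right.
  · refine (norm_sandwich_le hm _ _ _ _ _).trans ?_
    rw [mul_left_comm]
    refine mul_le_mul_of_nonneg_left ?_ (norm_nonneg _)
    refine (norm_mulL2_boundedV_le hm hu' hαβ ((hV.indicator hs₁m).comp hD)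
      (a := fun p => ε * C₂ * a p) ((hA.measurable.indicator hB).const_mul _)
      (hA.memLp.const_mul _) fun q => ?_).trans_eq ?_
    · set w := thirds m α β q with hwq
      have hwa : thirdMomentum m α q = w.1 := rfl
      rw [hwa]
      have hapos : 0 ≤ a w.1 := Set.indicator_nonneg (fun p _ => hA.nonneg p) _
      by_cases hw1 : ‖w.1‖ < 1
      · rw [Set.indicator_of_mem (by exact hw1), ha, Set.indicator_of_mem (by exact hw1)]
        by_cases hw2 : ‖w.2‖ < 1
        · rw [h0 w hw1 hw2, abs_zero]
          exact mul_nonneg (mul_nonneg hε h₂) (hA.nonneg _)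
        · refine (hle w).trans ?_
          rw [mul_assoc, mul_comm C₂]
          exact mul_le_mul_of_nonneg_left (mul_le_mul_of_nonneg_left (hC₂ _ (not_lt.1 hw2))
            (hA.nonneg _)) hε
      · rw [Set.indicator_of_notMem (by exact hw1), abs_zero]
        positivity
    · rw [hscale _ _ (by positivity)]
      ring
  rw [mul_add]
  refine add_le_add ?_ ?_
  -- Region `|p_α| ≥ 1`, `|p_β| < 1`: the mirror image, with `a'(p_β)` absorbed by `|V_α|^{1/2}` on
  -- the left.
  · refine (norm_sandwich_le' hm _ _ _ _ _).trans ?_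
    rw [← mul_assoc]
    refine mul_le_mul_of_nonneg_right ?_ (norm_nonneg _)
    refine (norm_boundedV_mulL2_le hm hu hαβ (((hV.indicator hs₁m.compl).indicator hs₂m).comp hD)
      (a := fun p => ε * C₁ * a' p) ((hA'.measurable.indicator hB).const_mul _)
      (hA'.memLp.const_mul _) fun q => ?_).trans_eq ?_
    · set w := thirds m α β q with hwq
      have hwa : thirdMomentum m β q = w.2 := rfl
      rw [hwa]
      have hapos : 0 ≤ a' w.2 := Set.indicator_nonneg (fun p _ => hA'.nonneg p) _
      by_cases hw2 : ‖w.2‖ < 1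
      · rw [Set.indicator_of_mem (show w ∈ s₂ from hw2), ha',
          Set.indicator_of_mem (show w.2 ∈ {p : E | ‖p‖ < 1} from hw2)]
        by_cases hw1 : ‖w.1‖ < 1
        · rw [Set.indicator_of_notMem (by simpa [hs₁] using hw1), abs_zero]
          exact mul_nonneg (mul_nonneg hε h₁) (hA'.nonneg _)
        · rw [Set.indicator_of_mem (by simpa [hs₁] using hw1)]
          refine (hle w).trans ?_
          rw [mul_assoc]
          exact mul_le_mul_of_nonneg_left (mul_le_mul_of_nonneg_right (hC₁ _ (not_lt.1 hw1))
            (hA'.nonneg _)) hε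
      · rw [Set.indicator_of_notMem (by exact hw2), abs_zero]
        positivity
    · rw [hscale _ _ (by positivity)]
      ring
  -- Region where both momenta are at least `1`: the multiplier itself is bounded by `ε C₁ C₂`.
  · refine (norm_sandwich_le hm _ _ _ _ _).trans ?_
    rw [mul_left_comm]
    refine mul_le_mul_of_nonneg_left ((ContinuousLinearMap.opNorm_comp_le _ _).trans ?_)
      (norm_nonneg _)
    rw [← mul_assoc]
    refine mul_le_mul_of_nonneg_right (norm_mulL2_le
      (((hV.indicator hs₁m.compl).indicator hs₂m.compl).comp hD) (fun q => ?_) (by positivity))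
      (norm_nonneg _)
    set w := thirds m α β q with hwq
    by_cases hw2 : ‖w.2‖ < 1
    · rw [Set.indicator_of_notMem (by simpa [hs₂] using hw2), abs_zero]
      positivity
    rw [Set.indicator_of_mem (by simpa [hs₂] using hw2)]
    by_cases hw1 : ‖w.1‖ < 1
    · rw [Set.indicator_of_notMem (by simpa [hs₁] using hw1), abs_zero]
      positivity
    rw [Set.indicator_of_mem (by simpa [hs₁] using hw1)]
    refine (hle w).trans (mul_le_mul_of_nonneg_left ?_ hε)
    exact mul_le_mul (hC₁ _ (not_lt.1 hw1)) (hC₂ _ (not_lt.1 hw2)) (hA'.nonneg _) h₁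

/-! ### Truncated multipliers and norm convergence. -/

/-- The truncation of `A(p) r(p, q) A'(q)` at level `n`. -/
def cutWeight (A A' : E → ℝ) (kin r : E × E → ℝ) (n : ℕ) (w : E × E) : ℝ :=
  truncate n A w.1 * ({w | kin w ≤ n}.indicator (truncate n r) w * truncate n A' w.2)

theorem truncate_nonneg {X : Type*} {f : X → ℝ} (hf : ∀ x, 0 ≤ f x) (n : ℕ) (x : X) :
    0 ≤ truncate n f x :=
  Set.indicator_nonneg (fun x _ => hf x) x

theorem truncate_le {X : Type*} {f : X → ℝ} (hf : ∀ x, 0 ≤ f x) (n : ℕ) (x : X) :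
    truncate n f x ≤ f x :=
  Set.indicator_le_self' (fun x _ => hf x) x

namespace IsSandwich

theorem bddMeas_cut (h : IsSandwich A A' kin r) (n : ℕ) :
    BddMeas ({w | kin w ≤ n}.indicator (truncate n r)) :=
  (BddMeas.truncate h.measurable_res h.res_nonneg n).indicator
    (measurableSet_le h.measurable_kin measurable_const)

theorem bddMeas_cutWeight (h : IsSandwich A A' kin r) (n : ℕ) :
    BddMeas (cutWeight A A' kin r n) :=
  ((BddMeas.truncate h.left.measurable h.left.nonneg n).comp measurable_fst).mul
    ((h.bddMeas_cut n).mul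
      ((BddMeas.truncate h.right.measurable h.right.nonneg n).comp measurable_snd))

theorem cutWeight_nonneg (h : IsSandwich A A' kin r) (n : ℕ) (w : E × E) :
    0 ≤ cutWeight A A' kin r n w :=
  mul_nonneg (truncate_nonneg h.left.nonneg _ _) (mul_nonneg
    (Set.indicator_nonneg (fun _ _ => truncate_nonneg h.res_nonneg _ _) _)
    (truncate_nonneg h.right.nonneg _ _))

theorem cutWeight_le (h : IsSandwich A A' kin r) (n : ℕ) (w : E × E) :
    cutWeight A A' kin r n w ≤ A w.1 * A' w.2 * r w := by
  rw [mul_assoc, mul_comm (A' w.2), cutWeight]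
  have h1 := truncate_nonneg h.left.nonneg n w.1
  have h2 := truncate_nonneg h.right.nonneg n w.2
  have h3 := h.res_nonneg w
  have h4 := h.left.nonneg w.1
  refine mul_le_mul (truncate_le h.left.nonneg _ _) (mul_le_mul ?_ (truncate_le h.right.nonneg _ _)
    h2 h3) (mul_nonneg (Set.indicator_nonneg (fun _ _ => truncate_nonneg h.res_nonneg _ _) _) h2) h4
  exact (Set.indicator_le_self' (fun x _ => truncate_nonneg h.res_nonneg n x) w).trans
    (truncate_le h.res_nonneg _ _)

theorem cutWeight_eventually_eq (w : E × E) :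
    ∀ᶠ n in Filter.atTop, cutWeight A A' kin r n w = A w.1 * A' w.2 * r w := by
  filter_upwards [eventually_indicator_eq (f := A) (g := A) w.1,
    eventually_indicator_eq (f := A') (g := A') w.2, eventually_indicator_eq (f := r) (g := r) w,
    eventually_indicator_eq (f := kin) (g := r) w] with n h1 h2 h3 h4
  have h5 : {w | kin w ≤ n}.indicator (truncate n r) w = r w := by
    rw [← h4]
    by_cases hw : kin w ≤ n
    · rw [Set.indicator_of_mem (by exact hw), Set.indicator_of_mem (by exact hw)]
      exact h3
    · rw [Set.indicator_of_notMem (by exact hw), Set.indicator_of_notMem (by exact hw)]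
  rw [cutWeight, h5, truncate, truncate, h1, h2]
  ring

/-- The cut-off in the kinetic energy confines the weight to a set where the full product is already
square integrable. -/
theorem memLp_cutWeight (h : IsSandwich A A' kin r) (n : ℕ) :
    MemLp (cutWeight A A' kin r n) 2 volume := by
  refine (h.memLp n).of_le (h.bddMeas_cutWeight n).1.aestronglyMeasurable
    (Filter.Eventually.of_forall fun w => ?_)
  by_cases hw : kin w ≤ n
  · rw [Set.indicator_of_mem (by exact hw), Real.norm_of_nonneg (h.cutWeight_nonneg n w)]
    exact (h.cutWeight_le n w).trans (le_abs_self _)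
  · rw [cutWeight, Set.indicator_of_notMem (by exact hw)]
    simp

theorem abs_sub_cutWeight_le (h : IsSandwich A A' kin r) (n k : ℕ) (w : E × E) :
    |cutWeight A A' kin r n w - cutWeight A A' kin r k w| ≤ A w.1 * A' w.2 * r w := by
  rw [abs_sub_le_iff]
  have h1 := h.cutWeight_nonneg n w
  have h2 := h.cutWeight_nonneg k w
  have h3 := h.cutWeight_le n w
  have h4 := h.cutWeight_le k w
  constructor <;> linarith

theorem tendsto_indicator_cutWeight (h : IsSandwich A A' kin r) (R : ℝ) :
    Filter.Tendsto (fun n => eLpNorm ({w | kin w ≤ R}.indicator (cutWeight A A' kin r n)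
      - {w | kin w ≤ R}.indicator fun w => A w.1 * A' w.2 * r w) 2 volume)
      Filter.atTop (nhds 0) := by
  refine tendsto_eLpNorm_sub_of_dominated (h.memLp R) (fun n =>
    ((h.bddMeas_cutWeight n).1.indicator
      (measurableSet_le h.measurable_kin measurable_const)).aestronglyMeasurable)
    (fun n => Filter.Eventually.of_forall fun w => ?_) (Filter.Eventually.of_forall fun w => ?_)
  · by_cases hw : kin w ≤ R
    · rw [Set.indicator_of_mem (by exact hw), Set.indicator_of_mem (by exact hw),
        Real.norm_of_nonneg (h.cutWeight_nonneg n w)]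
      exact (h.cutWeight_le n w).trans (le_abs_self _)
    · rw [Set.indicator_of_notMem (by exact hw), Set.indicator_of_notMem (by exact hw)]
  · refine tendsto_const_nhds.congr' ?_
    filter_upwards [cutWeight_eventually_eq (A := A) (A' := A') (kin := kin) (r := r) w] with n hn
    by_cases hw : kin w ≤ R
    · rw [Set.indicator_of_mem (by exact hw), Set.indicator_of_mem (by exact hw), hn]
    · rw [Set.indicator_of_notMem (by exact hw), Set.indicator_of_notMem (by exact hw)]

/-- The approximation of the sandwiched operator by Hilbert–Schmidt operators. -/
def approx (u u' : E → ℝ) (α β : Fin 3) (A A' : E → ℝ) (kin r : E × E → ℝ) (n : ℕ) :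
    L2Two →L[ℂ] L2Two :=
  sandwich hm u u' α β fun q => cutWeight A A' kin r n (thirds m α β q)

/-- The difference of two truncations is split at energy `R`. Above `R` it is at most `R⁻¹ A A'`,
uniformly in the levels, and `exists_norm_sandwich_le` applies. Below `R` its `L²` norm is small by
dominated convergence, and the kernel bound applies. -/
theorem cauchySeq_approx (h : IsSandwich A A' kin r) (hu : IsWeight u) (hu' : IsWeight u')
    (hαβ : α ≠ β) : CauchySeq (approx hm u u' α β A A' kin r) := by
  obtain ⟨C, hC, hCV⟩ := exists_norm_sandwich_le hm hu hu' hαβ h.left h.right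
  obtain ⟨R₀, hR₀⟩ := h.kin_le
  have hD := measurable_thirds hm α β
  set K := weightConst u * weightConst u' with hK
  have hK0 : 0 ≤ K := mul_nonneg (weightConst_nonneg _) (weightConst_nonneg _)
  rw [Metric.cauchySeq_iff]
  intro ε hε
  -- `R ≥ R₀` makes the high-energy part vanish when both momenta are in the unit ball, `1` keeps
  -- `R` positive, and `4C/ε` makes that part at most `ε/4`.
  set R := max (max R₀ 1) (4 * C / ε) with hR
  have hR1 : 0 < R := lt_of_lt_of_le one_pos ((le_max_right _ _).trans (le_max_left _ _))
  have hRC : R⁻¹ * C ≤ ε / 4 := by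
    have : 4 * C / ε ≤ R := le_max_right _ _
    rw [div_le_iff₀ hε] at this
    rw [inv_mul_le_iff₀ hR1]
    linarith
  -- Each truncation is within `δ` of the limit, so the two differ by `2δ`; `K + 1` avoids division
  -- by zero.
  set δ := ε / (8 * (K + 1)) with hδ
  have hδ0 : 0 < δ := by positivity
  have hKδ : K * (2 * δ) ≤ ε / 4 := by
    rw [hδ]
    have : K * (2 * (ε / (8 * (K + 1)))) = ε / 4 * (K / (K + 1)) := by
      field_simp
      ring
    rw [this]
    refine mul_le_of_le_one_right (by positivity) ?_
    rw [div_le_one (by positivity)]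
    linarith
  obtain ⟨N, hN⟩ := Filter.eventually_atTop.1 ((h.tendsto_indicator_cutWeight R).eventually_le_const
    (ENNReal.ofReal_pos.2 hδ0))
  refine ⟨N, fun n hn k hk => ?_⟩
  have hn' := hN n hn
  have hk' := hN k hk
  set S : Set (E × E) := {w | kin w ≤ R} with hS
  have hSm : MeasurableSet S := measurableSet_le h.measurable_kin measurable_const
  set V : E × E → ℝ := fun w => cutWeight A A' kin r n w - cutWeight A A' kin r k w with hV
  have hVb : BddMeas V := (h.bddMeas_cutWeight n).sub (h.bddMeas_cutWeight k)
  rw [dist_eq_norm, approx, approx, ← sandwich_sub hm u u' α β ((h.bddMeas_cutWeight n).comp hD)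
    ((h.bddMeas_cutWeight k).comp hD)]
  refine lt_of_le_of_lt (norm_sandwich_split_le hm u u' α β hVb hSm) ?_
  have h1 : ‖sandwich hm u u' α β fun q => S.indicator V (thirds m α β q)‖ ≤ ε / 4 := by
    have hVm : MemLp V 2 volume := (h.memLp_cutWeight n).sub (h.memLp_cutWeight k)
    refine ((isCompactOperator_sandwich hm hu hu' hαβ (hVb.indicator hSm)
      (hVm.indicator hSm)).2).trans (le_trans (mul_le_mul_of_nonneg_left ?_ hK0) hKδ)
    refine ENNReal.toReal_le_of_le_ofReal (by positivity) ?_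
    have e : S.indicator V = (S.indicator (cutWeight A A' kin r n)
        - S.indicator fun w => A w.1 * A' w.2 * r w) - (S.indicator (cutWeight A A' kin r k)
        - S.indicator fun w => A w.1 * A' w.2 * r w) := by
      rw [sub_sub_sub_cancel_right, hV]
      exact Set.indicator_sub _ _ _
    rw [e]
    have hmn : ∀ n, AEStronglyMeasurable (S.indicator (cutWeight A A' kin r n)
        - S.indicator fun w => A w.1 * A' w.2 * r w) volume := fun n =>
      (((h.bddMeas_cutWeight n).1.indicator hSm).aestronglyMeasurable).sub (h.memLp R).1
    refine (eLpNorm_sub_le (hmn n) (hmn k) (by norm_num)).trans ?_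
    rw [two_mul, ENNReal.ofReal_add hδ0.le hδ0.le]
    exact add_le_add hn' hk'
  have h2 : ‖sandwich hm u u' α β fun q => Sᶜ.indicator V (thirds m α β q)‖ ≤ ε / 4 := by
    refine (hCV _ (hVb.indicator hSm.compl) R⁻¹ (inv_nonneg.2 hR1.le) (fun w => ?_)
      (fun w hw1 hw2 => ?_)).trans hRC
    · have hAA := mul_nonneg (h.left.nonneg w.1) (h.right.nonneg w.2)
      by_cases hw : kin w ≤ R
      · rw [Set.indicator_of_notMem (by simpa [hS] using hw), abs_zero]
        exact mul_nonneg (inv_nonneg.2 hR1.le) hAA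
      · rw [Set.indicator_of_mem (by simpa [hS] using hw)]
        refine (h.abs_sub_cutWeight_le n k w).trans ?_
        rw [mul_comm]
        exact mul_le_mul_of_nonneg_right (h.res_le R hR1 w (not_le.1 hw)) hAA
    · refine Set.indicator_of_notMem ?_ _
      have : kin w ≤ R := (hR₀ w hw1 hw2).trans ((le_max_left _ _).trans (le_max_left _ _))
      simpa [hS] using this
  linarith

theorem exists_compact_limit (h : IsSandwich A A' kin r) (hu : IsWeight u) (hu' : IsWeight u')
    (hαβ : α ≠ β) : ∃ T : L2Two →L[ℂ] L2Two, IsCompactOperator T ∧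
      Filter.Tendsto (approx hm u u' α β A A' kin r) Filter.atTop (nhds T) := by
  obtain ⟨T, hT⟩ := cauchySeq_tendsto_of_complete (h.cauchySeq_approx hm hu hu' hαβ)
  refine ⟨T, isCompactOperator_of_tendsto hT (Filter.Eventually.of_forall fun n => ?_), hT⟩
  exact (isCompactOperator_sandwich hm hu hu' hαβ (h.bddMeas_cutWeight n)
    (h.memLp_cutWeight n)).1

end IsSandwich

end

/-! ### The product on its natural domain, and its agreement with the compact limit. -/

section

variable {m : Fin 3 → ℝ} (hm : ∀ i, 0 < m i) {α β : Fin 3} {u u' : E → ℝ}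
  {A A' : E → ℝ} {kin r : E × E → ℝ}

/-- The relation `g = A(p_α) |V_α|^{1/2} r |V_β|^{1/2} A'(p_β) f`, where all intermediate functions
are required to be square integrable. -/
def SandwichRel (u u' : E → ℝ) (α β : Fin 3) (A A' : E → ℝ) (r : E × E → ℝ) (f g : L2Two) : Prop :=
  ∃ f₁ f₃ : L2Two, (f₁ =ᵐ[volume] fun q => (A' (thirdMomentum m β q) : ℂ) * f q) ∧
    (f₃ =ᵐ[volume] fun q => (r (thirds m α β q) : ℂ) * boundedV hm u' β f₁ q) ∧
    (g =ᵐ[volume] fun q => (A (thirdMomentum m α q) : ℂ) * boundedV hm u α f₃ q)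

theorem eq_of_forall_mulL2_indicator_eq {f g : L2Two} {F : E × E → ℝ} (hF : Measurable F)
    (h : ∀ k : ℕ, mulL2 ({q | F q ≤ k}.indicator fun _ => (1 : ℝ)) f
      = mulL2 ({q | F q ≤ k}.indicator fun _ => (1 : ℝ)) g) : f = g := by
  have hb : ∀ k : ℕ, BddMeas ({q | F q ≤ k}.indicator fun _ => (1 : ℝ)) := fun k =>
    BddMeas.indicator_one (measurableSet_le hF measurable_const)
  apply Lp.ext
  filter_upwards [ae_all_iff.2 fun k => coeFn_mulL2 (hb k) f,
    ae_all_iff.2 fun k => coeFn_mulL2 (hb k) g] with q h1 h2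
  obtain ⟨k, hk⟩ := exists_nat_ge (F q)
  have h3 := (h1 k).symm.trans ((congrArg (fun y : L2Two => y q) (h k)).trans (h2 k))
  rw [Set.indicator_of_mem (by exact hk)] at h3
  simpa using h3

theorem bddMeas_indicator_le {X : Type*} [MeasurableSpace X] {F : X → ℝ} (hF : Measurable F)
    (c : ℝ) : BddMeas ({q | F q ≤ c}.indicator fun _ => (1 : ℝ)) :=
  BddMeas.indicator_one (measurableSet_le hF measurable_const)

theorem mulL2_congr_apply {X : Type*} [MeasurableSpace X] {μ : Measure X} {a b : X → ℝ}
    (ha : BddMeas a) (hb : BddMeas b) {f g : Lp ℂ 2 μ}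
    (h : ∀ᵐ x ∂μ, (a x : ℂ) * f x = (b x : ℂ) * g x) : mulL2 a f = mulL2 b g := by
  apply Lp.ext
  filter_upwards [h, coeFn_mulL2 ha f, coeFn_mulL2 hb g] with x h1 h2 h3
  rw [h2, h3, h1]

theorem indicator_mul_truncate {X : Type*} {F : X → ℝ} {k n : ℕ} (hkn : k ≤ n) (x : X) :
    {x | F x ≤ k}.indicator (fun _ => (1 : ℝ)) x * truncate n F x = truncate k F x := by
  by_cases hx : F x ≤ k
  · have hn : F x ≤ n := hx.trans (Nat.cast_le.2 hkn)
    simp [truncate, hx, hn]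
  · simp [truncate, hx]

theorem truncate_eq_indicator_mul {X : Type*} {F : X → ℝ} (n : ℕ) (x : X) :
    truncate n F x = {x | F x ≤ n}.indicator (fun _ => (1 : ℝ)) x * F x := by
  by_cases hx : F x ≤ n
  · rw [truncate, Set.indicator_of_mem (by exact hx), Set.indicator_of_mem (by exact hx), one_mul]
  · rw [truncate, Set.indicator_of_notMem (by exact hx), Set.indicator_of_notMem (by exact hx),
      zero_mul]

/-- Unbounded functions of `p_α` commute with `|V_α|^{1/2}`. -/
theorem coeFn_boundedV_of_mul (hu : IsWeight u) (α : Fin 3) (hA : Measurable A)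
    (hA0 : ∀ p, 0 ≤ A p) {y y' : L2Two}
    (h : y' =ᵐ[volume] fun q => (A (thirdMomentum m α q) : ℂ) * y q) :
    boundedV hm u α y' =ᵐ[volume] fun q => (A (thirdMomentum m α q) : ℂ) * boundedV hm u α y q := by
  have hp := measurable_thirdMomentum m hm α
  have hb : ∀ k : ℕ, BddMeas ({p | A p ≤ k}.indicator fun _ => (1 : ℝ)) := fun k =>
    bddMeas_indicator_le hA k
  have ht : ∀ k : ℕ, BddMeas (truncate k A) := fun k => BddMeas.truncate hA hA0 k
  -- Restricted to `{A ≤ k}` only bounded functions of `p_α` occur, and for these the commutation is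
  -- known; the sets exhaust the space.
  have h1 : ∀ k : ℕ,
      mulL2 (fun q => {p | A p ≤ k}.indicator (fun _ => (1 : ℝ)) (thirdMomentum m α q))
        (boundedV hm u α y') = mulL2 (fun q => truncate k A (thirdMomentum m α q))
        (boundedV hm u α y) := by
    intro k
    rw [← boundedV_mulL2 hm hu α (hb k), ← boundedV_mulL2 hm hu α (ht k)]
    congr 1
    refine mulL2_congr_apply ((hb k).comp hp) ((ht k).comp hp) ?_
    filter_upwards [h] with q hq
    rw [hq, truncate_eq_indicator_mul, Complex.ofReal_mul, mul_assoc]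
  filter_upwards [ae_all_iff.2 fun k => coeFn_mulL2 ((hb k).comp hp) (boundedV hm u α y'),
    ae_all_iff.2 fun k => coeFn_mulL2 ((ht k).comp hp) (boundedV hm u α y)] with q h2 h3
  obtain ⟨k, hk⟩ := exists_nat_ge (A (thirdMomentum m α q))
  have h4 := (h2 k).symm.trans ((congrArg (fun y : L2Two => y q) (h1 k)).trans (h3 k))
  rw [truncate, Set.indicator_of_mem (by exact hk), Set.indicator_of_mem (by exact hk)] at h4
  simpa using h4

namespace IsSandwich

/-- The truncated `A'` is carried through `|V_β|^{1/2}` onto `f` and leaves a cut-off of `f₁`. The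
truncated resolvent likewise leaves a cut-off of `f₃`. Apart from the outer factor `A`, only
indicator functions remain. -/
theorem approx_apply (h : IsSandwich A A' kin r) (hu : IsWeight u) (hu' : IsWeight u')
    {f f₁ f₃ : L2Two} (h₁ : f₁ =ᵐ[volume] fun q => (A' (thirdMomentum m β q) : ℂ) * f q)
    (h₃ : f₃ =ᵐ[volume] fun q => (r (thirds m α β q) : ℂ) * boundedV hm u' β f₁ q) (n : ℕ) :
    approx hm u u' α β A A' kin r n f = mulL2 (fun q => truncate n A (thirdMomentum m α q))
      (boundedV hm u α (mulL2 (fun q =>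
        {w | kin w ≤ n}.indicator ({w | r w ≤ n}.indicator fun _ => (1 : ℝ)) (thirds m α β q)
        * {p | A' p ≤ n}.indicator (fun _ => (1 : ℝ)) (thirdMomentum m β q)) f₃)) := by
  have hD := measurable_thirds hm α β
  have hα := measurable_thirdMomentum m hm α
  have hβ := measurable_thirdMomentum m hm β
  have hA := BddMeas.truncate h.left.measurable h.left.nonneg n
  have hA' := BddMeas.truncate h.right.measurable h.right.nonneg n
  have hA1 := bddMeas_indicator_le h.right.measurable (n : ℝ)
  have hr := h.bddMeas_cut n
  have hr1 : BddMeas ({w | kin w ≤ n}.indicator ({w | r w ≤ n}.indicator fun _ => (1 : ℝ))) :=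
    (bddMeas_indicator_le h.measurable_res (n : ℝ)).indicator
      (measurableSet_le h.measurable_kin measurable_const)
  have e1 : mulL2 (fun q => truncate n A' (thirdMomentum m β q)) f
      = mulL2 (fun q => {p | A' p ≤ n}.indicator (fun _ => (1 : ℝ)) (thirdMomentum m β q)) f₁ := by
    refine mulL2_congr_apply (hA'.comp hβ) (hA1.comp hβ) ?_
    filter_upwards [h₁] with q hq
    rw [hq, truncate_eq_indicator_mul, Complex.ofReal_mul, mul_assoc]
  change boundedV hm u α (mulL2 (fun q => truncate n A (thirdMomentum m α q) *
    ({w | kin w ≤ n}.indicator (truncate n r) (thirds m α β q)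
      * truncate n A' (thirdMomentum m β q))) (boundedV hm u' β f)) = _
  rw [mulL2_mul (hA.comp hα) ((hr.comp hD).mul (hA'.comp hβ)), boundedV_mulL2 hm hu α hA,
    mulL2_mul (hr.comp hD) (hA'.comp hβ), ← boundedV_mulL2 hm hu' β hA', e1,
    boundedV_mulL2 hm hu' β hA1, ← mulL2_mul (hr.comp hD) (hA1.comp hβ)]
  congr 2
  refine mulL2_congr_apply ((hr.comp hD).mul (hA1.comp hβ)) ((hr1.comp hD).mul (hA1.comp hβ)) ?_
  filter_upwards [h₃] with q hq
  rw [hq]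
  have e : {w | kin w ≤ n}.indicator (truncate n r) (thirds m α β q)
      = {w | kin w ≤ n}.indicator ({w | r w ≤ n}.indicator fun _ => (1 : ℝ)) (thirds m α β q)
        * r (thirds m α β q) := by
    by_cases hk : kin (thirds m α β q) ≤ n
    · rw [Set.indicator_of_mem (by exact hk), Set.indicator_of_mem (by exact hk),
        truncate_eq_indicator_mul]
    · rw [Set.indicator_of_notMem (by exact hk), Set.indicator_of_notMem (by exact hk), zero_mul]
  rw [e]
  push_cast
  ring

/-- After multiplication by the indicator of `{A ≤ k}`, the outer factor of every truncation with `n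
≥ k` is the same bounded function. Strong convergence of the inner cut-offs to the identity, applied
to `f₃`, then identifies the limit on each such set. -/
theorem limit_eq (h : IsSandwich A A' kin r) (hu : IsWeight u) (hu' : IsWeight u')
    {T : L2Two →L[ℂ] L2Two}
    (hT : Filter.Tendsto (approx hm u u' α β A A' kin r) Filter.atTop (nhds T)) {f g : L2Two}
    (hfg : SandwichRel hm u u' α β A A' r f g) : T f = g := by
  obtain ⟨f₁, f₃, h₁, h₃, hg⟩ := hfg
  have hD := measurable_thirds hm α β
  have hα := measurable_thirdMomentum m hm α
  have hβ := measurable_thirdMomentum m hm β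
  set c : ℕ → E × E → ℝ := fun n q =>
    {w | kin w ≤ n}.indicator ({w | r w ≤ n}.indicator fun _ => (1 : ℝ)) (thirds m α β q)
      * {p | A' p ≤ n}.indicator (fun _ => (1 : ℝ)) (thirdMomentum m β q) with hc
  have hcb : ∀ n, BddMeas (c n) := fun n =>
    (((bddMeas_indicator_le h.measurable_res (n : ℝ)).indicator
      (measurableSet_le h.measurable_kin measurable_const)).comp hD).mul
      ((bddMeas_indicator_le h.right.measurable (n : ℝ)).comp hβ)
  have hc1 : ∀ n q, |c n q| ≤ 1 := by
    intro n q
    simp only [hc, Set.indicator_apply]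
    split_ifs <;> simp
  have hcl : ∀ q, Filter.Tendsto (fun n => c n q) Filter.atTop (nhds 1) := by
    intro q
    refine tendsto_const_nhds.congr' ?_
    obtain ⟨N₁, h1⟩ := exists_nat_ge (kin (thirds m α β q))
    obtain ⟨N₂, h2⟩ := exists_nat_ge (r (thirds m α β q))
    obtain ⟨N₃, h3⟩ := exists_nat_ge (A' (thirdMomentum m β q))
    filter_upwards [Filter.eventually_ge_atTop N₁, Filter.eventually_ge_atTop N₂,
      Filter.eventually_ge_atTop N₃] with n g1 g2 g3
    simp only [hc]
    rw [Set.indicator_of_mem (show thirds m α β q ∈ {w | kin w ≤ n} from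
        h1.trans (Nat.cast_le.2 g1)), Set.indicator_of_mem (show thirds m α β q ∈ {w | r w ≤ n} from
        h2.trans (Nat.cast_le.2 g2)), Set.indicator_of_mem (show thirdMomentum m β q ∈
        {p | A' p ≤ n} from h3.trans (Nat.cast_le.2 g3)), one_mul]
  have hlim : Filter.Tendsto (fun n => mulL2 (c n) f₃) Filter.atTop (nhds f₃) :=
    tendsto_mulL2 hcb hc1 (Filter.Eventually.of_forall hcl) f₃
  refine eq_of_forall_mulL2_indicator_eq (F := fun q => A (thirdMomentum m α q))
    (h.left.measurable.comp hα) fun k => ?_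
  have hk1 := bddMeas_indicator_le (h.left.measurable.comp hα) (k : ℝ)
  simp only [Function.comp_apply] at hk1
  have hkt := (BddMeas.truncate h.left.measurable h.left.nonneg k).comp hα
  have hTf : Filter.Tendsto (fun n => mulL2 ({q | A (thirdMomentum m α q) ≤ k}.indicator
      fun _ => (1 : ℝ)) (approx hm u u' α β A A' kin r n f)) Filter.atTop
      (nhds (mulL2 ({q | A (thirdMomentum m α q) ≤ k}.indicator fun _ => (1 : ℝ)) (T f))) :=
    ((ContinuousLinearMap.continuous _).tendsto _).comp
      (((ContinuousLinearMap.apply ℂ L2Two f).continuous.tendsto T).comp hT)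
  refine tendsto_nhds_unique hTf ?_
  have e : mulL2 ({q | A (thirdMomentum m α q) ≤ k}.indicator fun _ => (1 : ℝ)) g
      = mulL2 (fun q => truncate k A (thirdMomentum m α q)) (boundedV hm u α f₃) := by
    refine mulL2_congr_apply hk1 hkt ?_
    filter_upwards [hg] with q hq
    rw [hq, truncate_eq_indicator_mul, Complex.ofReal_mul, mul_assoc]
    rfl
  rw [e]
  have hlim2 : Filter.Tendsto (fun n => mulL2 (fun q => truncate k A (thirdMomentum m α q))
      (boundedV hm u α (mulL2 (c n) f₃))) Filter.atTop
      (nhds (mulL2 (fun q => truncate k A (thirdMomentum m α q)) (boundedV hm u α f₃))) :=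
    ((ContinuousLinearMap.continuous _).tendsto _).comp
      (((boundedV hm u α).continuous.tendsto _).comp hlim)
  refine hlim2.congr' ?_
  filter_upwards [Filter.eventually_ge_atTop k] with n hn
  rw [h.approx_apply hm hu hu' h₁ h₃ n]
  have hnt := (BddMeas.truncate h.left.measurable h.left.nonneg n).comp hα
  rw [← mulL2_mul hk1 hnt]
  refine mulL2_congr_apply hkt (hk1.mul hnt) (Filter.Eventually.of_forall fun q => ?_)
  have := indicator_mul_truncate (F := A) hn (thirdMomentum m α q)
  rw [← this]
  rfl

/-- Inside the unit ball this is `lintegral_sq_mul_boundedV_le`; outside, `A` is bounded. -/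
theorem memLp_mul_boundedV (hA : IsMultiplier A) (hu' : IsWeight u') (hαβ : α ≠ β) (f : L2Two) :
    MemLp (fun q => (A (thirdMomentum m α q) : ℂ) * boundedV hm u' β f q) 2 volume := by
  have hα := measurable_thirdMomentum m hm α
  have hB : MeasurableSet {p : E | ‖p‖ < 1} := measurableSet_lt measurable_norm measurable_const
  set a := {p : E | ‖p‖ < 1}.indicator A with ha
  have ham : Measurable a := hA.measurable.indicator hB
  have h1 : MemLp (fun q => (a (thirdMomentum m α q) : ℂ) * boundedV hm u' β f q) 2 volume := by
    have hm1 : AEStronglyMeasurable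
        (fun q => (a (thirdMomentum m α q) : ℂ) * boundedV hm u' β f q) volume :=
      (Complex.measurable_ofReal.comp (ham.comp hα)).aestronglyMeasurable.mul
        (Lp.aestronglyMeasurable _)
    rw [memLp_two_iff _ hm1]
    have h2 := lintegral_sq_mul_boundedV_le hm hu' hαβ ham.enorm f
    refine lt_of_le_of_lt (le_of_eq_of_le ?_ h2) ?_
    · refine lintegral_congr fun q => ?_
      rw [enorm_mul, mul_pow, ← ofReal_norm, Complex.norm_real, ofReal_norm]
    · have := (memLp_two_iff _ hA.memLp.1).1 hA.memLp
      finiteness [this.ne]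
  have hb : BddMeas ({p : E | ‖p‖ < 1}ᶜ.indicator A) := by
    obtain ⟨C, hC⟩ := hA.exists_le
    refine ⟨hA.measurable.indicator hB.compl, max C 0, fun p => ?_⟩
    by_cases hp : ‖p‖ < 1
    · rw [Set.indicator_of_notMem (by simpa using hp), abs_zero]
      exact le_max_right _ _
    · rw [Set.indicator_of_mem (by simpa using hp), abs_of_nonneg (hA.nonneg p)]
      exact (hC p (not_lt.1 hp)).trans (le_max_left _ _)
  refine (h1.add ((hb.comp hα).memLp (boundedV hm u' β f))).ae_eq
    (Filter.Eventually.of_forall fun q => ?_)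
  have h3 := congrFun (Set.indicator_self_add_compl {p : E | ‖p‖ < 1} A) (thirdMomentum m α q)
  rw [Pi.add_apply, ← add_mul, ← Complex.ofReal_add]
  simp only [Pi.add_apply] at h3
  rw [h3]

/-- The cut-off `φ` tames `A'` and `r`. The remaining factor `A(p_α)` needs none, because `A(p_α)
|V_β|^{1/2} f` is already square integrable. It is applied before `|V_α|^{1/2}` and then commuted to
the outside. -/
theorem exists_sandwichRel (h : IsSandwich A A' kin r) (hu : IsWeight u) (hu' : IsWeight u')
    (hαβ : α ≠ β) {φ : E → ℝ} (hφ : BddMeas φ) (hφA : BddMeas fun p => A' p * φ p)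
    (hφr : BddMeas fun w : E × E => r w * (A' w.2 * φ w.2)) (f : L2Two) :
    ∃ g, SandwichRel hm u u' α β A A' r (mulL2 (fun q => φ (thirdMomentum m β q)) f) g := by
  have hD := measurable_thirds hm α β
  have hα := measurable_thirdMomentum m hm α
  have hβ := measurable_thirdMomentum m hm β
  have hr := hφr.comp hD
  set f₃ := mulL2 (fun q => r (thirds m α β q)
    * (A' (thirds m α β q).2 * φ (thirds m α β q).2)) (boundedV hm u' β f) with hf₃
  have h3 := coeFn_mulL2 hr (boundedV hm u' β f)
  have hy : MemLp (fun q => (A (thirdMomentum m α q) : ℂ) * f₃ q) 2 volume := by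
    have h4 := hr.memLp (memLp_mul_boundedV hm h.left hu' hαβ f).toLp
    refine h4.ae_eq ?_
    filter_upwards [h3, (memLp_mul_boundedV hm h.left hu' hαβ f).coeFn_toLp] with q h5 h6
    rw [h6, hf₃, h5]
    ring
  refine ⟨boundedV hm u α hy.toLp, mulL2 (fun q => A' (thirdMomentum m β q)
    * φ (thirdMomentum m β q)) f, f₃, ?_, ?_, ?_⟩
  · filter_upwards [coeFn_mulL2 (hφA.comp hβ) f, coeFn_mulL2 (hφ.comp hβ) f] with q h1 h2
    rw [h1, h2, Complex.ofReal_mul, mul_assoc]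
  · rw [boundedV_mulL2 hm hu' β hφA]
    filter_upwards [h3, coeFn_mulL2 (hφA.comp hβ) (boundedV hm u' β f)] with q h1 h2
    rw [hf₃, h1, h2, Complex.ofReal_mul, mul_assoc]
    rfl
  · exact coeFn_boundedV_of_mul hm hu α h.left.measurable h.left.nonneg hy.coeFn_toLp

end IsSandwich

end

section

/-! ### The graphs of the unbounded operators -/

theorem eventuallyEq_congr_right {X V : Type*} {l : Filter X} {f g h : X → V} (e : g =ᶠ[l] h) :
    f =ᶠ[l] g ↔ f =ᶠ[l] h :=
  ⟨fun h' => h'.trans e, fun h' => h'.trans e.symm⟩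

/-- On graphs, a product with natural domain is the composition of relations, which removes all
bookkeeping with domains. -/
theorem mem_graph_prodOp {H₁ H₂ H₃ : Type*} [AddCommGroup H₁] [Module ℂ H₁] [AddCommGroup H₂]
    [Module ℂ H₂] [AddCommGroup H₃] [Module ℂ H₃] (B : H₂ →ₗ.[ℂ] H₃) (A : H₁ →ₗ.[ℂ] H₂)
    (f : H₁) (g : H₃) :
    (f, g) ∈ (prodOp B A).graph ↔ ∃ h, (f, h) ∈ A.graph ∧ (h, g) ∈ B.graph := by
  simp only [LinearPMap.mem_graph_iff]
  constructor
  · rintro ⟨⟨y, hy⟩, rfl, rfl⟩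
    obtain ⟨h1, h2⟩ := (mem_prodOp_domain B A y).1 hy
    exact ⟨A ⟨y, h1⟩, ⟨⟨y, h1⟩, rfl, rfl⟩, ⟨⟨_, h2⟩, rfl, rfl⟩⟩
  · rintro ⟨h, ⟨⟨y, h1⟩, rfl, rfl⟩, ⟨⟨y', h2⟩, h3, rfl⟩⟩
    dsimp only at h3
    subst h3
    exact ⟨⟨y, (mem_prodOp_domain B A y).2 ⟨h1, h2⟩⟩, rfl, rfl⟩

theorem mem_graph_toPMap_top {H₁ H₂ : Type*} [AddCommGroup H₁] [Module ℂ H₁] [AddCommGroup H₂]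
    [Module ℂ H₂] (L : H₁ →ₗ[ℂ] H₂) (f : H₁) (g : H₂) :
    (f, g) ∈ (L.toPMap ⊤).graph ↔ g = L f := by
  simp only [LinearPMap.mem_graph_iff]
  constructor
  · rintro ⟨⟨y, hy⟩, rfl, rfl⟩
    rfl
  · rintro rfl
    exact ⟨⟨f, trivial⟩, rfl, rfl⟩

section MulOp

variable {X : Type*} [MeasurableSpace X] {μ : Measure X}

theorem mem_graph_mulOp (a : X → ℂ) (f g : Lp ℂ 2 μ) :
    (f, g) ∈ (mulOp a : Lp ℂ 2 μ →ₗ.[ℂ] Lp ℂ 2 μ).graph ↔ g =ᵐ[μ] fun x => a x * f x := by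
  simp only [LinearPMap.mem_graph_iff]
  constructor
  · rintro ⟨⟨y, hy⟩, rfl, rfl⟩
    exact MemLp.coeFn_toLp (show MemLp (fun x => a x * y x) 2 μ from hy)
  · intro h
    have hf : MemLp (fun x => a x * f x) 2 μ := (Lp.memLp g).ae_eq h
    refine ⟨⟨f, hf⟩, rfl, ?_⟩
    apply Lp.ext
    exact (MemLp.coeFn_toLp hf).trans h.symm

/-- A symbol without zeros gives a trivial kernel, which `LinearPMap.inverse_graph` requires; the
graph of the inverse is then the transposed graph. -/
theorem mem_graph_inverse_mulOp {a : X → ℂ} (ha : ∀ᵐ x ∂μ, a x ≠ 0) (f g : Lp ℂ 2 μ) :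
    (f, g) ∈ (mulOp a : Lp ℂ 2 μ →ₗ.[ℂ] Lp ℂ 2 μ).inverse.graph
      ↔ g =ᵐ[μ] fun x => (a x)⁻¹ * f x := by
  have hker : LinearMap.ker (mulOp a : Lp ℂ 2 μ →ₗ.[ℂ] Lp ℂ 2 μ).toFun = ⊥ := by
    rw [LinearMap.ker_eq_bot']
    rintro ⟨y, hy⟩ h0
    have h1 := (mem_graph_mulOp a y 0).1 ((LinearPMap.mem_graph_iff _).2 ⟨⟨y, hy⟩, rfl, h0⟩)
    apply Subtype.ext
    apply Lp.ext
    filter_upwards [h1, ha, Lp.coeFn_zero ℂ 2 μ] with x h2 h3 h4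
    rw [h4, Pi.zero_apply] at h2
    exact ((mul_eq_zero.1 h2.symm).resolve_left h3).trans (by rw [ZeroMemClass.coe_zero, h4]; rfl)
  rw [LinearPMap.inverse_graph hker]
  have h1 : (f, g) ∈ (mulOp a : Lp ℂ 2 μ →ₗ.[ℂ] Lp ℂ 2 μ).graph.map
      (LinearEquiv.prodComm ℂ (Lp ℂ 2 μ) (Lp ℂ 2 μ) : (Lp ℂ 2 μ × Lp ℂ 2 μ) →ₗ[ℂ] _)
      ↔ (g, f) ∈ (mulOp a : Lp ℂ 2 μ →ₗ.[ℂ] Lp ℂ 2 μ).graph := by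
    constructor
    · rintro ⟨⟨x, y⟩, h, e⟩
      obtain ⟨rfl, rfl⟩ := Prod.mk.inj e
      exact h
    · exact fun h => ⟨(g, f), h, rfl⟩
  rw [h1, mem_graph_mulOp]
  constructor
  · intro h
    filter_upwards [h, ha] with x h2 h3
    rw [h2, inv_mul_cancel_left₀ h3]
  · intro h
    filter_upwards [h, ha] with x h2 h3
    rw [h2, mul_inv_cancel_left₀ h3]

end MulOp

variable {m : Fin 3 → ℝ} (hm : ∀ i, 0 < m i) {α β : Fin 3} {u u' : E → ℝ}

theorem mem_graph_sqrtAbsV {v : Fin 3 → E → ℝ} (hu : IsWeight u)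
    (huv : (fun x => Real.sqrt |v α x|) =ᵐ[volume] u) (f g : L2Two) :
    (f, g) ∈ (sqrtAbsV m hm v α).graph ↔ g = boundedV hm u α f := by
  have h1 : ∀ᵐ w : E × E, Real.sqrt |v α w.2| = u w.2 :=
    Measure.quasiMeasurePreserving_snd.ae huv
  have h2 : ∀ y y' : L2Two, (y, y') ∈ (mulOp fun w : E × E => (Real.sqrt |v α w.2| : ℂ) :
      L2Two →ₗ.[ℂ] L2Two).graph ↔ y' = mulL2 (fun w : E × E => u w.2) y := by
    intro y y'
    have h3 := coeFn_mulL2 (hu.bddMeas.comp measurable_snd) y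
    rw [mem_graph_mulOp]
    constructor
    · intro h
      apply Lp.ext
      filter_upwards [h, h1, h3] with w e1 e2 e3
      rw [e1, e2, e3]
    · rintro rfl
      filter_upwards [h1, h3] with w e2 e3
      rw [e2, e3]
  unfold sqrtAbsV conjOp
  simp only [mem_graph_prodOp, mem_graph_toPMap_top, h2]
  constructor
  · rintro ⟨_, ⟨_, rfl, rfl⟩, rfl⟩
    rfl
  · rintro rfl
    exact ⟨_, ⟨_, rfl, rfl⟩, rfl⟩

/-- The graphs see only almost-everywhere values, so `ζ`, `v` and the resolvent may be replaced by
convenient measurable versions. -/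
theorem mem_graph_opM {v : Fin 3 → E → ℝ} (hu : IsWeight u) (hu' : IsWeight u')
    (huv : (fun x => Real.sqrt |v α x|) =ᵐ[volume] u)
    (huv' : (fun x => Real.sqrt |v β x|) =ᵐ[volume] u') {ζ : Fin 3 → ℝ → ℝ} {z : ℝ}
    {A A' : E → ℝ} {r : E × E → ℝ}
    (hA : ∀ᵐ p : E, ζ α (z - ‖p‖ ^ 2 / (2 * redMassThird m α)) ≠ 0 ∧
      A p = (ζ α (z - ‖p‖ ^ 2 / (2 * redMassThird m α)))⁻¹)
    (hA' : ∀ᵐ p : E, ζ β (z - ‖p‖ ^ 2 / (2 * redMassThird m β)) ≠ 0 ∧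
      A' p = (ζ β (z - ‖p‖ ^ 2 / (2 * redMassThird m β)))⁻¹)
    (hr : ∀ᵐ q : E × E, kinetic m q - z ≠ 0 ∧ r (thirds m α β q) = (kinetic m q - z)⁻¹)
    (f g : L2Two) :
    (f, g) ∈ (opM m hm v ζ α β z).graph ↔ SandwichRel hm u u' α β A A' r f g := by
  have hp : ∀ γ, Measure.QuasiMeasurePreserving (thirdMomentum m γ) volume volume := fun γ =>
    Measure.quasiMeasurePreserving_fst.comp
      (measurePreserving_jacobi m hm γ).quasiMeasurePreserving
  have hAq := (hp α).ae hA
  have hAq' := (hp β).ae hA'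
  have e1 : ∀ y y' : L2Two, (y, y') ∈ (opGamma m ζ α z).inverse.graph ↔
      y' =ᵐ[volume] fun q => (A (thirdMomentum m α q) : ℂ) * y q := by
    intro y y'
    refine (mem_graph_inverse_mulOp (hAq.mono fun q hq =>
      Complex.ofReal_ne_zero.2 hq.1) y y').trans (eventuallyEq_congr_right ?_)
    filter_upwards [hAq] with q hq
    rw [hq.2, Complex.ofReal_inv]
  have e2 : ∀ y y' : L2Two, (y, y') ∈ (opGamma m ζ β z).inverse.graph ↔
      y' =ᵐ[volume] fun q => (A' (thirdMomentum m β q) : ℂ) * y q := by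
    intro y y'
    refine (mem_graph_inverse_mulOp (hAq'.mono fun q hq =>
      Complex.ofReal_ne_zero.2 hq.1) y y').trans (eventuallyEq_congr_right ?_)
    filter_upwards [hAq'] with q hq
    rw [hq.2, Complex.ofReal_inv]
  have e3 : ∀ y y' : L2Two, (y, y') ∈ (freeResolvent m z).graph ↔
      y' =ᵐ[volume] fun q => (r (thirds m α β q) : ℂ) * y q := by
    intro y y'
    refine (mem_graph_inverse_mulOp (hr.mono fun q hq =>
      Complex.ofReal_ne_zero.2 hq.1) y y').trans (eventuallyEq_congr_right ?_)
    filter_upwards [hr] with q hq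
    rw [hq.2, Complex.ofReal_inv]
  unfold opM opK
  simp only [mem_graph_prodOp, e1, e2, e3, mem_graph_sqrtAbsV hm hu huv,
    mem_graph_sqrtAbsV hm hu' huv']
  constructor
  · rintro ⟨_, ⟨f₁, h1, _, ⟨_, rfl, h2⟩, rfl⟩, h3⟩
    exact ⟨f₁, _, h1, h2, h3⟩
  · rintro ⟨f₁, f₃, h1, h2, h3⟩
    exact ⟨_, ⟨f₁, h1, f₃, ⟨_, rfl, h2⟩, rfl⟩, h3⟩

end

section

/-! ### A logarithmically convergent integral -/

/-- Polar coordinates; the exponent `3` is the dimension minus one. -/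
theorem lintegral_fun_norm {f : ℝ → ENNReal} (hf : Measurable f) :
    ∫⁻ x : E, f ‖x‖ = (volume : Measure E).toSphere Set.univ
      * ∫⁻ y in Set.Ioi (0 : ℝ), ENNReal.ofReal (y ^ 3) * f y := by
  calc ∫⁻ x : E, f ‖x‖
      = ∫⁻ x : ({(0 : E)}ᶜ : Set E), f ‖x.1‖ ∂((volume : Measure E).comap Subtype.val) := by
        rw [lintegral_subtype_comap (measurableSet_singleton _).compl fun x => f ‖x‖,
          restrict_compl_singleton]
    _ = ∫⁻ x, f x.2 ∂(volume : Measure E).toSphere.prod (.volumeIoiPow 3) := by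
        have h := (volume : Measure E).measurePreserving_homeomorphUnitSphereProd.lintegral_comp_emb
          (Homeomorph.measurableEmbedding _) (f ∘ Subtype.val ∘ Prod.snd)
        have h3 : Module.finrank ℝ E - 1 = 3 := by simp
        rw [h3] at h
        simpa using h
    _ = (volume : Measure E).toSphere Set.univ
          * ∫⁻ x : Set.Ioi (0 : ℝ), f x ∂.volumeIoiPow 3 := by
        have h := lintegral_prod_mul (μ := (volume : Measure E).toSphere)
          (ν := Measure.volumeIoiPow 3) (f := fun _ => 1) (g := fun x => f x.1)
          aemeasurable_const (hf.comp measurable_subtype_coe).aemeasurable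
        simpa using h
    _ = _ := by
        have h := lintegral_withDensity_eq_lintegral_mul
          ((volume : Measure ℝ).comap (Subtype.val : Set.Ioi (0 : ℝ) → ℝ))
          (f := fun y => ENNReal.ofReal (y.1 ^ 3)) (by fun_prop)
          (g := fun y => f y.1) (hf.comp measurable_subtype_coe)
        rw [Measure.volumeIoiPow, h]
        congr 1
        exact lintegral_subtype_comap measurableSet_Ioi fun y => ENNReal.ofReal (y ^ 3) * f y

theorem lintegral_inv_norm_sq_le {R : ℝ} (hR : 0 ≤ R) :
    ∫⁻ p : E, (if ‖p‖ ≤ R then ENNReal.ofReal ((‖p‖ ^ 2)⁻¹) else 0)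
      ≤ (volume : Measure E).toSphere Set.univ * ENNReal.ofReal (R ^ 2) := by
  have hm : Measurable fun y : ℝ => if y ≤ R then ENNReal.ofReal ((y ^ 2)⁻¹) else 0 :=
    Measurable.ite measurableSet_Iic (by fun_prop) measurable_const
  rw [lintegral_fun_norm hm]
  gcongr
  calc ∫⁻ y in Set.Ioi (0 : ℝ), ENNReal.ofReal (y ^ 3)
        * (if y ≤ R then ENNReal.ofReal ((y ^ 2)⁻¹) else 0)
      ≤ ∫⁻ y in Set.Ioi (0 : ℝ), (Set.Iic R).indicator (fun _ => ENNReal.ofReal R) y := by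
        refine setLIntegral_mono' measurableSet_Ioi fun y hy => ?_
        have hy0 : 0 < y := hy
        by_cases h : y ≤ R
        · rw [if_pos h, Set.indicator_of_mem (by exact h), ← ENNReal.ofReal_mul (by positivity)]
          refine ENNReal.ofReal_le_ofReal (le_of_eq_of_le ?_ h)
          field_simp
        · rw [if_neg h, mul_zero]
          exact zero_le
    _ = ENNReal.ofReal (R ^ 2) := by
        rw [lintegral_indicator measurableSet_Iic, Measure.restrict_restrict measurableSet_Iic,
          setLIntegral_const, Set.inter_comm, Set.Ioi_inter_Iic, Real.volume_Ioc, sub_zero,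
          ← ENNReal.ofReal_mul hR, sq]

/-- The function `1 + ln ρ - ln y`. -/
def logWeight (ρ y : ℝ) : ℝ := 1 + Real.log ρ - Real.log y

theorem one_le_logWeight {ρ y : ℝ} (hy : 0 < y) (h : y ≤ ρ) : 1 ≤ logWeight ρ y := by
  have := Real.log_le_log hy h
  unfold logWeight
  linarith

theorem logWeight_anti {ρ y y' : ℝ} (hy : 0 < y) (h : y ≤ y') :
    logWeight ρ y' ≤ logWeight ρ y := by
  have := Real.log_le_log hy h
  unfold logWeight
  linarith

theorem measurable_logWeight (ρ : ℝ) : Measurable (logWeight ρ) :=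
  measurable_const.sub Real.measurable_log

/-- The integrand is the derivative of `1 / logWeight`, which has the limit `0` at the origin. -/
theorem integrableOn_inv_logWeight (ρ : ℝ) :
    IntegrableOn (fun y => (y * logWeight ρ y ^ 2)⁻¹) (Set.Ioc 0 ρ) := by
  have hpos : ∀ y ∈ Set.Ioc 0 ρ, 0 < logWeight ρ y := fun y hy =>
    one_pos.trans_le (one_le_logWeight hy.1 hy.2)
  -- Since `Real.log 0 = 0`, the primitive would have the wrong value at the origin; it is redefined
  -- there by its limit `0`.
  refine intervalIntegral.integrableOn_deriv_of_nonneg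
    (g := Function.update (fun y => (logWeight ρ y)⁻¹) 0 0) ?_ ?_ ?_
  · have hset : Set.Icc 0 ρ \ {0} = Set.Ioc 0 ρ := by
      ext y
      simp only [Set.mem_sdiff, Set.mem_Icc, Set.mem_singleton_iff, Set.mem_Ioc]
      exact ⟨fun h => ⟨lt_of_le_of_ne h.1.1 (Ne.symm h.2), h.1.2⟩,
        fun h => ⟨⟨h.1.le, h.2⟩, h.1.ne'⟩⟩
    rw [continuousOn_update_iff, hset]
    refine ⟨?_, fun _ => ?_⟩
    · refine ContinuousOn.inv₀ (continuousOn_const.sub (Real.continuousOn_log.mono ?_))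
        fun y hy => (hpos y hy).ne'
      exact fun y hy => hy.1.ne'
    · have h1 : Filter.Tendsto (logWeight ρ) (nhdsWithin 0 (Set.Ioi 0)) Filter.atTop := by
        unfold logWeight
        simp_rw [sub_eq_add_neg]
        exact Filter.tendsto_atTop_add_const_left _ _
          (Filter.tendsto_neg_atBot_atTop.comp Real.tendsto_log_nhdsGT_zero)
      exact (tendsto_inv_atTop_zero.comp h1).mono_left
        (nhdsWithin_mono _ fun y hy => hy.1)
  · intro y hy
    have hL := hpos y ⟨hy.1, hy.2.le⟩
    have h1 : HasDerivAt (logWeight ρ) (-y⁻¹) y := by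
      have := (Real.hasDerivAt_log hy.1.ne').const_sub (1 + Real.log ρ)
      exact this
    have h2 := h1.inv hL.ne'
    have h3 : (y * logWeight ρ y ^ 2)⁻¹ = - -y⁻¹ / logWeight ρ y ^ 2 := by
      rw [neg_neg, mul_inv, div_eq_mul_inv]
    rw [h3]
    refine h2.congr_of_eventuallyEq ?_
    filter_upwards [lt_mem_nhds hy.1] with x hx
    rw [Function.update_of_ne hx.ne']
    rfl
  · intro y hy
    have := hpos y ⟨hy.1, hy.2.le⟩
    have := hy.1
    positivity

/-- A majorant of `1 / (|p|² L(|p|) |q|² L(|q|) max(|p|, |q|)⁴)` in the region `|p| ≤ |q| ≤ ρ`. -/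
def logMajorant (ρ : ℝ) (w : E × E) : ENNReal :=
  if ‖w.1‖ ≤ ‖w.2‖ ∧ ‖w.2‖ ≤ ρ then
    ENNReal.ofReal ((‖w.1‖ ^ 2)⁻¹) * ENNReal.ofReal ((‖w.2‖ ^ 6 * logWeight ρ ‖w.2‖ ^ 2)⁻¹) else 0

theorem measurable_logMajorant (ρ : ℝ) : Measurable (logMajorant ρ) := by
  have hL := measurable_logWeight ρ
  refine Measurable.ite ?_ ?_ measurable_const
  · exact (measurableSet_le measurable_fst.norm measurable_snd.norm).inter
      (measurableSet_le measurable_snd.norm measurable_const)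
  · refine Measurable.mul (by fun_prop) (ENNReal.measurable_ofReal.comp ?_)
    exact (Measurable.mul (by fun_prop) ((hL.comp (by fun_prop)).pow_const 2)).inv

/-- The integral over `|p| ≤ |q|` of `|p|⁻²` gives a multiple of `|q|²`. The radial integrand in `y
= |q|` is then `y³ y² y⁻⁶ = 1/y` divided by the squared logarithm, which
`integrableOn_inv_logWeight` handles. -/
theorem lintegral_logMajorant_lt_top (ρ : ℝ) : ∫⁻ w, logMajorant ρ w < ⊤ := by
  set S := (volume : Measure E).toSphere Set.univ with hS
  have hSt : S < ⊤ := measure_lt_top _ _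
  set g : ℝ → ENNReal := fun y => if y ≤ ρ then
    ENNReal.ofReal (y ^ 2) * ENNReal.ofReal ((y ^ 6 * logWeight ρ y ^ 2)⁻¹) else 0 with hg
  have hgm : Measurable g := by
    have hL := measurable_logWeight ρ
    refine Measurable.ite measurableSet_Iic ?_ measurable_const
    exact Measurable.mul (by fun_prop) (ENNReal.measurable_ofReal.comp
      (Measurable.mul (by fun_prop) (hL.pow_const 2)).inv)
  have h1 : ∫⁻ w, logMajorant ρ w ≤ ∫⁻ q : E, S * g ‖q‖ := by
    refine (lintegral_prod_symm _ (measurable_logMajorant ρ).aemeasurable).trans_le ?_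
    refine lintegral_mono fun q => ?_
    by_cases hq : ‖q‖ ≤ ρ
    · have h2 : ∀ p : E, logMajorant ρ (p, q)
          = (if ‖p‖ ≤ ‖q‖ then ENNReal.ofReal ((‖p‖ ^ 2)⁻¹) else 0)
            * ENNReal.ofReal ((‖q‖ ^ 6 * logWeight ρ ‖q‖ ^ 2)⁻¹) := by
        intro p
        by_cases hp : ‖p‖ ≤ ‖q‖ <;> simp [logMajorant, hp, hq]
      simp_rw [h2]
      rw [lintegral_mul_const' _ _ ENNReal.ofReal_ne_top, hg]
      simp only [hq, if_true]
      rw [← mul_assoc]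
      gcongr
      exact lintegral_inv_norm_sq_le (norm_nonneg q)
    · have h2 : ∀ p : E, logMajorant ρ (p, q) = 0 := fun p => by simp [logMajorant, hq]
      simp_rw [h2]
      simp
  refine h1.trans_lt ?_
  rw [lintegral_const_mul' _ _ hSt.ne, lintegral_fun_norm hgm]
  refine ENNReal.mul_lt_top hSt (ENNReal.mul_lt_top hSt ?_)
  calc ∫⁻ y in Set.Ioi (0 : ℝ), ENNReal.ofReal (y ^ 3) * g y
      ≤ ∫⁻ y in Set.Ioi (0 : ℝ),
          (Set.Iic ρ).indicator (fun y => ‖(y * logWeight ρ y ^ 2)⁻¹‖ₑ) y := by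
        refine setLIntegral_mono' measurableSet_Ioi fun y hy => ?_
        have hy0 : 0 < y := hy
        by_cases h : y ≤ ρ
        · have hL := one_pos.trans_le (one_le_logWeight hy0 h)
          rw [Set.indicator_of_mem (by exact h), hg]
          simp only [h, if_true]
          rw [← ENNReal.ofReal_mul (by positivity), ← ENNReal.ofReal_mul (by positivity),
            ← ofReal_norm, Real.norm_of_nonneg (by positivity)]
          refine ENNReal.ofReal_le_ofReal (le_of_eq ?_)
          field_simp
        · simp [hg, h]
    _ = ∫⁻ y in Set.Ioc 0 ρ, ‖(y * logWeight ρ y ^ 2)⁻¹‖ₑ := by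
        rw [lintegral_indicator measurableSet_Iic, Measure.restrict_restrict measurableSet_Iic,
          Set.inter_comm, Set.Ioi_inter_Iic]
    _ < ⊤ := (integrableOn_inv_logWeight ρ).2

end

section

/-! ### The multipliers `Γ(z)⁻¹` -/

variable {τ μ : ℝ} {ζ : ℝ → ℝ}

/-- `ζ` equals `1` up to `-1` and is continuous and positive on the remaining compact interval;
enlarging `t₀` to at least `-1/2` keeps that interval nonempty. -/
theorem IsAuxFunction.exists_le (hζ : IsAuxFunction τ μ ζ) {t₀ : ℝ} (ht₀ : t₀ < 0) :
    ∃ c > 0, ∀ t ≤ t₀, c ≤ ζ t := by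
  set s := max t₀ (-1 / 2) with hs
  have hs0 : s < 0 := max_lt ht₀ (by norm_num)
  have hs1 : -1 ≤ s := le_trans (by norm_num) (le_max_right _ _)
  have hc : ContinuousOn ζ (Set.Icc (-1) s) :=
    hζ.smooth.continuousOn.mono fun t ht => lt_of_le_of_lt ht.2 hs0
  obtain ⟨x, hx, hmin⟩ := isCompact_Icc.exists_isMinOn ⟨s, hs1, le_rfl⟩ hc
  refine ⟨min (ζ x) 1, lt_min (hζ.pos x (lt_of_le_of_lt hx.2 hs0)) one_pos, fun t ht => ?_⟩
  by_cases h : t ≤ -1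
  · rw [hζ.eq_one t h]
    exact min_le_right _ _
  · exact (min_le_left _ _).trans (hmin ⟨(not_le.1 h).le, ht.trans (le_max_left _ _)⟩)

/-- The function `p ↦ ζ(z - p² / 2n)⁻¹` (where it makes sense). -/
def auxMultiplier (ζ : ℝ → ℝ) (n z : ℝ) (p : E) : ℝ :=
  ((Set.Iio 0).indicator ζ (z - ‖p‖ ^ 2 / (2 * n)))⁻¹

theorem auxMultiplier_eq {n z : ℝ} {p : E} (h : z - ‖p‖ ^ 2 / (2 * n) < 0) :
    auxMultiplier ζ n z p = (ζ (z - ‖p‖ ^ 2 / (2 * n)))⁻¹ := by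
  rw [auxMultiplier, Set.indicator_of_mem (by exact h)]

theorem sub_sq_neg {n z : ℝ} (hn : 0 < n) (hz : z ≤ 0) {p : E} (hp : p ≠ 0) :
    z - ‖p‖ ^ 2 / (2 * n) < 0 := by
  have : 0 < ‖p‖ ^ 2 / (2 * n) := by
    have := norm_pos_iff.2 hp
    positivity
  linarith

/-- Nothing is known about `ζ` on `[0, ∞)`; the indicator in `auxMultiplier` discards these values.
-/
theorem measurable_auxMultiplier (hζ : IsAuxFunction τ μ ζ) (n z : ℝ) :
    Measurable (auxMultiplier ζ n z) := by
  classical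
  have h1 : Measurable ((Set.Iio 0).indicator ζ) := by
    have h := ContinuousOn.measurable_piecewise (f := ζ) (g := fun _ => 0) (s := Set.Iio 0)
      hζ.smooth.continuousOn continuousOn_const measurableSet_Iio
    have e : (Set.Iio 0).indicator ζ = (Set.Iio 0).piecewise ζ fun _ => 0 :=
      Set.piecewise_eq_indicator.symm
    rw [e]
    exact h
  exact (h1.comp (by fun_prop : Measurable fun p : E => z - ‖p‖ ^ 2 / (2 * n))).inv

theorem auxMultiplier_nonneg (hζ : IsAuxFunction τ μ ζ) (n z : ℝ) (p : E) :
    0 ≤ auxMultiplier ζ n z p :=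
  inv_nonneg.2 (Set.indicator_nonneg (fun t ht => (hζ.pos t ht).le) _)

theorem exists_auxMultiplier_le (hζ : IsAuxFunction τ μ ζ) {n z t₀ : ℝ} (ht₀ : t₀ < 0) :
    ∃ C, 0 ≤ C ∧ ∀ p : E, z - ‖p‖ ^ 2 / (2 * n) ≤ t₀ → auxMultiplier ζ n z p ≤ C := by
  obtain ⟨c, hc, h⟩ := hζ.exists_le ht₀
  refine ⟨c⁻¹, (inv_pos.2 hc).le, fun p hp => ?_⟩
  rw [auxMultiplier_eq (hp.trans_lt ht₀)]
  exact inv_anti₀ hc (h _ hp)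

theorem sq_mul_logWeight_le {ρ y : ℝ} (hy : 0 < y) (h : y ≤ ρ) :
    y ^ 2 * logWeight ρ y ≤ ρ ^ 2 := by
  have hρ := hy.trans_le h
  have h1 : logWeight ρ y ≤ ρ / y := by
    have := Real.log_le_sub_one_of_pos (div_pos hρ hy)
    rw [Real.log_div hρ.ne' hy.ne'] at this
    unfold logWeight
    linarith
  calc y ^ 2 * logWeight ρ y ≤ y ^ 2 * (ρ / y) := by gcongr
    _ = y * ρ := by field_simp
    _ ≤ ρ * ρ := by gcongr
    _ = ρ ^ 2 := (sq ρ).symm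

/-- With `s = |p|²/2n` and `z = 0`, near the threshold `ζ(-s)² = s (τ - ln s)`, and `-ln s` contains
`-2 ln |p|`, which dominates `logWeight` for small `p`. Away from the threshold the multiplier is
bounded and `sq_mul_logWeight_le` suffices; for `z < 0` only this case occurs. -/
theorem exists_sq_auxMultiplier_le (hζ : IsAuxFunction τ μ ζ) {n z : ℝ} (hn : 0 < n) (hz : z ≤ 0)
    {ρ : ℝ} (hρ : 0 < ρ) : ∃ K, 0 ≤ K ∧ ∀ p : E, p ≠ 0 → ‖p‖ ≤ ρ →
      auxMultiplier ζ n z p ^ 2 ≤ K / (‖p‖ ^ 2 * logWeight ρ ‖p‖) := by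
  have far : ∀ t₀ < 0, ∃ K, 0 ≤ K ∧ ∀ p : E, p ≠ 0 → ‖p‖ ≤ ρ → z - ‖p‖ ^ 2 / (2 * n) ≤ t₀ →
      auxMultiplier ζ n z p ^ 2 ≤ K / (‖p‖ ^ 2 * logWeight ρ ‖p‖) := by
    intro t₀ ht₀
    obtain ⟨C, hC, h⟩ := exists_auxMultiplier_le hζ (n := n) (z := z) ht₀
    refine ⟨C ^ 2 * ρ ^ 2, by positivity, fun p hp hpρ hpt => ?_⟩
    have hp0 := norm_pos_iff.2 hp
    have hL := one_pos.trans_le (one_le_logWeight hp0 hpρ)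
    rw [le_div_iff₀ (by positivity)]
    exact mul_le_mul (pow_le_pow_left₀ (auxMultiplier_nonneg hζ n z p) (h p hpt) 2)
      (sq_mul_logWeight_le hp0 hpρ) (by positivity) (by positivity)
  rcases hz.lt_or_eq with hz | rfl
  · obtain ⟨K, hK, h⟩ := far z hz
    refine ⟨K, hK, fun p hp hpρ => h p hp hpρ ?_⟩
    have : 0 ≤ ‖p‖ ^ 2 / (2 * n) := by positivity
    linarith
  -- Below the first number `logWeight ρ ‖p‖ ≤ τ - ln s` holds; below the second, `-s` lies in `(μ,
  -- 0)`, where the formula for `ζ` is valid.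
  set r₀ := min (Real.exp (τ + Real.log (2 * n) - 1 - Real.log ρ)) (Real.sqrt (2 * n * -μ)) with hr₀
  have hμ := hζ.mu_mem.2
  have hr₀0 : 0 < r₀ := lt_min (Real.exp_pos _)
    (Real.sqrt_pos.2 (mul_pos (by positivity) (neg_pos.2 hμ)))
  obtain ⟨K, hK, h⟩ := far (-(r₀ ^ 2 / (2 * n))) (neg_lt_zero.2 (by positivity))
  refine ⟨max K (2 * n), hK.trans (le_max_left _ _), fun p hp hpρ => ?_⟩
  have hp0 := norm_pos_iff.2 hp
  have hL := one_pos.trans_le (one_le_logWeight hp0 hpρ)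
  by_cases hpr : r₀ ≤ ‖p‖
  · refine (h p hp hpρ ?_).trans (by gcongr; exact le_max_left _ _)
    rw [zero_sub, neg_le_neg_iff]
    gcongr
  · have hpr := not_le.1 hpr
    refine le_trans ?_ (div_le_div_of_nonneg_right (le_max_right K (2 * n)) (by positivity))
    have h1 : Real.log ‖p‖ ≤ τ + Real.log (2 * n) - 1 - Real.log ρ := by
      rw [Real.log_le_iff_le_exp hp0]
      exact (hpr.trans_le (min_le_left _ _)).le
    have h2 : ‖p‖ ^ 2 < 2 * n * -μ := by
      rw [← Real.lt_sqrt hp0.le]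
      exact hpr.trans_le (min_le_right _ _)
    set s := ‖p‖ ^ 2 / (2 * n) with hs
    have hs0 : 0 < s := by positivity
    have hsμ : μ < -s := by
      rw [lt_neg, hs, div_lt_iff₀ (by positivity)]
      linarith
    have hlog : Real.log s = 2 * Real.log ‖p‖ - Real.log (2 * n) := by
      rw [hs, Real.log_div (by positivity) (by positivity), Real.log_pow]
      norm_num
    have hneg : Real.log s - τ < 0 := by
      have := hζ.log_sub_neg (-s) ⟨hsμ.le, by linarith⟩
      rwa [abs_neg, abs_of_pos hs0] at this
    rw [auxMultiplier_eq (sub_sq_neg hn le_rfl hp), zero_sub, ← hs,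
      hζ.eq_near_zero (-s) ⟨hsμ, by linarith⟩, abs_neg, abs_of_pos hs0, inv_pow,
      Real.sq_sqrt (mul_nonneg_of_nonpos_of_nonpos (by linarith) hneg.le)]
    have h3 : logWeight ρ ‖p‖ ≤ τ - Real.log s := by
      rw [hlog]
      unfold logWeight
      linarith
    rw [inv_le_comm₀ (mul_pos_of_neg_of_neg (by linarith) hneg) (by positivity), inv_div]
    calc ‖p‖ ^ 2 * logWeight ρ ‖p‖ / (2 * n) = s * logWeight ρ ‖p‖ := by
          rw [hs]
          ring
      _ ≤ s * (τ - Real.log s) := by gcongr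
      _ = -s * (Real.log s - τ) := by ring

/-- For a single factor the logarithm is not needed: `|p|⁻²` is integrable near `0` in dimension
four. For `|p| ≥ 1` the argument of `ζ` is at most `-1/(2n)`. -/
theorem isMultiplier_auxMultiplier (hζ : IsAuxFunction τ μ ζ) {n z : ℝ} (hn : 0 < n)
    (hz : z ≤ 0) : IsMultiplier (auxMultiplier ζ n z) := by
  have hm := measurable_auxMultiplier hζ n z
  have hB : MeasurableSet {p : E | ‖p‖ < 1} := measurableSet_lt measurable_norm measurable_const
  refine ⟨hm, auxMultiplier_nonneg hζ n z, ?_, ?_⟩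
  · obtain ⟨C, -, hC⟩ := exists_auxMultiplier_le hζ (n := n) (z := z) (t₀ := -(1 / (2 * n)))
      (neg_lt_zero.2 (by positivity))
    refine ⟨C, fun p hp => hC p ?_⟩
    have : 1 / (2 * n) ≤ ‖p‖ ^ 2 / (2 * n) := by
      gcongr
      exact one_le_pow₀ hp
    linarith
  · obtain ⟨K, hK, h⟩ := exists_sq_auxMultiplier_le hζ hn hz one_pos
    rw [memLp_two_iff _ (hm.indicator hB).aestronglyMeasurable]
    refine lt_of_le_of_lt (b := ENNReal.ofReal K
      * ∫⁻ p : E, (if ‖p‖ ≤ 1 then ENNReal.ofReal ((‖p‖ ^ 2)⁻¹) else 0)) ?_ ?_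
    · rw [← lintegral_const_mul' _ _ ENNReal.ofReal_ne_top]
      apply lintegral_mono_ae
      filter_upwards [Measure.ae_ne volume (0 : E)] with p hp
      by_cases hp1 : ‖p‖ < 1
      · have hp0 := norm_pos_iff.2 hp
        rw [Set.indicator_of_mem (by exact hp1), if_pos hp1.le, ← ENNReal.ofReal_mul hK,
          ← ofReal_norm, ← ENNReal.ofReal_pow (norm_nonneg _), Real.norm_eq_abs, sq_abs]
        refine ENNReal.ofReal_le_ofReal ((h p hp hp1.le).trans ?_)
        rw [div_eq_mul_inv]
        gcongr
        exact le_mul_of_one_le_right (by positivity) (one_le_logWeight hp0 hp1.le)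
      · rw [Set.indicator_of_notMem (by exact hp1)]
        simp
    · refine ENNReal.mul_lt_top ENNReal.ofReal_lt_top
        ((lintegral_inv_norm_sq_le zero_le_one).trans_lt ?_)
      exact ENNReal.mul_lt_top (measure_lt_top _ _) ENNReal.ofReal_lt_top

/-! ### The resolvent as a function of the third momenta -/

/-- The kinetic energy as a function of `(p_α, p_β)`, where `k_α = a p_α + b p_β`. -/
def kineticThirds (m : Fin 3 → ℝ) (α : Fin 3) (a b : ℝ) (w : E × E) : ℝ :=
  ‖a • w.1 + b • w.2‖ ^ 2 / (2 * redMass m α) + ‖w.1‖ ^ 2 / (2 * redMassThird m α)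

theorem surjective_thirds {m : Fin 3 → ℝ} (hm : ∀ i, 0 < m i) {α β : Fin 3} (h : α ≠ β) :
    Function.Surjective (thirds m α β) := by
  rintro ⟨p, q⟩
  simp only [thirds, thirdMomentum_eq_vec m hm]
  fin_cases α <;> fin_cases β <;> first | exact absurd rfl h | skip
  · exact ⟨(-q, p + q), by simp⟩
  · exact ⟨(p + q, -q), by simp⟩
  · exact ⟨(-p, p + q), by simp⟩
  · exact ⟨(-p, -q), by simp⟩
  · exact ⟨(p + q, -p), by simp⟩
  · exact ⟨(-q, -p), by simp⟩

variable {m : Fin 3 → ℝ} {α β : Fin 3} {a b : ℝ}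

theorem kineticThirds_thirds (hm : ∀ i, 0 < m i)
    (hab : ∀ q, pairMomentum m α q = a • thirdMomentum m α q + b • thirdMomentum m β q)
    (q : E × E) : kineticThirds m α a b (thirds m α β q) = kinetic m q := by
  rw [kinetic_eq m hm α, hab]
  rfl

theorem sq_fst_le_kineticThirds (hm : ∀ i, 0 < m i) (w : E × E) :
    ‖w.1‖ ^ 2 / (2 * redMassThird m α) ≤ kineticThirds m α a b w := by
  have := redMass_pos m hm α
  exact le_add_of_nonneg_left (by positivity)

/-- The formula for `kineticThirds` favours `α`; passing to a point of momentum space above `w`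
restores the symmetry between the pairs. -/
theorem sq_snd_le_kineticThirds (hm : ∀ i, 0 < m i) (h : α ≠ β)
    (hab : ∀ q, pairMomentum m α q = a • thirdMomentum m α q + b • thirdMomentum m β q)
    (w : E × E) : ‖w.2‖ ^ 2 / (2 * redMassThird m β) ≤ kineticThirds m α a b w := by
  obtain ⟨q, rfl⟩ := surjective_thirds hm h w
  rw [kineticThirds_thirds hm hab]
  exact thirdMomentum_sq_le_kinetic m hm β q

theorem kineticThirds_nonneg (hm : ∀ i, 0 < m i) (w : E × E) : 0 ≤ kineticThirds m α a b w := by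
  have := redMass_pos m hm α
  have := redMassThird_pos m hm α
  unfold kineticThirds
  positivity

theorem measurable_kineticThirds (m : Fin 3 → ℝ) (α : Fin 3) (a b : ℝ) :
    Measurable (kineticThirds m α a b) := by
  unfold kineticThirds
  fun_prop

/-- Here `t` plays the larger of the two momenta. Lowering the logarithm `Ls` to `Lt` puts both
logarithms on `t` and leaves a pure power of `s`. -/
theorem sq_mul_le_logMajorant {K K' N s t Ls Lt x x' r : ℝ} (hs : 0 < s) (ht : 0 < t)
    (hLt : 1 ≤ Lt) (hL : Lt ≤ Ls) (hK : 0 ≤ K) (hK' : 0 ≤ K')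
    (hx : x ^ 2 ≤ K / (s ^ 2 * Ls)) (hx' : x' ^ 2 ≤ K' / (t ^ 2 * Lt)) (hr0 : 0 ≤ r)
    (hr : r ≤ N / t ^ 2) :
    (x * x' * r) ^ 2 ≤ K * K' * N ^ 2 * ((s ^ 2)⁻¹ * (t ^ 6 * Lt ^ 2)⁻¹) := by
  have hLt0 : 0 < Lt := one_pos.trans_le hLt
  have h1 : x ^ 2 ≤ K / (s ^ 2 * Lt) := hx.trans (by gcongr)
  calc (x * x' * r) ^ 2 = x ^ 2 * x' ^ 2 * r ^ 2 := by ring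
    _ ≤ K / (s ^ 2 * Lt) * (K' / (t ^ 2 * Lt)) * (N / t ^ 2) ^ 2 := by gcongr
    _ = _ := by
      field_simp

theorem isSandwich_auxMultiplier (hm : ∀ i, 0 < m i) (h : α ≠ β)
    (hab : ∀ q, pairMomentum m α q = a • thirdMomentum m α q + b • thirdMomentum m β q)
    {τ' μ' : ℝ} {ζ' : ℝ → ℝ} (hζ : IsAuxFunction τ μ ζ) (hζ' : IsAuxFunction τ' μ' ζ')
    {z : ℝ} (hz : z ≤ 0) :
    IsSandwich (auxMultiplier ζ (redMassThird m α) z) (auxMultiplier ζ' (redMassThird m β) z)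
      (kineticThirds m α a b) (fun w => (kineticThirds m α a b w - z)⁻¹) := by
  have hα := redMassThird_pos m hm α
  have hβ := redMassThird_pos m hm β
  have hk := measurable_kineticThirds m α a b
  have hr0 : ∀ w, 0 ≤ (kineticThirds m α a b w - z)⁻¹ := fun w => by
    have := kineticThirds_nonneg (α := α) (a := a) (b := b) hm w
    exact inv_nonneg.2 (by linarith)
  refine ⟨isMultiplier_auxMultiplier hζ hα hz, isMultiplier_auxMultiplier hζ' hβ hz, hk,
    (hk.sub_const z).inv, hr0, fun R hR w hw => inv_anti₀ hR (by linarith), ?_, fun R => ?_⟩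
  · have h1 := redMass_pos m hm α
    refine ⟨(|a| + |b|) ^ 2 / (2 * redMass m α) + 1 ^ 2 / (2 * redMassThird m α),
      fun w hw1 hw2 => ?_⟩
    unfold kineticThirds
    gcongr
    refine (norm_add_le _ _).trans ?_
    rw [norm_smul, norm_smul, Real.norm_eq_abs, Real.norm_eq_abs]
    exact add_le_add (mul_le_of_le_one_right (abs_nonneg _) hw1.le)
      (mul_le_of_le_one_right (abs_nonneg _) hw2.le)
  -- As `ρ ≥ 1`, one has `ρ² ≥ ρ ≥ 2n|R|` for both reduced masses `n`, so energy at most `R`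
  -- confines both momenta to the ball of radius `ρ`.
  · set ρ := 1 + 2 * redMassThird m α * |R| + 2 * redMassThird m β * |R| with hρ
    have hρ1 : 1 ≤ ρ := by
      rw [hρ, add_assoc]
      exact le_add_of_nonneg_right (by positivity)
    obtain ⟨K, hK, hKb⟩ := exists_sq_auxMultiplier_le hζ hα hz (one_pos.trans_le hρ1)
    obtain ⟨K', hK', hKb'⟩ := exists_sq_auxMultiplier_le hζ' hβ hz (one_pos.trans_le hρ1)
    set N := 2 * redMassThird m α + 2 * redMassThird m β with hN
    have hmeas : Measurable ({w | kineticThirds m α a b w ≤ R}.indicator fun w =>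
        auxMultiplier ζ (redMassThird m α) z w.1 * auxMultiplier ζ' (redMassThird m β) z w.2
          * (kineticThirds m α a b w - z)⁻¹) :=
      ((((measurable_auxMultiplier hζ _ z).comp measurable_fst).mul
        ((measurable_auxMultiplier hζ' _ z).comp measurable_snd)).mul
        (hk.sub_const z).inv).indicator (measurableSet_le hk measurable_const)
    rw [memLp_two_iff _ hmeas.aestronglyMeasurable]
    have hfin := lintegral_logMajorant_lt_top ρ
    have hswap : ∫⁻ w : E × E, logMajorant ρ w.swap = ∫⁻ w, logMajorant ρ w :=
      (Measure.measurePreserving_swap (μ := (volume : Measure E))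
        (ν := (volume : Measure E))).lintegral_comp (measurable_logMajorant ρ)
    refine lt_of_le_of_lt (b := ENNReal.ofReal (K * K' * N ^ 2)
      * ∫⁻ w : E × E, (logMajorant ρ w + logMajorant ρ w.swap)) ?_ ?_
    swap
    · rw [lintegral_add_left (measurable_logMajorant ρ), hswap]
      exact ENNReal.mul_lt_top ENNReal.ofReal_lt_top (ENNReal.add_lt_top.2 ⟨hfin, hfin⟩)
    rw [← lintegral_const_mul' _ _ ENNReal.ofReal_ne_top]
    apply lintegral_mono_ae
    have hne := Measure.ae_ne (volume : Measure E) (0 : E)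
    have hne1 : ∀ᵐ w : E × E, w.1 ≠ 0 := Measure.quasiMeasurePreserving_fst.ae hne
    have hne2 : ∀ᵐ w : E × E, w.2 ≠ 0 := Measure.quasiMeasurePreserving_snd.ae hne
    filter_upwards [hne1, hne2] with w h1 h2
    by_cases hw : kineticThirds m α a b w ≤ R
    swap
    · rw [Set.indicator_of_notMem (by exact hw)]
      simp
    rw [Set.indicator_of_mem (by exact hw), ← ofReal_norm, ← ENNReal.ofReal_pow (norm_nonneg _),
      Real.norm_eq_abs, sq_abs]
    have hs := norm_pos_iff.2 h1
    have ht := norm_pos_iff.2 h2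
    have e1 := sq_fst_le_kineticThirds (α := α) (a := a) (b := b) hm w
    have e2 := sq_snd_le_kineticThirds hm h hab w
    have le_rho : ∀ {n x : ℝ}, 0 < n → 2 * n * |R| ≤ ρ → x ^ 2 / (2 * n)
        ≤ kineticThirds m α a b w → x ≤ ρ := by
      intro n x hn hnρ hx
      have g1 := hx.trans (hw.trans (le_abs_self R))
      rw [div_le_iff₀ (by positivity)] at g1
      have g2 : x ^ 2 ≤ ρ ^ 2 := by nlinarith
      exact (abs_le_of_sq_le_sq' g2 (by linarith)).2
    have hs1 : ‖w.1‖ ≤ ρ := le_rho hα (by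
      have : 0 ≤ 2 * redMassThird m β * |R| := by positivity
      linarith) e1
    have ht1 : ‖w.2‖ ≤ ρ := le_rho hβ (by
      have : 0 ≤ 2 * redMassThird m α * |R| := by positivity
      linarith) e2
    have res_le : ∀ {n x : ℝ}, 0 < n → n ≤ redMassThird m α + redMassThird m β → 0 < x →
        x ^ 2 / (2 * n) ≤ kineticThirds m α a b w →
        (kineticThirds m α a b w - z)⁻¹ ≤ N / x ^ 2 := by
      intro n x hn hnN hx hxk
      have g1 : x ^ 2 / N ≤ kineticThirds m α a b w - z := by
        have g2 : x ^ 2 / N ≤ x ^ 2 / (2 * n) := by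
          gcongr
          linarith
        linarith
      rw [← inv_div]
      exact inv_anti₀ (by positivity) g1
    have hsL := one_le_logWeight hs hs1
    have htL := one_le_logWeight ht ht1
    have b1 := hKb w.1 h1 hs1
    have b2 := hKb' w.2 h2 ht1
    -- The resolvent is estimated by the larger momentum; each ordering uses one of the two summands
    -- of the majorant.
    rcases le_total ‖w.1‖ ‖w.2‖ with hst | hst
    · refine le_trans ?_ (mul_le_mul_right (le_self_add) _)
      rw [logMajorant, if_pos ⟨hst, ht1⟩, ← ENNReal.ofReal_mul (by positivity),
        ← ENNReal.ofReal_mul (by positivity)]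
      exact ENNReal.ofReal_le_ofReal (sq_mul_le_logMajorant hs ht htL (logWeight_anti hs hst) hK hK'
        b1 b2 (hr0 w) (res_le hβ (by linarith) ht e2))
    · refine le_trans ?_ (mul_le_mul_right (le_add_self) _)
      rw [logMajorant, if_pos ⟨hst, hs1⟩, ← ENNReal.ofReal_mul (by positivity),
        ← ENNReal.ofReal_mul (by positivity), mul_comm (auxMultiplier ζ _ z w.1), mul_comm K]
      exact ENNReal.ofReal_le_ofReal (sq_mul_le_logMajorant ht hs hsL (logWeight_anti ht hst) hK' hK
        b2 b1 (hr0 w) (res_le hα (by linarith) hs e1))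

end

section

/-! ### Compactness of `M_{αβ}(z)` -/

/-- Square integrability is integrability of `(1 + |x|)^{-b}` for `b` above the dimension. The
minimum with `√|C|` turns an almost-everywhere bound into one that holds everywhere. -/
theorem exists_isWeight {v : E → ℝ} (hv : AEMeasurable v volume) {C b : ℝ} (hb : 4 < b)
    (hdecay : ∀ᵐ x, |v x| ≤ C * (1 + ‖x‖) ^ (-b)) :
    ∃ u, IsWeight u ∧ (fun x => Real.sqrt |v x|) =ᵐ[volume] u := by
  have hbd : ∀ᵐ x, |v x| ≤ |C| := by
    filter_upwards [hdecay] with x hx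
    have h1 : (1 + ‖x‖) ^ (-b) ≤ 1 :=
      Real.rpow_le_one_of_one_le_of_nonpos (le_add_of_nonneg_right (norm_nonneg x)) (by linarith)
    have h0 : 0 ≤ (1 + ‖x‖) ^ (-b) := by positivity
    calc |v x| ≤ C * (1 + ‖x‖) ^ (-b) := hx
      _ ≤ |C| * (1 + ‖x‖) ^ (-b) := by
        gcongr
        exact le_abs_self C
      _ ≤ |C| := mul_le_of_le_one_right (abs_nonneg C) h1
  set u : E → ℝ := fun x => min (Real.sqrt |hv.mk v x|) (Real.sqrt |C|) with hu
  have hum : Measurable u := hv.measurable_mk.abs.sqrt.min measurable_const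
  have huv : (fun x => Real.sqrt |v x|) =ᵐ[volume] u := by
    filter_upwards [hv.ae_eq_mk, hbd] with x h1 h2
    rw [hu]
    dsimp only
    rw [← h1, min_eq_left (Real.sqrt_le_sqrt h2)]
  refine ⟨u, ⟨⟨hum, Real.sqrt |C|, fun x => ?_⟩, ?_⟩, huv⟩
  · rw [abs_of_nonneg (le_min (Real.sqrt_nonneg _) (Real.sqrt_nonneg _))]
    exact min_le_right _ _
  · rw [memLp_two_iff_integrable_sq hum.aestronglyMeasurable]
    have hint : Integrable (fun x : E => C * (1 + ‖x‖) ^ (-b)) volume :=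
      (integrable_one_add_norm (by simpa using hb)).const_mul C
    refine hint.mono' (hum.pow_const 2).aestronglyMeasurable ?_
    filter_upwards [huv, hdecay] with x h1 h2
    rw [← h1, Real.sq_sqrt (abs_nonneg _), Real.norm_of_nonneg (abs_nonneg _)]
    exact h2

theorem ae_thirdMomentum {m : Fin 3 → ℝ} (hm : ∀ i, 0 < m i) (γ : Fin 3) {P : E → Prop}
    (h : ∀ᵐ p, P p) : ∀ᵐ q, P (thirdMomentum m γ q) :=
  (Measure.quasiMeasurePreserving_fst.comp
    (measurePreserving_jacobi m hm γ).quasiMeasurePreserving).ae h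

section Domain

variable {m : Fin 3 → ℝ} (hm : ∀ i, 0 < m i) {α β : Fin 3} {v : Fin 3 → E → ℝ} {u u' : E → ℝ}
  {τ μ : Fin 3 → ℝ} {ζ : Fin 3 → ℝ → ℝ} {z a b : ℝ}

theorem mem_graph_opM_auxMultiplier (hu : IsWeight u) (hu' : IsWeight u')
    (huv : (fun x => Real.sqrt |v α x|) =ᵐ[volume] u)
    (huv' : (fun x => Real.sqrt |v β x|) =ᵐ[volume] u')
    (hζ : ∀ γ, IsAuxFunction (τ γ) (μ γ) (ζ γ)) (hz : z ≤ 0)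
    (hab : ∀ q, pairMomentum m α q = a • thirdMomentum m α q + b • thirdMomentum m β q)
    (f g : L2Two) : (f, g) ∈ (opM m hm v ζ α β z).graph ↔
      SandwichRel hm u u' α β (auxMultiplier (ζ α) (redMassThird m α) z)
        (auxMultiplier (ζ β) (redMassThird m β) z) (fun w => (kineticThirds m α a b w - z)⁻¹) f g := by
  have hne := Measure.ae_ne (volume : Measure E) (0 : E)
  have hA : ∀ γ, ∀ᵐ p : E, ζ γ (z - ‖p‖ ^ 2 / (2 * redMassThird m γ)) ≠ 0 ∧
      auxMultiplier (ζ γ) (redMassThird m γ) z p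
        = (ζ γ (z - ‖p‖ ^ 2 / (2 * redMassThird m γ)))⁻¹ := fun γ => by
    filter_upwards [hne] with p hp
    have h := sub_sq_neg (redMassThird_pos m hm γ) hz hp
    exact ⟨((hζ γ).pos _ h).ne', auxMultiplier_eq h⟩
  refine mem_graph_opM hm hu hu' huv huv' (hA α) (hA β) ?_ f g
  filter_upwards [ae_thirdMomentum hm α hne] with q hq
  refine ⟨?_, by rw [kineticThirds_thirds hm hab]⟩
  have h1 := thirdMomentum_sq_le_kinetic m hm α q
  have h2 := sub_sq_neg (redMassThird_pos m hm α) hz hq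
  linarith

/-- On `s` the multiplier `A'` is bounded, and so is the resolvent, by `(-t₀)⁻¹`, since the kinetic
energy is at least `p_β²/2n_β`. -/
theorem mulL2_mem_domain_opM (hαβ : α ≠ β) (hu : IsWeight u) (hu' : IsWeight u')
    (huv : (fun x => Real.sqrt |v α x|) =ᵐ[volume] u)
    (huv' : (fun x => Real.sqrt |v β x|) =ᵐ[volume] u')
    (hζ : ∀ γ, IsAuxFunction (τ γ) (μ γ) (ζ γ)) (hz : z ≤ 0)
    {s : Set E} (hs : MeasurableSet s) {t₀ : ℝ} (ht₀ : t₀ < 0)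
    (hst : ∀ p ∈ s, z - ‖p‖ ^ 2 / (2 * redMassThird m β) ≤ t₀) (f : L2Two) :
    mulL2 (fun q => s.indicator (fun _ => (1 : ℝ)) (thirdMomentum m β q)) f
      ∈ (opM m hm v ζ α β z).domain := by
  obtain ⟨a, b, hab⟩ := exists_pairMomentum_eq m hm hαβ
  have h := isSandwich_auxMultiplier hm hαβ hab (hζ α) (hζ β) hz
  obtain ⟨C, hC, hCb⟩ := exists_auxMultiplier_le (hζ β) (n := redMassThird m β) (z := z) ht₀
  have hA' := auxMultiplier_nonneg (hζ β) (redMassThird m β) z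
  have hφ : BddMeas (s.indicator fun _ => (1 : ℝ)) := BddMeas.indicator_one hs
  have hle : ∀ p, auxMultiplier (ζ β) (redMassThird m β) z p * s.indicator (fun _ => (1 : ℝ)) p
      ≤ C := fun p => by
    by_cases hp : p ∈ s
    · simpa [hp] using hCb p (hst p hp)
    · simpa [hp] using hC
  have h0 : ∀ p, 0 ≤ auxMultiplier (ζ β) (redMassThird m β) z p
      * s.indicator (fun _ => (1 : ℝ)) p := fun p =>
    mul_nonneg (hA' p) (Set.indicator_nonneg (fun _ _ => zero_le_one) p)
  have hφA : BddMeas fun p => auxMultiplier (ζ β) (redMassThird m β) z p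
      * s.indicator (fun _ => (1 : ℝ)) p :=
    ⟨h.right.measurable.mul hφ.1, C, fun p => by
      rw [abs_of_nonneg (h0 p)]
      exact hle p⟩
  have hφr : BddMeas fun w : E × E => (kineticThirds m α a b w - z)⁻¹
      * (auxMultiplier (ζ β) (redMassThird m β) z w.2 * s.indicator (fun _ => (1 : ℝ)) w.2) := by
    refine ⟨h.measurable_res.mul (hφA.1.comp measurable_snd), (-t₀)⁻¹ * C, fun w => ?_⟩
    rw [abs_of_nonneg (mul_nonneg (h.res_nonneg w) (h0 _))]
    by_cases hw : w.2 ∈ s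
    · refine mul_le_mul (inv_anti₀ (neg_pos.2 ht₀) ?_) (hle _) (h0 _)
        (inv_nonneg.2 (neg_pos.2 ht₀).le)
      have := sq_snd_le_kineticThirds hm hαβ hab w
      have := hst _ hw
      linarith
    · rw [Set.indicator_of_notMem hw, mul_zero, mul_zero]
      exact mul_nonneg (inv_nonneg.2 (neg_pos.2 ht₀).le) hC
  obtain ⟨g, hg⟩ := h.exists_sandwichRel hm hu hu' hαβ hφ hφA hφr f
  exact LinearPMap.mem_domain_of_mem_graph
    ((mem_graph_opM_auxMultiplier hm hu hu' huv huv' hζ hz hab _ _).2 hg)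

/-- The sets where the argument of `ζ_β` is at most `-1/(n+1)` exhaust `p_β ≠ 0`, so cutting `f` off
to them approximates `f` within the domain. -/
theorem dense_domain_opM (hαβ : α ≠ β) (hu : IsWeight u) (hu' : IsWeight u')
    (huv : (fun x => Real.sqrt |v α x|) =ᵐ[volume] u)
    (huv' : (fun x => Real.sqrt |v β x|) =ᵐ[volume] u')
    (hζ : ∀ γ, IsAuxFunction (τ γ) (μ γ) (ζ γ)) (hz : z ≤ 0) :
    Dense ((opM m hm v ζ α β z).domain : Set L2Two) := by
  intro f
  set s : ℕ → Set E := fun n => {p | z - ‖p‖ ^ 2 / (2 * redMassThird m β) ≤ -(1 / ((n : ℝ) + 1))}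
    with hs
  have hsm : ∀ n, MeasurableSet (s n) := fun n =>
    measurableSet_le (by fun_prop) measurable_const
  refine mem_closure_of_tendsto (tendsto_mulL2 (c := fun n q =>
    (s n).indicator (fun _ => (1 : ℝ)) (thirdMomentum m β q)) (fun n =>
      (BddMeas.indicator_one (hsm n)).comp (measurable_thirdMomentum m hm β)) (fun n q => ?_)
      ?_ f) (Filter.Eventually.of_forall fun n =>
      mulL2_mem_domain_opM hm hαβ hu hu' huv huv' hζ hz (hsm n)
        (neg_lt_zero.2 Nat.one_div_pos_of_nat) (fun p hp => hp) f)
  · by_cases hq : thirdMomentum m β q ∈ s n <;> simp [hq]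
  · filter_upwards [ae_thirdMomentum hm β (Measure.ae_ne (volume : Measure E) (0 : E))] with q hq
    have h1 := sub_sq_neg (redMassThird_pos m hm β) hz hq
    have h2 : Filter.Tendsto (fun n : ℕ => -(1 / ((n : ℝ) + 1))) Filter.atTop (nhds 0) := by
      simpa using (tendsto_one_div_add_atTop_nhds_zero_nat (𝕜 := ℝ)).neg
    refine tendsto_const_nhds.congr' ?_
    filter_upwards [h2.eventually (lt_mem_nhds h1)] with n hn
    exact (Set.indicator_of_mem (show thirdMomentum m β q ∈ s n from hn.le)
      fun _ => (1 : ℝ)).symm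

/-- For `z < 0` the threshold `t₀ = z` works with no cut-off at all. -/
theorem domain_opM_eq_top (hαβ : α ≠ β) (hu : IsWeight u) (hu' : IsWeight u')
    (huv : (fun x => Real.sqrt |v α x|) =ᵐ[volume] u)
    (huv' : (fun x => Real.sqrt |v β x|) =ᵐ[volume] u')
    (hζ : ∀ γ, IsAuxFunction (τ γ) (μ γ) (ζ γ)) (hz : z < 0) :
    (opM m hm v ζ α β z).domain = ⊤ := by
  refine (Submodule.eq_top_iff').2 fun f => ?_
  have h := mulL2_mem_domain_opM hm hαβ hu hu' huv huv' hζ hz.le MeasurableSet.univ hz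
    (fun p _ => by
      have := redMassThird_pos m hm β
      have : 0 ≤ ‖p‖ ^ 2 / (2 * redMassThird m β) := by positivity
      linarith) f
  convert h
  apply Lp.ext
  filter_upwards [coeFn_mulL2 ((BddMeas.indicator_one MeasurableSet.univ).comp
    (measurable_thirdMomentum m hm β)) f] with q hq
  rw [hq]
  simp

theorem isCompactPMap_opM (hαβ : α ≠ β) (hu : IsWeight u) (hu' : IsWeight u')
    (huv : (fun x => Real.sqrt |v α x|) =ᵐ[volume] u)
    (huv' : (fun x => Real.sqrt |v β x|) =ᵐ[volume] u')
    (hζ : ∀ γ, IsAuxFunction (τ γ) (μ γ) (ζ γ)) (hz : z ≤ 0) :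
    IsCompactPMap (opM m hm v ζ α β z) := by
  refine ⟨dense_domain_opM hm hαβ hu hu' huv huv' hζ hz, ?_⟩
  obtain ⟨a, b, hab⟩ := exists_pairMomentum_eq m hm hαβ
  have h := isSandwich_auxMultiplier hm hαβ hab (hζ α) (hζ β) hz
  obtain ⟨T, hT, hlim⟩ := h.exists_compact_limit hm hu hu' hαβ
  refine ⟨T, hT, fun f => ?_⟩
  have hf := (mem_graph_opM_auxMultiplier hm hu hu' huv huv' hζ hz hab _ _).1
    (LinearPMap.mem_graph _ f)
  exact (h.limit_eq hm hu hu' hlim hf).symm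

end Domain

end

end ThreeBody

end

theorem mainTheorem7 (m : Fin 3 → ℝ) (hm : ∀ i, 0 < m i)
    (v : Fin 3 → ThreeBody.E → ℝ)
    (hv_meas : ∀ α, AEMeasurable (v α) volume)
    (hv_nonpos : ∀ α, ∀ᵐ x, v α x ≤ 0)
    (hv_decay : ∀ α, ∃ C b : ℝ, 4 < b ∧ ∀ᵐ x, |v α x| ≤ C * (1 + ‖x‖) ^ (-b))
    (τ μ : Fin 3 → ℝ) (ζ : Fin 3 → ℝ → ℝ)
    (hζ : ∀ α, ThreeBody.IsAuxFunction (τ α) (μ α) (ζ α))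
    (α β : Fin 3) (hαβ : α ≠ β) :
    ∀ z : ℝ, z ≤ 0 →
      ThreeBody.IsCompactPMap (ThreeBody.opM m hm v ζ α β z) ∧
      (z < 0 → (ThreeBody.opM m hm v ζ α β z).domain = ⊤) := by
  intro z hz
  obtain ⟨C, b, hb, hd⟩ := hv_decay α
  obtain ⟨C', b', hb', hd'⟩ := hv_decay β
  obtain ⟨u, hu, huv⟩ := ThreeBody.exists_isWeight (hv_meas α) hb hd
  obtain ⟨u', hu', huv'⟩ := ThreeBody.exists_isWeight (hv_meas β) hb' hd'
  exact ⟨ThreeBody.isCompactPMap_opM hm hαβ hu hu' huv huv' hζ hz,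
    ThreeBody.domain_opM_eq_top hm hαβ hu hu' huv huv' hζ⟩
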